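/- A \emph{switch graph} is a finite set $V$ of vertices with two maps $s_0,s_1\colon V\to V$, regarded as a directed graph with edges $v\to s_0(v)$ and $v\to s_1(v)$; it is \emph{acyclic} if it has no directed cycles aside from self-loops. Every vertex carries a switch, initially in state $0$. A ball at a vertex $v$ whose switch is in state $i\in\{0,1\}$ moves to $s_i(v)$, and the switch at $v$ is toggled. Balls are released sequentially from a vertex $s$, each once the previous one has come to rest, that is, has arrived at a vertex $v$ with $s_0(v)=s_1(v)=v$; the switches are not reset between balls. The problem $\textsc{Digicomp}_{\mathsf{EXP}}$ is: given an acyclic switch graph, a starting vertex $s$, a destination vertex $t$, and a number $T$ of balls encoded in binary, decide whether at least one of the $T$ balls released from $s$ ever reaches $t$. Let $\mathsf{PL}$ be the class of languages $L\subseteq\{0,1\}^*$ for which there is a coin-tossing Turing machine working in space $O(\log n)$ that halts within a polynomial number of steps for all outcomes of its coin tosses and accepts an input $x$ with probability greater than $1/2$ if and only if $x\in L$. Then $\textsc{Digicomp}_{\mathsf{EXP}}$ is $\mathsf{PL}$-hard: for every $L\in\mathsf{PL}$ there is a function $f$, computable by a deterministic Turing machine with a read-only input tape, a write-only output tape and work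 space $O(\log n)$, that maps every $x\in\{0,1\}^*$ to the encoding of an instance of $\textsc{Digicomp}_{\mathsf{EXP}}$ such that $x\in L$ if and only if $f(x)$ encodes a yes-instance. -/

import Mathlib

/-! ## Turing machines with a read-only input tape, work tapes and a write-only output -/

/-- What the input head sees: a bit of the input or one of the two end markers. -/
inductive InputSymbol : Type
  | leftEnd : InputSymbol
  | bit : Bool → InputSymbol
  | rightEnd : InputSymbol

/-- Head movements. -/
inductive HeadMove : Type
  | left : HeadMove
  | stay : HeadMove
  | right : HeadMove

/-- A head movement on a one-way infinite tape; moving left from cell `0` has no effect. -/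
def HeadMove.apply : HeadMove → ℕ → ℕ
  | HeadMove.left, i => i - 1
  | HeadMove.stay, i => i
  | HeadMove.right, i => i + 1

/-- The input `x` is written between two end markers: position `0` carries the left end marker,
positions `1, …, x.length` carry the bits of `x`, and the next position the right end marker. -/
def inputSymbolAt (x : List Bool) : ℕ → InputSymbol
  | 0 => InputSymbol.leftEnd
  | i + 1 => if h : i < x.length then InputSymbol.bit (x[i]'h) else InputSymbol.rightEnd

/-- What a machine does in one step. -/
structure MachineAction (Tape State Symbol : Type) where
  /-- the new state -/
  next : State
  /-- the movement of the input head -/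
  inputMove : HeadMove
  /-- the symbol written on each work tape -/
  write : Tape → Symbol
  /-- the movement of the head of each work tape, after writing -/
  move : Tape → HeadMove
  /-- the bit appended to the output, if any -/
  output : Option Bool

/-- A multi-tape Turing machine with a two-way read-only input tape holding a bit string, finitely
many work tapes (indexed by `Tape`) and a one-way write-only output tape.  At every step it
receives an element of `C`: machines with `C = Unit` are deterministic, and machines with
`C = Bool` are coin-tossing. -/
structure Machine (C : Type) where
  /-- the index set of the work tapes -/
  Tape : Type
  /-- the states of the finite control -/
  State : Type
  /-- the alphabet of the work tapes -/
  Symbol : Type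
  finite_tape : Finite Tape
  finite_state : Finite State
  finite_symbol : Finite Symbol
  /-- the blank symbol, initially in all cells of the work tapes -/
  blank : Symbol
  /-- the initial state -/
  start : State
  /-- the halting states -/
  halting : Set State
  /-- the transition function -/
  transition : State → InputSymbol → (Tape → Symbol) → C → MachineAction Tape State Symbol

namespace Machine

variable {C : Type}

/-- A configuration of a machine. -/
structure Config (M : Machine C) where
  state : M.State
  inputHead : ℕ
  head : M.Tape → ℕ
  cell : M.Tape → ℕ → M.Symbol
  output : List Bool

/-- The initial configuration. -/
def init (M : Machine C) : M.Config where
  state := M.start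
  inputHead := 0
  head := fun _ => 0
  cell := fun _ _ => M.blank
  output := []

/-- The action taken in a non-halting configuration on input `x`. -/
def action (M : Machine C) (x : List Bool) (γ : M.Config) (c : C) :
    MachineAction M.Tape M.State M.Symbol :=
  M.transition γ.state (inputSymbolAt x γ.inputHead) (fun i => γ.cell i (γ.head i)) c

open Classical in
/-- One step on input `x`; configurations in a halting state do not change any more.  The input
head cannot leave the input together with its two end markers. -/
noncomputable def step (M : Machine C) (x : List Bool) (γ : M.Config) (c : C) : M.Config :=
  if γ.state ∈ M.halting then γ
  else
    { state := (M.action x γ c).next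
      inputHead := min ((M.action x γ c).inputMove.apply γ.inputHead) (x.length + 1)
      head := fun i => ((M.action x γ c).move i).apply (γ.head i)
      cell := fun i => Function.update (γ.cell i) (γ.head i) ((M.action x γ c).write i)
      output := γ.output ++ (M.action x γ c).output.toList }

/-- The configuration reached on input `x` after the steps in which the machine receives the
elements of the list `cs`, in this order. -/
noncomputable def run (M : Machine C) (x : List Bool) (cs : List C) : M.Config :=
  cs.foldl (M.step x) M.init

/-- The machine has halted on input `x` after the steps given by `cs`. -/
def HaltsAfter (M : Machine C) (x : List Bool) (cs : List C) : Prop :=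
  (M.run x cs).state ∈ M.halting

/-- The machine works in space `O(log n)`: on inputs of length `n`, in all computations, the work
tape heads visit only the first `c * (⌊log₂ n⌋ + 1)` cells.  Input and output are not counted. -/
def IsLogSpace (M : Machine C) : Prop :=
  ∃ c : ℕ, ∀ (x : List Bool) (cs : List C) (i : M.Tape),
    (M.run x cs).head i < c * (Nat.log 2 x.length + 1)

/-- The probability that, after `T` steps with independent fair coin tosses on input `x`, the
machine is in a state that belongs to `accept`. -/
noncomputable def acceptProb (M : Machine Bool) (accept : Set M.State) (x : List Bool) (T : ℕ) :
    ℚ :=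
  (Nat.card {ω : Fin T → Bool // (M.run x (List.ofFn ω)).state ∈ accept} : ℚ) / 2 ^ T

end Machine

/-! ## The class PL and log-space reductions -/

/-- The class PL: the languages `L` for which there is a coin-tossing machine that works in
logarithmic space, halts within polynomially many steps whatever the coin tosses are, and accepts
an input with probability greater than `1 / 2` if and only if the input belongs to `L`. -/
def PL : Set (Language Bool) :=
  {L | ∃ (M : Machine Bool) (accept : Set M.State) (p : Polynomial ℕ),
    M.IsLogSpace ∧
    (∀ (x : List Bool) (cs : List Bool), cs.length = p.eval x.length → M.HaltsAfter x cs) ∧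
    ∀ x : List Bool, x ∈ L ↔ 1 / 2 < M.acceptProb accept x (p.eval x.length)}

/-- A function on bit strings is log-space computable if some deterministic machine working in
logarithmic space halts on every input with the value of the function as its output. -/
def LogSpaceComputable (f : List Bool → List Bool) : Prop :=
  ∃ M : Machine Unit, M.IsLogSpace ∧
    ∀ x : List Bool, ∃ t : ℕ, M.HaltsAfter x (List.replicate t ()) ∧
      (M.run x (List.replicate t ())).output = f x

/-- A decision problem, given by the encodings of its yes-instances and of its no-instances
(strings that do not encode an instance belong to neither set). -/
structure DecisionProblem where
  yes : Language Bool
  no : Language Bool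

/-- Many-one log-space reducibility of a language to a decision problem.  Every string has to be
sent to the encoding of an actual instance. -/
def LogSpaceReducible (L : Language Bool) (P : DecisionProblem) : Prop :=
  ∃ f : List Bool → List Bool, LogSpaceComputable f ∧
    ∀ x : List Bool, (x ∈ L → f x ∈ P.yes) ∧ (x ∉ L → f x ∈ P.no)

/-- A decision problem is PL-hard if all languages in PL are log-space reducible to it. -/
def PLHard (P : DecisionProblem) : Prop :=
  ∀ L ∈ PL, LogSpaceReducible L P

/-! ## Switch graphs -/

/-- A switch graph on the vertex set `V`. -/
structure SwitchGraph (V : Type) where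
  s₀ : V → V
  s₁ : V → V

namespace SwitchGraph

variable {V : Type}

/-- There is an edge from `u` to `v` which is not a self-loop. -/
def ProperEdge (G : SwitchGraph V) (u v : V) : Prop :=
  u ≠ v ∧ (v = G.s₀ u ∨ v = G.s₁ u)

/-- There are no directed cycles aside from self-loops. -/
def Acyclic (G : SwitchGraph V) : Prop :=
  ∀ v : V, ¬ Relation.TransGen G.ProperEdge v v

/-- A vertex that cannot be left: a ball that arrives there is at rest. -/
def IsLeaf (G : SwitchGraph V) (v : V) : Prop :=
  G.s₀ v = v ∧ G.s₁ v = v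

/-- The vertex to which a ball at `v` moves if the switches are in the states `σ`
(`false` is state `0` and `true` is state `1`). -/
def next (G : SwitchGraph V) (σ : V → Bool) (v : V) : V :=
  if σ v then G.s₁ v else G.s₀ v

/-- `G.BallAt s i v σ`: if balls are released one after the other from `s`, each one as soon as
the previous one is at rest, then at some moment ball number `i` (the first one being number `0`)
is at the vertex `v` while the switches are in the states `σ`.  All switches are initially in
state `0`, and the switch at a vertex is toggled whenever a ball leaves that vertex, along a
self-loop or not. -/
inductive BallAt [DecidableEq V] (G : SwitchGraph V) (s : V) : ℕ → V → (V → Bool) → Prop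
  | first : BallAt G s 0 s (fun _ => false)
  | move {i : ℕ} {v : V} {σ : V → Bool} (h : BallAt G s i v σ) (hv : ¬ G.IsLeaf v) :
      BallAt G s i (G.next σ v) (Function.update σ v (!σ v))
  | release {i : ℕ} {v : V} {σ : V → Bool} (h : BallAt G s i v σ) (hv : G.IsLeaf v) :
      BallAt G s (i + 1) s σ

/-- After `T` balls are released sequentially from `s`, at least one of them reaches `t`. -/
def SomeBallReaches [DecidableEq V] (G : SwitchGraph V) (s t : V) (T : ℕ) : Prop :=
  ∃ i < T, ∃ σ : V → Bool, G.BallAt s i t σ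

end SwitchGraph

/-! ## The problem -/

/-- An instance: an acyclic switch graph on the vertices `0, …, size - 1`, a starting vertex, a
destination vertex and a number of balls. -/
structure DigicompInstance where
  size : ℕ
  graph : SwitchGraph (Fin size)
  acyclic : graph.Acyclic
  source : Fin size
  target : Fin size
  balls : ℕ

/-- Self-delimiting binary encoding of a natural number: every binary digit, the least significant
one first, is preceded by `true`, and the end is marked by `false`. -/
def encodeBinary (n : ℕ) : List Bool :=
  n.bits.flatMap (fun b => [true, b]) ++ [false]

/-- The encoding of an instance: the number of vertices, the starting vertex, the destination
vertex, the number of balls (in binary), and the list of the pairs `(s₀ v, s₁ v)`. -/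
def DigicompInstance.encode (I : DigicompInstance) : List Bool :=
  encodeBinary I.size ++ encodeBinary I.source ++ encodeBinary I.target ++ encodeBinary I.balls ++
    (List.finRange I.size).flatMap
      (fun v => encodeBinary (I.graph.s₀ v) ++ encodeBinary (I.graph.s₁ v))

/-- It is a yes-instance if some ball reaches the destination. -/
def DigicompInstance.IsYes (I : DigicompInstance) : Prop :=
  I.graph.SomeBallReaches I.source I.target I.balls

/-- The problem Digicomp with the number of balls encoded in binary. -/
def DigicompEXP : DecisionProblem where
  yes := {w | ∃ I : DigicompInstance, I.encode = w ∧ I.IsYes}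
  no := {w | ∃ I : DigicompInstance, I.encode = w ∧ ¬ I.IsYes}

/-! Let `M` be a coin-tossing machine for the language and `T` a number of steps after which it has
certainly halted on `x`. Unroll `M` into a layered graph whose vertices are configurations with a
time stamp and whose two edges are the outcomes of the coin. If `2 ^ T` balls are released, a vertex
of layer `n < T` is visited `2 ^ (T - n)` times for each walk leading to it. This number is even, so
the switch splits the balls exactly in half, and the deterministic process enumerates all coin
sequences (`SwitchGraph.flow_eq_paths`). All accepting branches are merged into one vertex of layer
`T`, which therefore receives exactly the number `A` of accepting coin sequences
(`Coding.flow_chain_zero`, `Coding.walk_eq_chain_iff`).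

It remains to test whether `A > 2 ^ (T - 1)`. A chain of `T` vertices does so: edge 0 passes on half
of the balls, rounded up, so that vertex number `τ` of the chain receives `⌈A / 2 ^ τ⌉` balls, and
the last vertex sends half of its balls, rounded down, along edge 1 to the target. The target is
reached if and only if `⌈A / 2 ^ (T - 1)⌉ ≥ 2` (`Coding.flow_target_pos_iff`). The dynamics enters
only through a conservation law for the numbers of visits (`SwitchGraph.exists_flow`).

The instance has to be printed in logarithmic space. A vertex is a list of four sections of `L`
digits in base `2 ^ K`: the cells of the work tapes with head marks, the control state, the position
of the input head, and the time. Digits are stored with the least significant one first, which is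
also the order in which numbers are encoded; hence a successor, being a local rewriting together
with some increments and decrements, is printed during a single pass from left to right. The time
bound is `T = (2 ^ K) ^ L`, so that the time section overflows exactly at the end. `K` depends on
the machine only, and `L` is a constant multiple of the number of digits of `x.length + 1`, large
enough for the space bound and for the polynomial time bound (`Coding.mul_log_le_sectionLength`,
`Coding.pow_le_pow_sectionLength`). A leading bit gives all vertices that are heads of edges
encodings of the same length; the numbers without it are additional copies that no edge enters.

Sweeping machines separate this algorithm from the details of Turing machines:
`Sweeper.logSpaceComputable` is proved once, and `Coding.reaches_done` composes the sweeps. Most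
lists of digits represent no configuration. The layers are defined for all lists, so acyclicity
needs no notion of a well-formed vertex, and `Coding.chain_of_flow_pos` shows that malformed chain
vertices receive no balls. -/

instance : Finite InputSymbol := by
  refine Finite.of_surjective (α := Option (Option Bool))
    (fun o => match o with
      | none => InputSymbol.leftEnd
      | some none => InputSymbol.rightEnd
      | some (some b) => InputSymbol.bit b) ?_
  rintro (_ | b | _)
  · exact ⟨none, rfl⟩
  · exact ⟨some (some b), rfl⟩
  · exact ⟨some none, rfl⟩

instance : Finite HeadMove := by
  refine Finite.of_surjective (α := Fin 3)
    (fun i => match i with | 0 => .left | 1 => .stay | 2 => .right) ?_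
  rintro (_ | _ | _)
  exacts [⟨0, rfl⟩, ⟨1, rfl⟩, ⟨2, rfl⟩]

/-! ## Traces of deterministic machines -/

namespace Machine

/-- A deterministic computation from one configuration to another during which all work tape heads
stay below the bound `b`. -/
inductive Trace (M : Machine Unit) (x : List Bool) (b : ℕ) : M.Config → M.Config → Prop
  | refl {γ : M.Config} (h : ∀ i, γ.head i < b) : Trace M x b γ γ
  | head {γ γ' : M.Config} (h : ∀ i, γ.head i < b) (t : Trace M x b (M.step x γ ()) γ') :
      Trace M x b γ γ'

namespace Trace

variable {M : Machine Unit} {x : List Bool} {b : ℕ} {γ γ' γ'' : M.Config}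

theorem trans (h : Trace M x b γ γ') (h' : Trace M x b γ' γ'') : Trace M x b γ γ'' := by
  induction h with
  | refl _ => exact h'
  | head h _ ih => exact head h (ih h')

theorem step (h : ∀ i, γ.head i < b) (hs : M.step x γ () = γ') (h' : ∀ i, γ'.head i < b) :
    Trace M x b γ γ' := by
  subst hs
  exact head h (refl h')

theorem exists_run (h : Trace M x b γ γ') :
    ∃ t : ℕ, (List.replicate t ()).foldl (M.step x) γ = γ' := by
  induction h with
  | refl _ => exact ⟨0, rfl⟩
  | head _ _ ih =>
    obtain ⟨t, ht⟩ := ih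
    exact ⟨t + 1, by rw [List.replicate_succ, List.foldl_cons, ht]⟩

/-- `Machine.IsLogSpace` bounds runs of every length: a short run is a prefix of the trace, and a
longer one stays in the halting configuration, which steps do not change. -/
theorem head_lt (h : Trace M x b γ γ') (hh : γ'.state ∈ M.halting) (cs : List Unit)
    (i : M.Tape) : ((cs.foldl (M.step x) γ).head i) < b := by
  induction h generalizing cs with
  | @refl γ h =>
    have : cs.foldl (M.step x) γ = γ := by
      induction cs with
      | nil => rfl
      | cons c cs ih =>
        rw [List.foldl_cons, show M.step x γ c = γ by rw [Machine.step, if_pos hh]]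
        exact ih
    rw [this]
    exact h i
  | head h _ ih =>
    cases cs with
    | nil => exact h i
    | cons c cs => exact ih hh cs

end Trace

/-- A function is log-space computable if some machine has traces of logarithmic width that compute
its values. -/
theorem logSpaceComputable_of_trace {f : List Bool → List Bool} (M : Machine Unit) (c : ℕ)
    (h : ∀ x : List Bool, ∃ γ : M.Config, Trace M x (c * (Nat.log 2 x.length + 1)) M.init γ ∧
      γ.state ∈ M.halting ∧ γ.output = f x) : LogSpaceComputable f := by
  refine ⟨M, ⟨c, fun x cs i => ?_⟩, fun x => ?_⟩
  · obtain ⟨γ, hγ, hh, -⟩ := h x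
    exact hγ.head_lt hh cs i
  · obtain ⟨γ, hγ, hh, ho⟩ := h x
    obtain ⟨t, ht⟩ := hγ.exists_run
    refine ⟨t, ?_, ?_⟩
    · rw [HaltsAfter, run, ht]
      exact hh
    · rw [run, ht]
      exact ho

end Machine

/-! ## Sweeping machines -/

/-- A machine that works in sweeps over a single tape holding a list of symbols.  A sweep starts
with a look at the input symbol, visits the symbols of the list from left to right, each one
together with its right neighbour, rewrites them, may append a symbol to the list, and ends with a
movement of the input head.  The type `Mem` is the memory of the finite control. -/
structure Sweeper (Mem Γ : Type) where
  start : Mem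
  halting : Set Mem
  enter : Mem → InputSymbol → Mem
  visit : Mem → Γ → Option Γ → Mem × Γ × List Bool
  finish : Mem → Mem × Option Γ × List Bool
  inputMove : Mem → HeadMove

namespace Sweeper

variable {Mem Γ : Type}

/-- The final memory, the new list and the output of a sweep. -/
def sweep (S : Sweeper Mem Γ) : Mem → List Γ → Mem × List Γ × List Bool
  | μ, [] => ((S.finish μ).1, (S.finish μ).2.1.toList, (S.finish μ).2.2)
  | μ, g :: l =>
    ((S.sweep (S.visit μ g l.head?).1 l).1,
      (S.visit μ g l.head?).2.1 :: (S.sweep (S.visit μ g l.head?).1 l).2.1,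
      (S.visit μ g l.head?).2.2 ++ (S.sweep (S.visit μ g l.head?).1 l).2.2)

/-- A configuration between two sweeps. -/
structure Conf (S : Sweeper Mem Γ) where
  mem : Mem
  pos : ℕ
  tape : List Γ
  out : List Bool

/-- The result of a sweep on input `x`. -/
def next (S : Sweeper Mem Γ) (x : List Bool) (c : S.Conf) : S.Conf where
  mem := (S.sweep (S.enter c.mem (inputSymbolAt x c.pos)) c.tape).1
  pos := min ((S.inputMove (S.sweep (S.enter c.mem (inputSymbolAt x c.pos)) c.tape).1).apply c.pos)
    (x.length + 1)
  tape := (S.sweep (S.enter c.mem (inputSymbolAt x c.pos)) c.tape).2.1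
  out := c.out ++ (S.sweep (S.enter c.mem (inputSymbolAt x c.pos)) c.tape).2.2

/-- `S.Reaches x n c c'`: the machine gets from `c` to `c'` by sweeps, and the list never has more
than `n` elements. -/
inductive Reaches (S : Sweeper Mem Γ) (x : List Bool) (n : ℕ) : S.Conf → S.Conf → Prop
  | refl {c : S.Conf} (h : c.tape.length ≤ n) : Reaches S x n c c
  | head {c c' : S.Conf} (h : c.tape.length ≤ n) (hc : c.mem ∉ S.halting)
      (t : Reaches S x n (S.next x c) c') : Reaches S x n c c'

theorem Reaches.trans {S : Sweeper Mem Γ} {x : List Bool} {n : ℕ} {c c' c'' : S.Conf}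
    (h : S.Reaches x n c c') (h' : S.Reaches x n c' c'') : S.Reaches x n c c'' := by
  induction h with
  | refl _ => exact h'
  | head h hc _ ih => exact head h hc (ih h')

theorem Reaches.le {S : Sweeper Mem Γ} {x : List Bool} {n : ℕ} {c c' : S.Conf}
    (h : S.Reaches x n c c') : c.tape.length ≤ n := by
  cases h <;> assumption

theorem Reaches.mono {S : Sweeper Mem Γ} {x : List Bool} {n n' : ℕ} {c c' : S.Conf}
    (h : S.Reaches x n c c') (hn : n ≤ n') : S.Reaches x n' c c' := by
  induction h with
  | refl h => exact .refl (h.trans hn)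
  | head h hc _ ih => exact .head (h.trans hn) hc ih

theorem Reaches.single {S : Sweeper Mem Γ} {x : List Bool} {n : ℕ} {c c' : S.Conf}
    (h : c.tape.length ≤ n) (hc : c.mem ∉ S.halting) (hn : S.next x c = c')
    (h' : c'.tape.length ≤ n) : S.Reaches x n c c' := by
  subst hn
  exact .head h hc (.refl h')

/-- Bounded output buffers. -/
abbrev Buffer (R : ℕ) : Type := {l : List Bool // l.length ≤ R}

/-- The first `R` elements of a list, as a buffer. -/
def Buffer.mk (R : ℕ) (l : List Bool) : Buffer R := ⟨l.take R, by simp⟩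

instance (R : ℕ) : Finite (Buffer R) := List.finite_length_le Bool R

/-- The states of the Turing machine that simulates a sweeping machine. -/
inductive TMState (Mem Γ : Type) (R : ℕ) : Type
  | boot : TMState Mem Γ R
  | start : Mem → TMState Mem Γ R
  | scan : Mem → TMState Mem Γ R
  | peek : Mem → Γ → TMState Mem Γ R
  | put : Mem → Γ → Buffer R → TMState Mem Γ R
  | emit : Mem → Buffer R → TMState Mem Γ R
  | emitEnd : Mem → Buffer R → TMState Mem Γ R
  | rewind : Mem → TMState Mem Γ R

instance {Mem Γ : Type} {R : ℕ} [Finite Mem] [Finite Γ] : Finite (TMState Mem Γ R) := by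
  refine Finite.of_surjective
    (α := Unit ⊕ Mem ⊕ Mem ⊕ (Mem × Γ) ⊕ (Mem × Γ × Buffer R) ⊕ (Mem × Buffer R) ⊕
      (Mem × Buffer R) ⊕ Mem)
    (fun s => match s with
      | .inl _ => .boot
      | .inr (.inl μ) => .start μ
      | .inr (.inr (.inl μ)) => .scan μ
      | .inr (.inr (.inr (.inl p))) => .peek p.1 p.2
      | .inr (.inr (.inr (.inr (.inl p)))) => .put p.1 p.2.1 p.2.2
      | .inr (.inr (.inr (.inr (.inr (.inl p))))) => .emit p.1 p.2
      | .inr (.inr (.inr (.inr (.inr (.inr (.inl p)))))) => .emitEnd p.1 p.2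
      | .inr (.inr (.inr (.inr (.inr (.inr (.inr μ)))))) => .rewind μ) ?_
  rintro (_ | μ | μ | ⟨μ, g⟩ | ⟨μ, g, l⟩ | ⟨μ, l⟩ | ⟨μ, l⟩ | μ)
  exacts [⟨.inl (), rfl⟩, ⟨.inr (.inl μ), rfl⟩, ⟨.inr (.inr (.inl μ)), rfl⟩,
    ⟨.inr (.inr (.inr (.inl (μ, g)))), rfl⟩, ⟨.inr (.inr (.inr (.inr (.inl (μ, g, l))))), rfl⟩,
    ⟨.inr (.inr (.inr (.inr (.inr (.inl (μ, l)))))), rfl⟩,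
    ⟨.inr (.inr (.inr (.inr (.inr (.inr (.inl (μ, l))))))), rfl⟩,
    ⟨.inr (.inr (.inr (.inr (.inr (.inr (.inr μ)))))), rfl⟩]

/-- The action of a machine with one work tape. -/
def act {St Sy : Type} (q : St) (w : Sy) (mv : HeadMove) (o : Option Bool := none)
    (im : HeadMove := .stay) : MachineAction Unit St Sy where
  next := q
  inputMove := im
  write := fun _ => w
  move := fun _ => mv
  output := o

/-- The transition function of the simulating Turing machine.  The symbol `none` is the blank and
`some none` marks the left end of the tape. -/
def transition (S : Sweeper Mem Γ) (R : ℕ) : TMState Mem Γ R → InputSymbol → Option (Option Γ) →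
    MachineAction Unit (TMState Mem Γ R) (Option (Option Γ))
  | .boot, _, _ => act (.start S.start) (some none) .right
  | .start μ, a, s => act (.scan (S.enter μ a)) s .stay
  | .scan μ, _, some (some g) => act (.peek μ g) (some (some g)) .right
  | .scan μ, _, _ =>
    act (.emitEnd (S.finish μ).1 (.mk R (S.finish μ).2.2)) ((S.finish μ).2.1.map some) .stay
  | .peek μ g, _, s =>
    act (.put (S.visit μ g s.join).1 (S.visit μ g s.join).2.1 (.mk R (S.visit μ g s.join).2.2))
      s .left
  | .put μ g l, _, _ => act (.emit μ l) (some (some g)) .stay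
  | .emit μ ⟨[], _⟩, _, s => act (.scan μ) s .right
  | .emit μ ⟨b :: l, h⟩, _, s =>
    act (.emit μ ⟨l, (Nat.le_succ _).trans h⟩) s .stay (some b)
  | .emitEnd μ ⟨[], _⟩, _, s => act (.rewind μ) s .left
  | .emitEnd μ ⟨b :: l, h⟩, _, s =>
    act (.emitEnd μ ⟨l, (Nat.le_succ _).trans h⟩) s .stay (some b)
  | .rewind μ, _, some none => act (.start μ) (some none) .right none (S.inputMove μ)
  | .rewind μ, _, s => act (.rewind μ) s .left

/-- The Turing machine that simulates a sweeping machine. -/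
def toMachine (S : Sweeper Mem Γ) [Finite Mem] [Finite Γ] (R : ℕ) : Machine Unit where
  Tape := Unit
  State := TMState Mem Γ R
  Symbol := Option (Option Γ)
  finite_tape := inferInstance
  finite_state := inferInstance
  finite_symbol := inferInstance
  blank := none
  start := .boot
  halting := {q | ∃ μ ∈ S.halting, q = .start μ}
  transition := fun q a s _ => S.transition R q a (s ())

/-- The contents of the tape that represents the list `l`. -/
def tapeCells (l : List Γ) : ℕ → Option (Option Γ)
  | 0 => some none
  | k + 1 => l[k]?.map some

theorem update_tapeCells_append (l : List Γ) (o : Option Γ) :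
    Function.update (tapeCells l) (l.length + 1) (o.map some) = tapeCells (l ++ o.toList) := by
  funext k
  rcases k with _ | k
  · simp [tapeCells]
  · rcases eq_or_ne k l.length with rfl | hk
    · cases o <;> simp [tapeCells]
    · rw [Function.update_of_ne (by simpa using hk)]
      cases o with
      | none => simp
      | some g =>
        simp only [tapeCells, Option.toList_some, List.getElem?_append]
        split_ifs with h
        · rfl
        · rw [List.getElem?_eq_none (by omega),
            List.getElem?_eq_none (by simp; omega)]

theorem update_tapeCells_middle (l l' : List Γ) (g g' : Γ) :
    Function.update (tapeCells (l ++ g :: l')) (l.length + 1) (some (some g')) =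
      tapeCells (l ++ g' :: l') := by
  funext k
  rcases k with _ | k
  · simp [tapeCells]
  · rcases lt_trichotomy k l.length with hk | rfl | hk
    · rw [Function.update_of_ne (by omega)]
      simp [tapeCells, List.getElem?_append_left hk]
    · simp [tapeCells]
    · rw [Function.update_of_ne (by omega)]
      obtain ⟨j, rfl⟩ : ∃ j, k = l.length + 1 + j := ⟨k - l.length - 1, by omega⟩
      rw [tapeCells, tapeCells, List.getElem?_append_right (by omega),
        List.getElem?_append_right (by omega), show l.length + 1 + j - l.length = j + 1 by omega]
      rfl

theorem tapeCells_length_succ (l : List Γ) : tapeCells l (l.length + 1) = none := by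
  simp [tapeCells]

theorem tapeCells_middle (l l' : List Γ) (g : Γ) :
    tapeCells (l ++ g :: l') (l.length + 1) = some (some g) := by
  simp [tapeCells]

theorem tapeCells_middle_succ (l l' : List Γ) (g : Γ) :
    (tapeCells (l ++ g :: l') (l.length + 1 + 1)).join = l'.head? := by
  cases l' <;> simp [tapeCells]

section Simulation

variable (S : Sweeper Mem Γ) [Finite Mem] [Finite Γ] {R : ℕ} {x : List Bool}

/-- The configuration of the simulating machine with the given components. -/
def config (R : ℕ) (q : TMState Mem Γ R) (p h : ℕ) (l : List Γ) (o : List Bool) :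
    (S.toMachine R).Config where
  state := q
  inputHead := p
  head := fun _ => h
  cell := fun _ => tapeCells l
  output := o

/-- A step of the simulating machine. -/
theorem trace_config {b p p' h h' : ℕ} {l l' : List Γ} {o o' : List Bool}
    {q q' : TMState Mem Γ R} {w : Option (Option Γ)} {mv im : HeadMove} {ob : Option Bool}
    (hq : ∀ μ, q = .start μ → μ ∉ S.halting)
    (ha : S.transition R q (inputSymbolAt x p) (tapeCells l h) = act q' w mv ob im)
    (hp : min (im.apply p) (x.length + 1) = p') (hh : mv.apply h = h')
    (hl : Function.update (tapeCells l) h w = tapeCells l') (ho : o ++ ob.toList = o')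
    (hb : h < b) (hb' : h' < b) :
    Machine.Trace (S.toMachine R) x b (S.config R q p h l o) (S.config R q' p' h' l' o') := by
  refine Machine.Trace.step (fun _ => hb) ?_ (fun _ => hb')
  have hn : (S.config R q p h l o).state ∉ (S.toMachine R).halting := by
    rintro ⟨μ, hμ, h⟩
    exact hq μ h hμ
  have hact : (S.toMachine R).action x (S.config R q p h l o) () = act q' w mv ob im := ha
  rw [Machine.step, if_neg hn, hact]
  simp only [act, config, hp, hh, ho]
  congr 1
  exact funext fun _ => hl

/-- A step outputs at most one bit, so the output of a visit is unloaded from the buffer bit by bit;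
the head moves on only when the buffer is empty. -/
theorem trace_emit {b p h : ℕ} {l : List Γ} (μ : Mem) (bits : List Bool)
    (hR : bits.length ≤ R) (o : List Bool) (hp : p ≤ x.length + 1) (hb : h + 1 < b) :
    Machine.Trace (S.toMachine R) x b (S.config R (.emit μ ⟨bits, hR⟩) p h l o)
      (S.config R (.scan μ) p (h + 1) l (o ++ bits)) := by
  induction bits generalizing o with
  | nil =>
    exact S.trace_config (by simp) rfl (by simpa [HeadMove.apply] using hp) rfl
      (Function.update_eq_self _ _) (by simp) (by omega) hb
  | cons c bits ih =>
    have := ih ((Nat.le_succ _).trans hR) (o ++ [c])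
    rw [List.append_assoc, List.singleton_append] at this
    refine Machine.Trace.trans ?_ this
    exact S.trace_config (by simp) rfl (by simpa [HeadMove.apply] using hp) rfl
      (Function.update_eq_self _ _) (by simp) (by omega) (by omega)

theorem trace_emitEnd {b p h : ℕ} {l : List Γ} (μ : Mem) (bits : List Bool)
    (hR : bits.length ≤ R) (o : List Bool) (hp : p ≤ x.length + 1) (hb : h < b) :
    Machine.Trace (S.toMachine R) x b (S.config R (.emitEnd μ ⟨bits, hR⟩) p h l o)
      (S.config R (.rewind μ) p (h - 1) l (o ++ bits)) := by
  induction bits generalizing o with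
  | nil =>
    exact S.trace_config (by simp) rfl (by simpa [HeadMove.apply] using hp) rfl
      (Function.update_eq_self _ _) (by simp) (by omega) (by omega)
  | cons c bits ih =>
    have := ih ((Nat.le_succ _).trans hR) (o ++ [c])
    rw [List.append_assoc, List.singleton_append] at this
    refine Machine.Trace.trans ?_ this
    exact S.trace_config (by simp) rfl (by simpa [HeadMove.apply] using hp) rfl
      (Function.update_eq_self _ _) (by simp) (by omega) hb

theorem trace_rewind {b p h : ℕ} {l : List Γ} (μ : Mem) (o : List Bool)
    (hp : p ≤ x.length + 1) (hh : h ≤ l.length) (hb : l.length + 1 < b) :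
    Machine.Trace (S.toMachine R) x b (S.config R (.rewind μ) p h l o)
      (S.config R (.start μ) (min ((S.inputMove μ).apply p) (x.length + 1)) 1 l o) := by
  induction h with
  | zero =>
    exact S.trace_config (by simp) rfl rfl rfl (Function.update_eq_self _ _) (by simp)
      (by omega) (by omega)
  | succ h ih =>
    refine Machine.Trace.trans ?_ (ih (by omega))
    have hc : tapeCells l (h + 1) = some (some l[h]) := by
      simp [tapeCells, List.getElem?_eq_getElem (show h < l.length by omega)]
    refine S.trace_config (w := some (some l[h])) (mv := .left) (ob := none) (im := .stay)
      (by simp) ?_ (by simpa [HeadMove.apply] using hp)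
      (by simp [HeadMove.apply]) ?_ (by simp) (by omega) (by omega)
    · rw [hc]
      rfl
    · rw [← hc, Function.update_eq_self]

/-- Induction on the part `l'` of the list that has not been visited. Each symbol costs a look to
the right, a return, a rewriting and the unloading of the buffer; `hv` and `hf` ensure that the
truncation to `R` bits loses nothing. -/
theorem trace_sweep {b p : ℕ} (hv : ∀ μ g n, (S.visit μ g n).2.2.length ≤ R)
    (hf : ∀ μ, (S.finish μ).2.2.length ≤ R) (l l' : List Γ) (μ : Mem) (o : List Bool)
    (hp : p ≤ x.length + 1) (hb : l.length + l'.length + 1 < b) :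
    Machine.Trace (S.toMachine R) x b
      (S.config R (.scan μ) p (l.length + 1) (l ++ l') o)
      (S.config R (.rewind (S.sweep μ l').1) p (l.length + l'.length) (l ++ (S.sweep μ l').2.1)
        (o ++ (S.sweep μ l').2.2)) := by
  induction l' generalizing l μ o with
  | nil =>
    have h2 := S.trace_emitEnd (R := R) (b := b) (h := l.length + 1)
      (l := l ++ (S.sweep μ []).2.1) (S.sweep μ []).1 (S.finish μ).2.2 (hf μ) o hp (by simpa using hb)
    refine Machine.Trace.trans ?_ h2
    simp only [List.append_nil, List.length_nil, Nat.add_zero] at hb ⊢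
    refine S.trace_config (w := (S.finish μ).2.1.map some) (mv := .stay) (ob := none)
      (im := .stay) (by simp) ?_ (by simpa [HeadMove.apply] using hp)
      (by simp [HeadMove.apply]) (update_tapeCells_append _ _) (by simp) (by omega) (by omega)
    rw [tapeCells_length_succ]
    simp [transition, Buffer.mk, List.take_of_length_le (hf μ), sweep]
  | cons g l' ih =>
    set v := S.visit μ g l'.head? with hvd
    have hvl := hv μ g l'.head?
    rw [← hvd] at hvl
    have h4 := ih (l ++ [v.2.1]) v.1 (o ++ v.2.2) (by simpa [add_assoc, add_comm 1] using hb)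
    have h3 := S.trace_emit (R := R) (b := b) (x := x) (h := l.length + 1) (l := l ++ v.2.1 :: l')
      v.1 v.2.2 hvl o hp (by simp at hb; omega)
    simp only [List.length_append, List.length_cons, List.length_nil, List.append_assoc,
      List.singleton_append, zero_add] at h4 hb
    have h5 := h3.trans h4
    have e : l.length + 1 + l'.length = l.length + (g :: l').length := by simp; omega
    rw [e] at h5
    refine Machine.Trace.trans ?_ h5
    refine Machine.Trace.trans (γ' := S.config R (.put v.1 v.2.1 ⟨v.2.2, hvl⟩) p (l.length + 1)
      (l ++ g :: l') o) (Machine.Trace.trans (γ' := S.config R (.peek μ g) p (l.length + 1 + 1)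
      (l ++ g :: l') o) ?_ ?_) ?_
    · refine S.trace_config (w := some (some g)) (mv := .right) (ob := none) (im := .stay)
        (by simp) ?_ (by simpa [HeadMove.apply] using hp) rfl
        (update_tapeCells_middle _ _ _ _) (by simp) (by omega) (by omega)
      rw [tapeCells_middle]
      rfl
    · refine S.trace_config (w := tapeCells (l ++ g :: l') (l.length + 1 + 1)) (mv := .left)
        (ob := none) (im := .stay)
        (by simp) ?_ (by simpa [HeadMove.apply] using hp) rfl
        (Function.update_eq_self _ _) (by simp) (by omega) (by omega)
      simp only [transition, tapeCells_middle_succ, ← hvd, Buffer.mk, List.take_of_length_le hvl]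
    · exact S.trace_config (w := some (some v.2.1)) (mv := .stay) (ob := none) (im := .stay)
        (by simp) rfl (by simpa [HeadMove.apply] using hp) rfl
        (update_tapeCells_middle _ _ _ _) (by simp) (by omega) (by omega)

theorem trace_next {b : ℕ} (hv : ∀ μ g n, (S.visit μ g n).2.2.length ≤ R)
    (hf : ∀ μ, (S.finish μ).2.2.length ≤ R) (c : S.Conf) (hc : c.mem ∉ S.halting)
    (hp : c.pos ≤ x.length + 1) (hb : c.tape.length + 1 < b)
    (hb' : (S.next x c).tape.length + 1 < b) :
    Machine.Trace (S.toMachine R) x b (S.config R (.start c.mem) c.pos 1 c.tape c.out)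
      (S.config R (.start (S.next x c).mem) (S.next x c).pos 1 (S.next x c).tape
        (S.next x c).out) := by
  have h1 := S.trace_sweep (x := x) (b := b) hv hf [] c.tape
    (S.enter c.mem (inputSymbolAt x c.pos)) c.out hp (by simpa using hb)
  -- A sweep never shortens the list, so the rewinding, which starts at the last cell of the old
  -- list, starts within the new one.
  have hlen : ∀ (l : List Γ) (μ : Mem), l.length ≤ (S.sweep μ l).2.1.length := by
    intro l
    induction l with
    | nil => simp
    | cons g l ih => intro μ; simp [sweep, ih]
  refine Machine.Trace.trans (Machine.Trace.trans ?_ h1)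
    (S.trace_rewind _ _ hp (by simpa using hlen _ _) (by simpa [next] using hb'))
  refine S.trace_config (mv := .stay) (ob := none) (im := .stay) (by rintro _ ⟨⟩; exact hc) rfl
    (by simpa [HeadMove.apply] using hp) rfl
    (Function.update_eq_self _ _) (by simp) (show 0 + 1 < b by omega) (show 0 + 1 < b by omega)

theorem trace_of_reaches {b n : ℕ} (hv : ∀ μ g n, (S.visit μ g n).2.2.length ≤ R)
    (hf : ∀ μ, (S.finish μ).2.2.length ≤ R) {c c' : S.Conf} (h : S.Reaches x n c c')
    (hp : c.pos ≤ x.length + 1) (hb : n + 1 < b) :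
    Machine.Trace (S.toMachine R) x b (S.config R (.start c.mem) c.pos 1 c.tape c.out)
      (S.config R (.start c'.mem) c'.pos 1 c'.tape c'.out) := by
  induction h with
  | refl h => exact Machine.Trace.refl fun _ => by simp [config]; omega
  | head h hc t ih =>
    have := t.le
    exact (S.trace_next hv hf _ hc hp (by omega) (by omega)).trans (ih (min_le_right _ _))

/-- A function is log-space computable if it is computed by a sweeping machine whose list has
logarithmic length. -/
theorem logSpaceComputable {f : List Bool → List Bool} (k : ℕ)
    (h : ∀ x : List Bool, ∃ c : S.Conf, c.mem ∈ S.halting ∧ c.out = f x ∧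
      S.Reaches x (k * (Nat.log 2 x.length + 1)) ⟨S.start, 0, [], []⟩ c) :
    LogSpaceComputable f := by
  -- Memory and alphabet are finite, so one buffer size suffices for all visits and for all ends of
  -- sweeps.
  obtain ⟨R₁, hR₁⟩ := (Set.finite_range
    fun p : Mem × Γ × Option Γ => (S.visit p.1 p.2.1 p.2.2).2.2.length).bddAbove
  obtain ⟨R₂, hR₂⟩ := (Set.finite_range fun μ : Mem => (S.finish μ).2.2.length).bddAbove
  have hv : ∀ μ g n, (S.visit μ g n).2.2.length ≤ max R₁ R₂ :=
    fun μ g n => (hR₁ ⟨(μ, g, n), rfl⟩).trans (le_max_left _ _)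
  have hf : ∀ μ, (S.finish μ).2.2.length ≤ max R₁ R₂ :=
    fun μ => (hR₂ ⟨μ, rfl⟩).trans (le_max_right _ _)
  -- The two additional units pay for the end mark in cell `0` and for the blank after the list.
  refine Machine.logSpaceComputable_of_trace (S.toMachine (max R₁ R₂)) (k + 2) fun x => ?_
  obtain ⟨c, hc, ho, hr⟩ := h x
  have hb : k * (Nat.log 2 x.length + 1) + 1 < (k + 2) * (Nat.log 2 x.length + 1) := by
    rw [add_mul]
    omega
  have := S.trace_of_reaches hv hf hr (Nat.zero_le _) hb
  refine ⟨_, Machine.Trace.trans ?_ this, ⟨c.mem, hc, rfl⟩, ho⟩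
  refine Machine.Trace.step (fun _ => by simp [Machine.init]) ?_
    (fun _ => by simp [config]; omega)
  have hn : (S.toMachine (max R₁ R₂)).init.state ∉ (S.toMachine (max R₁ R₂)).halting := by
    rintro ⟨μ, -, h⟩
    cases h
  rw [Machine.step, if_neg hn]
  simp only [config, Machine.action, Machine.init, toMachine, transition, act, HeadMove.apply]
  congr 1
  funext _ k
  rcases k with _ | k <;> simp [tapeCells]

end Simulation

end Sweeper

/-! ## Counting the balls in a switch graph -/

namespace SwitchGraph

open Finset

theorem acyclic_of_rank {V : Type} (G : SwitchGraph V) {ρ : V → ℕ}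
    (hρ : ∀ u v, G.ProperEdge u v → ρ u < ρ v) : G.Acyclic := by
  intro v h
  have : ∀ u w, Relation.TransGen G.ProperEdge u w → ρ u < ρ w := by
    intro u w h
    induction h with
    | single h => exact hρ _ _ h
    | tail _ h ih => exact ih.trans (hρ _ _ h)
  exact lt_irrefl _ (this v v h)

variable {V : Type} [DecidableEq V] (G : SwitchGraph V) (s : V)

instance (v : V) : Decidable (G.IsLeaf v) :=
  inferInstanceAs (Decidable (G.s₀ v = v ∧ G.s₁ v = v))

/-- The number of the current ball, its position and the switches after `k` moves and releases. -/
def ball : ℕ → ℕ × V × (V → Bool)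
  | 0 => (0, s, fun _ => false)
  | k + 1 =>
    if G.IsLeaf (ball k).2.1 then ((ball k).1 + 1, s, (ball k).2.2)
    else ((ball k).1, G.next (ball k).2.2 (ball k).2.1,
      Function.update (ball k).2.2 (ball k).2.1 (!(ball k).2.2 (ball k).2.1))

theorem ball_succ_of_isLeaf {k : ℕ} (h : G.IsLeaf (G.ball s k).2.1) :
    G.ball s (k + 1) = ((G.ball s k).1 + 1, s, (G.ball s k).2.2) := by
  rw [ball, if_pos h]

theorem ball_succ_of_not_isLeaf {k : ℕ} (h : ¬ G.IsLeaf (G.ball s k).2.1) :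
    G.ball s (k + 1) = ((G.ball s k).1, G.next (G.ball s k).2.2 (G.ball s k).2.1,
      Function.update (G.ball s k).2.2 (G.ball s k).2.1 (!(G.ball s k).2.2 (G.ball s k).2.1)) := by
  rw [ball, if_neg h]

/-- In every situation exactly one of the two rules applies, so the process is a sequence, and
visits can be counted by moments of time. -/
theorem ballAt_iff {i : ℕ} {v : V} {σ : V → Bool} :
    G.BallAt s i v σ ↔ ∃ k, G.ball s k = (i, v, σ) := by
  constructor
  · intro h
    induction h with
    | first => exact ⟨0, rfl⟩
    | move h hv ih =>
      obtain ⟨k, hk⟩ := ih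
      refine ⟨k + 1, ?_⟩
      rw [ball_succ_of_not_isLeaf _ _ (by rwa [hk]), hk]
    | release h hv ih =>
      obtain ⟨k, hk⟩ := ih
      refine ⟨k + 1, ?_⟩
      rw [ball_succ_of_isLeaf _ _ (by rwa [hk]), hk]
  · rintro ⟨k, hk⟩
    induction k generalizing i v σ with
    | zero =>
      obtain ⟨rfl, rfl, rfl⟩ : 0 = i ∧ s = v ∧ (fun _ => false) = σ := by simpa [ball] using hk
      exact .first
    | succ k ih =>
      have h := ih (i := (G.ball s k).1) (v := (G.ball s k).2.1) (σ := (G.ball s k).2.2) rfl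
      by_cases hl : G.IsLeaf (G.ball s k).2.1
      · rw [ball_succ_of_isLeaf _ _ hl, Prod.mk.injEq, Prod.mk.injEq] at hk
        obtain ⟨rfl, rfl, rfl⟩ := hk
        exact .release h hl
      · rw [ball_succ_of_not_isLeaf _ _ hl, Prod.mk.injEq, Prod.mk.injEq] at hk
        obtain ⟨rfl, rfl, rfl⟩ := hk
        exact .move h hl

/-- The number of visits to `w` during the first `k` moves and releases. -/
def visits (k : ℕ) (w : V) : ℕ := #{j ∈ range k | (G.ball s j).2.1 = w}

theorem visits_succ (k : ℕ) (w : V) :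
    G.visits s (k + 1) w = G.visits s k w + if (G.ball s k).2.1 = w then 1 else 0 := by
  rw [visits, range_add_one, filter_insert, visits]
  split_ifs
  · rw [card_insert_of_notMem (by simp)]
  · rfl

/-- Each completed visit to a vertex that is not a leaf ends with a toggle. Leaves are excluded
since a release does not touch the switch. -/
theorem switch_eq_odd (k : ℕ) {u : V} (hu : ¬ G.IsLeaf u) :
    (G.ball s k).2.2 u = decide (Odd (G.visits s k u)) := by
  induction k with
  | zero => simp [ball, visits]
  | succ k ih =>
    rw [visits_succ]
    by_cases hl : G.IsLeaf (G.ball s k).2.1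
    · rw [ball_succ_of_isLeaf _ _ hl, if_neg (by rintro rfl; exact hu hl)]
      simpa using ih
    · rw [ball_succ_of_not_isLeaf _ _ hl]
      by_cases h : (G.ball s k).2.1 = u
      · subst h
        simp [ih, Nat.odd_add_one, -Nat.not_odd_iff_even]
      · rw [if_neg h]
        simpa [Function.update_of_ne (Ne.symm h)] using ih

/-- The number of balls that arrive at `w` if `c u` balls leave each vertex `u`. -/
def inflow [Fintype V] (c : V → ℕ) (w : V) : ℕ :=
  ∑ u with ¬ G.IsLeaf u,
    ((if G.s₀ u = w then (c u + 1) / 2 else 0) + if G.s₁ u = w then c u / 2 else 0)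

theorem inflow_congr [Fintype V] {c c' : V → ℕ} (w : V)
    (h : ∀ u, ¬ G.IsLeaf u → c u = c' u) : G.inflow c w = G.inflow c' w := by
  refine sum_congr rfl fun u hu => ?_
  rw [h u (by simpa using hu)]

/-- Conservation of balls: an arrival at `w` is a release or a move along an edge, and since the
switch alternates, `n` departures from `u` use edge 0 `⌈n / 2⌉` times and edge 1 `⌊n / 2⌋` times.
The second summand on the left is the visit still in progress; balls are numbered from `0`, whence
the `+ 1` for the releases. -/
theorem visits_add [Fintype V] (k : ℕ) (w : V) :
    (G.visits s k w + if (G.ball s k).2.1 = w then 1 else 0) =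
      (if s = w then (G.ball s k).1 + 1 else 0) + G.inflow (G.visits s k) w := by
  induction k with
  | zero =>
    by_cases h : s = w <;> simp [inflow, visits, ball, h]
  | succ k ih =>
    by_cases hl : G.IsLeaf (G.ball s k).2.1
    · have h1 : G.inflow (G.visits s (k + 1)) w = G.inflow (G.visits s k) w := by
        refine G.inflow_congr w fun u hu => ?_
        rw [visits_succ, if_neg (by rintro rfl; exact hu hl), add_zero]
      rw [h1, visits_succ, ih, ball_succ_of_isLeaf _ _ hl]
      dsimp only
      split_ifs <;> omega
    · have h1 : G.inflow (G.visits s (k + 1)) w = G.inflow (G.visits s k) w +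
          if G.next (G.ball s k).2.2 (G.ball s k).2.1 = w then 1 else 0 := by
        -- Only the term of the vertex just left changes; the parity of its previous visits decides
        -- which of the two quotients grows.
        have : ∀ u ∈ ({u | ¬ G.IsLeaf u} : Finset V),
            ((if G.s₀ u = w then (G.visits s (k + 1) u + 1) / 2 else 0) +
              if G.s₁ u = w then G.visits s (k + 1) u / 2 else 0) =
            ((if G.s₀ u = w then (G.visits s k u + 1) / 2 else 0) +
              if G.s₁ u = w then G.visits s k u / 2 else 0) +
            if (G.ball s k).2.1 = u then
              if G.next (G.ball s k).2.2 (G.ball s k).2.1 = w then 1 else 0 else 0 := by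
          intro u hu
          rw [visits_succ]
          by_cases h : (G.ball s k).2.1 = u
          · subst h
            rw [if_pos rfl, if_pos rfl, next, switch_eq_odd _ _ _ hl]
            rcases Nat.even_or_odd (G.visits s k (G.ball s k).2.1) with he | ho
            · have hd : ¬ Odd (G.visits s k (G.ball s k).2.1) := Nat.not_odd_iff_even.2 he
              obtain ⟨m, hm⟩ := he
              simp only [hd, decide_false, Bool.false_eq_true, if_false]
              split_ifs <;> omega
            · simp only [ho, decide_true, if_true]
              obtain ⟨m, hm⟩ := ho
              split_ifs <;> omega
          · simp only [if_neg h, add_zero]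
        rw [inflow, sum_congr rfl this, sum_add_distrib, sum_ite_eq]
        simp only [inflow, mem_filter, mem_univ, true_and, hl, not_false_eq_true, if_true]
      rw [h1, visits_succ, ih, ball_succ_of_not_isLeaf _ _ hl]
      dsimp only
      split_ifs <;> omega

theorem ball_fst_le_succ (k : ℕ) : (G.ball s k).1 ≤ (G.ball s (k + 1)).1 := by
  rw [ball]
  split_ifs <;> simp

theorem ball_fst_mono {j k : ℕ} (h : j ≤ k) : (G.ball s j).1 ≤ (G.ball s k).1 :=
  monotone_nat_of_le_succ (G.ball_fst_le_succ s) h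

variable {ρ : V → ℕ}

/-- `ρ` increases with each move and is bounded on a finite vertex set, so every ball comes to rest.
-/
theorem exists_isLeaf [Fintype V] (hρ : ∀ u, ¬ G.IsLeaf u → ρ u < ρ (G.s₀ u) ∧ ρ u < ρ (G.s₁ u))
    (k : ℕ) : ∃ k', (G.ball s k').1 = (G.ball s k).1 ∧ G.IsLeaf (G.ball s k').2.1 := by
  have hle : ∀ v, ρ v ≤ univ.sup ρ := fun v => le_sup (mem_univ v)
  induction hd : univ.sup ρ - ρ (G.ball s k).2.1 using Nat.strong_induction_on generalizing k with
  | _ d ih =>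
    by_cases hl : G.IsLeaf (G.ball s k).2.1
    · exact ⟨k, rfl, hl⟩
    · have hs := G.ball_succ_of_not_isLeaf s hl
      have h1 : ρ (G.ball s k).2.1 < ρ (G.ball s (k + 1)).2.1 := by
        rw [hs, next]
        split_ifs
        exacts [(hρ _ hl).2, (hρ _ hl).1]
      have h2 := hle (G.ball s (k + 1)).2.1
      obtain ⟨k', h3, h4⟩ := ih _ (by omega) (k + 1) rfl
      exact ⟨k', by rw [h3, hs], h4⟩

/-- In a graph without cycles, the numbers of visits satisfy the conservation law. -/
theorem exists_flow [Fintype V]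
    (hρ : ∀ u, ¬ G.IsLeaf u → ρ u < ρ (G.s₀ u) ∧ ρ u < ρ (G.s₁ u)) (T : ℕ) :
    ∃ c : V → ℕ, (∀ w, c w = (if s = w then T else 0) + G.inflow c w) ∧
      ∀ t, G.SomeBallReaches s t T ↔ 0 < c t := by
  have hex : ∃ k, (G.ball s k).1 = T := by
    induction T with
    | zero => exact ⟨0, rfl⟩
    | succ T ih =>
      obtain ⟨k, hk⟩ := ih
      obtain ⟨k', h1, h2⟩ := G.exists_isLeaf s hρ k
      exact ⟨k' + 1, by rw [ball_succ_of_isLeaf _ _ h2, h1, hk]⟩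
  classical
  -- At the first moment of ball number `T`, the balls `0, …, T - 1` have completed their ways and
  -- the new ball is still at `s`; this unfinished visit cancels one of the `T + 1` releases.
  obtain ⟨k, hk, hlt⟩ : ∃ k, (G.ball s k).1 = T ∧ ∀ j < k, (G.ball s j).1 ≠ T :=
    ⟨Nat.find hex, Nat.find_spec hex, fun j hj => Nat.find_min hex hj⟩
  have hpos : (G.ball s k).2.1 = s := by
    rcases k with _ | k
    · rfl
    · by_cases hl : G.IsLeaf (G.ball s k).2.1
      · rw [ball_succ_of_isLeaf _ _ hl]
      · rw [ball_succ_of_not_isLeaf _ _ hl] at hk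
        exact absurd hk (hlt k (Nat.lt_succ_self k))
  refine ⟨G.visits s k, fun w => ?_, fun t => ?_⟩
  · have := G.visits_add s k w
    rw [hpos, hk] at this
    split_ifs at this ⊢ <;> omega
  · rw [visits, card_pos]
    constructor
    · rintro ⟨i, hi, σ, hb⟩
      obtain ⟨j, hj⟩ := (G.ballAt_iff s).1 hb
      refine ⟨j, mem_filter.2 ⟨mem_range.2 ?_, by rw [hj]⟩⟩
      by_contra h
      have := G.ball_fst_mono s (not_lt.1 h)
      rw [hj, hk] at this
      exact absurd hi (not_lt.2 this)
    · rintro ⟨j, hj⟩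
      obtain ⟨h1, h2⟩ := mem_filter.1 hj
      rw [mem_range] at h1
      exact ⟨(G.ball s j).1, lt_of_le_of_ne (hk ▸ G.ball_fst_mono s h1.le) (hlt j h1),
        (G.ball s j).2.2, (G.ballAt_iff s).2 ⟨j, by rw [← h2]⟩⟩

end SwitchGraph

/-! ## Lists of digits -/

/-- The digits in base `2 ^ K`. -/
abbrev Digit (K : ℕ) : Type := Fin (2 ^ K)

namespace Digit

variable {K : ℕ}

/-- The number with the given digits, the least significant one first. -/
def value : List (Digit K) → ℕ
  | [] => 0
  | d :: l => d + 2 ^ K * value l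

@[simp] theorem value_nil : value ([] : List (Digit K)) = 0 := rfl

@[simp] theorem value_cons (d : Digit K) (l : List (Digit K)) :
    value (d :: l) = d + 2 ^ K * value l := rfl

theorem value_append (l l' : List (Digit K)) :
    value (l ++ l') = value l + (2 ^ K) ^ l.length * value l' := by
  induction l with
  | nil => simp
  | cons d l ih => simp [ih, pow_succ]; ring

theorem value_lt (l : List (Digit K)) : value l < (2 ^ K) ^ l.length := by
  induction l with
  | nil => simp
  | cons d l ih =>
    have := d.isLt
    rw [value_cons, List.length_cons, pow_succ']
    nlinarith

theorem value_inj {l l' : List (Digit K)} (hl : l.length = l'.length) (h : value l = value l') :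
    l = l' := by
  induction l generalizing l' with
  | nil => exact (List.length_eq_zero_iff.1 hl.symm).symm
  | cons d l ih =>
    obtain _ | ⟨d', l'⟩ := l'
    · simp at hl
    · rw [value_cons, value_cons] at h
      have h1 : (d : ℕ) = d' := by
        have := congrArg (· % 2 ^ K) h
        simpa [Nat.add_mul_mod_self_left, Nat.mod_eq_of_lt d.isLt, Nat.mod_eq_of_lt d'.isLt]
          using this
      rw [h1, Nat.add_left_cancel_iff] at h
      rw [Fin.ext h1, ih (by simpa using hl) (Nat.eq_of_mul_eq_mul_left (by positivity) h)]

theorem value_replicate_zero (n : ℕ) : value (List.replicate n (0 : Digit K)) = 0 := by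
  induction n with
  | zero => rfl
  | succ n ih => simp [List.replicate_succ, ih]

/-- The `n` least significant digits of a number. -/
def ofNat (K : ℕ) : ℕ → ℕ → List (Digit K)
  | 0, _ => []
  | n + 1, v => ⟨v % 2 ^ K, Nat.mod_lt _ (by positivity)⟩ :: ofNat K n (v / 2 ^ K)

@[simp] theorem length_ofNat (n v : ℕ) : (ofNat K n v).length = n := by
  induction n generalizing v with
  | zero => rfl
  | succ n ih => simp [ofNat, ih]

theorem value_ofNat (n v : ℕ) : value (ofNat K n v) = v % (2 ^ K) ^ n := by
  induction n generalizing v with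
  | zero => simp [ofNat, Nat.mod_one]
  | succ n ih => rw [ofNat, value_cons, ih, pow_succ', Nat.mod_mul]

/-! ### Increment and decrement -/

/-- The sum of a digit and a carry, and the new carry. -/
def inc (c : Bool) (d : Digit K) : Digit K × Bool :=
  if c then if h : (d : ℕ) + 1 < 2 ^ K then (⟨d + 1, h⟩, false) else (0, true) else (d, false)

/-- The difference of a digit and a borrow, and the new borrow. -/
def dec (c : Bool) (d : Digit K) : Digit K × Bool :=
  if c then
    if (d : ℕ) = 0 then (⟨2 ^ K - 1, Nat.sub_lt (by positivity) one_pos⟩, true)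
    else (⟨d - 1, (Nat.sub_le _ _).trans_lt d.isLt⟩, false)
  else (d, false)

theorem inc_val (c : Bool) (d : Digit K) :
    ((inc c d).1 : ℕ) + 2 ^ K * (inc c d).2.toNat = d + c.toNat := by
  have := d.isLt
  unfold inc
  split_ifs with h1 h2
  · simp [h1]
  · simp [h1]; omega
  · simp [h1]

theorem dec_val (c : Bool) (d : Digit K) :
    ((dec c d).1 : ℕ) + c.toNat = d + 2 ^ K * (dec c d).2.toNat := by
  have := d.isLt
  have h0 : 0 < 2 ^ K := by positivity
  unfold dec
  split_ifs with h1 h2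
  · simp [h1, h2]; omega
  · simp [h1]; omega
  · simp [h1]

/-- Digitwise processing of a list with a carry. -/
def carryMap (f : Bool → Digit K → Digit K × Bool) : Bool → List (Digit K) → List (Digit K) × Bool
  | c, [] => ([], c)
  | c, d :: l => ((f c d).1 :: (carryMap f (f c d).2 l).1, (carryMap f (f c d).2 l).2)

@[simp] theorem length_carryMap (f : Bool → Digit K → Digit K × Bool) (c : Bool)
    (l : List (Digit K)) : (carryMap f c l).1.length = l.length := by
  induction l generalizing c with
  | nil => rfl
  | cons d l ih => simp [carryMap, ih]

theorem carryMap_append (f : Bool → Digit K → Digit K × Bool) (c : Bool)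
    (l l' : List (Digit K)) : carryMap f c (l ++ l') =
      ((carryMap f c l).1 ++ (carryMap f (carryMap f c l).2 l').1,
        (carryMap f (carryMap f c l).2 l').2) := by
  induction l generalizing c with
  | nil => rfl
  | cons d l ih => simp [carryMap, ih]

theorem value_carryMap_inc (c : Bool) (l : List (Digit K)) :
    value (carryMap inc c l).1 + (2 ^ K) ^ l.length * (carryMap inc c l).2.toNat =
      value l + c.toNat := by
  induction l generalizing c with
  | nil => simp [carryMap]
  | cons d l ih =>
    have h1 := ih (inc c d).2
    have h2 := inc_val c d
    simp only [carryMap, value_cons, List.length_cons, pow_succ']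
    linear_combination 2 ^ K * h1 + h2

theorem value_carryMap_dec (c : Bool) (l : List (Digit K)) :
    value (carryMap dec c l).1 + c.toNat =
      value l + (2 ^ K) ^ l.length * (carryMap dec c l).2.toNat := by
  induction l generalizing c with
  | nil => simp [carryMap]
  | cons d l ih =>
    have h1 := ih (dec c d).2
    have h2 := dec_val c d
    simp only [carryMap, value_cons, List.length_cons, pow_succ']
    linear_combination 2 ^ K * h1 + h2

theorem carryMap_inc_false (l : List (Digit K)) : carryMap inc false l = (l, false) := by
  induction l with
  | nil => rfl
  | cons d l ih => simp [carryMap, inc, ih]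

/-- The increment overflows if and only if all digits are maximal. -/
theorem carryMap_inc_snd (l : List (Digit K)) :
    (carryMap inc true l).2 = decide (value l + 1 = (2 ^ K) ^ l.length) := by
  have h := value_carryMap_inc true l
  have h1 := value_lt (carryMap inc true l).1
  have h2 := value_lt l
  rw [length_carryMap] at h1
  cases hc : (carryMap inc true l).2
  · rw [hc] at h
    simp only [Bool.toNat_false, mul_zero, add_zero, Bool.toNat_true] at h
    have : value l + 1 ≠ (2 ^ K) ^ l.length := by omega
    simp [this]
  · rw [hc] at h
    simp only [mul_one, Bool.toNat_true] at h
    have : value l + 1 = (2 ^ K) ^ l.length := by omega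
    simp [this]

theorem value_carryMap_inc_of_lt {l : List (Digit K)} (h : value l + 1 < (2 ^ K) ^ l.length) :
    value (carryMap inc true l).1 = value l + 1 := by
  have h1 := value_carryMap_inc true l
  rw [carryMap_inc_snd, decide_eq_false h.ne] at h1
  simpa using h1

theorem value_carryMap_inc_of_eq {l : List (Digit K)} (h : value l + 1 = (2 ^ K) ^ l.length) :
    (carryMap inc true l).1 = List.replicate l.length 0 := by
  refine value_inj (by simp) ?_
  have h1 := value_carryMap_inc true l
  rw [carryMap_inc_snd, decide_eq_true h] at h1
  rw [value_replicate_zero]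
  simp only [Bool.toNat_true, mul_one] at h1
  omega

theorem value_carryMap_dec_of_pos {l : List (Digit K)} (h : 0 < value l) :
    value (carryMap dec true l).1 = value l - 1 := by
  have h1 := value_carryMap_dec true l
  have h2 := value_lt (carryMap dec true l).1
  rw [length_carryMap] at h2
  cases hc : (carryMap dec true l).2
  · rw [hc] at h1
    simp only [Bool.toNat_true, Bool.toNat_false, mul_zero, add_zero] at h1
    omega
  · rw [hc] at h1
    simp only [Bool.toNat_true, mul_one] at h1
    omega

/-- The finite control cannot compare numbers, but it can check digit by digit whether a section is
about to overflow; this is how the last time step is recognized. -/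
theorem forall_eq_max_iff (l : List (Digit K)) :
    (∀ d ∈ l, (d : ℕ) + 1 = 2 ^ K) ↔ value l + 1 = (2 ^ K) ^ l.length := by
  induction l with
  | nil => simp
  | cons d l ih =>
    have h1 := d.isLt
    have h2 := value_lt l
    rw [List.forall_mem_cons, ih, value_cons, List.length_cons, pow_succ']
    constructor
    · rintro ⟨h3, h4⟩
      rw [← h4, mul_add]
      omega
    · intro h
      have h3 : 2 ^ K * (value l + 1) ≤ 2 ^ K * (2 ^ K) ^ l.length := Nat.mul_le_mul_left _ h2
      rw [mul_add] at h3
      have h4 : (d : ℕ) + 1 = 2 ^ K := by omega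
      refine ⟨h4, Nat.eq_of_mul_eq_mul_left (show 0 < 2 ^ K by positivity) ?_⟩
      rw [mul_add]
      omega

/-! ### Counting with a growing list of digits -/

/-- The increment, with a new digit in case of an overflow. -/
def grow (K : ℕ) (l : List (Digit K)) : List (Digit K) :=
  (carryMap inc true l).1 ++ if (carryMap inc true l).2 then [(inc true 0).1] else []

/-- The list of digits obtained by counting to `n`. -/
def count (K n : ℕ) : List (Digit K) := (grow K)^[n] []

theorem count_succ (n : ℕ) : count K (n + 1) = grow K (count K n) :=
  Function.iterate_succ_apply' _ _ _

theorem value_count (hK : 0 < K) (n : ℕ) : value (count K n) = n := by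
  -- For `K = 0` the only digit is `0`, and an overflow could not produce a leading digit `1`.
  have h2 : 1 < 2 ^ K := Nat.one_lt_two_pow hK.ne'
  induction n with
  | zero => rfl
  | succ n ih =>
    have h := value_carryMap_inc true (count K n)
    rw [ih] at h
    rw [count_succ, grow, value_append, length_carryMap]
    cases hc : (carryMap inc true (count K n)).2
    · simpa [hc] using h
    · simpa [hc, inc, h2] using h

/-- A digit is added only when all present ones are maximal, so there are no leading zeros. This
keeps the list logarithmically short. -/
theorem pow_length_count_le (hK : 0 < K) (n : ℕ) :
    count K n = [] ∨ (2 ^ K) ^ (count K n).length ≤ 2 ^ K * n := by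
  induction n with
  | zero => exact .inl rfl
  | succ n ih =>
    right
    have h := value_carryMap_inc true (count K n)
    rw [value_count hK] at h
    cases hc : (carryMap inc true (count K n)).2
    · rcases ih with ih | ih
      · rw [ih] at hc
        simp [carryMap] at hc
      · simp only [count_succ, grow, hc, Bool.false_eq_true, if_false, List.append_nil,
          length_carryMap]
        exact ih.trans (Nat.mul_le_mul_left _ (Nat.le_succ n))
    · simp only [hc, Bool.toNat_true, mul_one] at h
      simp only [count_succ, grow, hc, if_true, List.length_append, length_carryMap,
        List.length_cons, List.length_nil, zero_add, pow_succ']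
      exact Nat.mul_le_mul_left _ (by omega)

theorem lt_pow_length_count (hK : 0 < K) (n : ℕ) : n < (2 ^ K) ^ (count K n).length := by
  have := value_lt (count K n)
  rwa [value_count hK] at this

theorem length_count_le (hK : 0 < K) (n : ℕ) : (count K n).length ≤ Nat.log 2 n + 1 := by
  rcases pow_length_count_le hK n with h | h
  · simp [h]
  · rcases hl : (count K n).length with _ | d
    · omega
    · rw [hl, pow_succ'] at h
      have h1 : (2 ^ K) ^ d ≤ n := Nat.le_of_mul_le_mul_left h (by positivity)
      have hn : n ≠ 0 := by
        rintro rfl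
        have : 0 < (2 ^ K) ^ d := by positivity
        omega
      have h2 : 2 ^ d ≤ n :=
        (Nat.pow_le_pow_left (Nat.le_self_pow hK.ne' 2) d).trans h1
      have := Nat.le_log_of_pow_le one_lt_two h2
      omega

/-! ### Binary encodings -/

/-- The binary digits of a digit. -/
def bits (d : Digit K) : List Bool := (List.range K).map fun i => Nat.testBit d i

/-- `Nat.bits` drops leading zeros; the low block keeps its full width because a positive number
stands above it. -/
theorem nat_bits_add_mul (K : ℕ) {d m : ℕ} (hd : d < 2 ^ K) (hm : 0 < m) :
    Nat.bits (d + 2 ^ K * m) = (List.range K).map (fun i => Nat.testBit d i) ++ Nat.bits m := by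
  induction K generalizing d with
  | zero =>
    obtain rfl : d = 0 := by omega
    simp
  | succ K ih =>
    have h1 : d + 2 ^ (K + 1) * m = Nat.bit (Nat.testBit d 0) (d / 2 + 2 ^ K * m) := by
      rw [Nat.bit_val, Nat.testBit_zero, pow_succ]
      have := Nat.div_add_mod d 2
      rcases Nat.mod_two_eq_zero_or_one d with h | h <;> simp [h] <;> lia
    rw [h1, Nat.bits_append_bit, ih (by omega), List.range_succ_eq_map]
    · simp [Nat.testBit_succ, Function.comp_def]
    · intro h
      have : 0 < 2 ^ K * m := by positivity
      omega

theorem nat_bits_value_add (l : List (Digit K)) {m : ℕ} (hm : 0 < m) :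
    Nat.bits (value l + (2 ^ K) ^ l.length * m) = l.flatMap bits ++ Nat.bits m := by
  induction l with
  | nil => simp
  | cons d l ih =>
    have h : value (d :: l) + (2 ^ K) ^ (d :: l).length * m =
        d + 2 ^ K * (value l + (2 ^ K) ^ l.length * m) := by
      rw [value_cons, List.length_cons, pow_succ']
      ring
    rw [h, nat_bits_add_mul K d.isLt (by positivity), ih, List.flatMap_cons, List.append_assoc]
    rfl

/-- The part of the encoding of a number that encodes one of its digits. -/
def code (d : Digit K) : List Bool := (bits d).flatMap fun b => [true, b]

/-- Each digit contributes its own piece of the encoding, independently of the others, so a number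
can be printed while its digits are visited one by one. -/
theorem encodeBinary_value_add (l : List (Digit K)) {m : ℕ} (hm : 0 < m) :
    encodeBinary (value l + (2 ^ K) ^ l.length * m) = l.flatMap code ++ encodeBinary m := by
  rw [encodeBinary, nat_bits_value_add l hm, List.flatMap_append, List.flatMap_assoc,
    List.append_assoc]
  rfl

theorem encodeBinary_value_add_pow (l : List (Digit K)) :
    encodeBinary (value l + (2 ^ K) ^ l.length) = l.flatMap code ++ [true, true, false] := by
  have := encodeBinary_value_add l one_pos
  rw [mul_one] at this
  rw [this]
  simp [encodeBinary]

/-- The exponent of the number of balls is polynomially large, too large to keep all bits of that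
number on the tape, but the encoding is a repeated pattern that a counter can print. -/
theorem encodeBinary_two_pow (n : ℕ) :
    encodeBinary (2 ^ n) = (List.replicate n [true, false]).flatten ++ [true, true, false] := by
  have : Nat.bits (2 ^ n) = List.replicate n false ++ [true] := by
    induction n with
    | zero => simp
    | succ n ih =>
      rw [show 2 ^ (n + 1) = Nat.bit false (2 ^ n) by rw [Nat.bit_val, pow_succ]; simp; ring,
        Nat.bits_append_bit _ _ (by intro h; simp at h), ih]
      rfl
  rw [encodeBinary, this]
  simp [List.flatMap]

end Digit

/-! ## The reduction machine -/

/-- The sections of the digits of a vertex: the contents of the work tapes, the state, the position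
of the input head and the time. -/
inductive Section : Type
  | cell : Section
  | state : Section
  | pos : Section
  | time : Section

instance : Finite Section := by
  refine Finite.of_surjective (α := Fin 4)
    (fun i => match i with | 0 => .cell | 1 => .state | 2 => .pos | 3 => .time) ?_
  rintro (_ | _ | _ | _)
  exacts [⟨0, rfl⟩, ⟨1, rfl⟩, ⟨2, rfl⟩, ⟨3, rfl⟩]

/-- The kinds of vertices: configurations of the machine, vertices of the counter that halves the
number of accepting computations, the target, and the vertex for the other balls. -/
inductive Kind (Q : Type) : Type
  | sim : Q → Kind Q
  | chain : Kind Q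
  | target : Kind Q
  | dump : Kind Q

instance {Q : Type} [Finite Q] : Finite (Kind Q) := by
  refine Finite.of_surjective (α := Q ⊕ Fin 3)
    (fun s => match s with
      | .inl q => .sim q
      | .inr 0 => .chain
      | .inr 1 => .target
      | .inr 2 => .dump) ?_
  rintro (q | _ | _ | _)
  exacts [⟨.inl q, rfl⟩, ⟨.inr 0, rfl⟩, ⟨.inr 1, rfl⟩, ⟨.inr 2, rfl⟩]

/-- A coin-tossing machine together with codes for its states and for the contents of a cell on all
work tapes, where a cell carries a mark if it is under the head.  The sections of a vertex consist
of `m + 1` segments. -/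
structure Coding where
  M : Machine Bool
  accept : Set M.State
  K : ℕ
  K_pos : 0 < K
  encCell : (M.Tape → M.Symbol × Bool) → Digit K
  encCell_injective : Function.Injective encCell
  encKind : Kind M.State → Digit K
  encKind_injective : Function.Injective encKind
  m : ℕ

namespace Coding

variable (U : Coding)

instance : Finite U.M.Tape := U.M.finite_tape
instance : Finite U.M.Symbol := U.M.finite_symbol
instance : Nonempty (U.M.Tape → U.M.Symbol × Bool) := ⟨fun _ => (U.M.blank, false)⟩
instance : Nonempty (Kind U.M.State) := ⟨.dump⟩

/-- The contents of a cell with a given code. -/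
noncomputable def decCell : Digit U.K → U.M.Tape → U.M.Symbol × Bool := Function.invFun U.encCell

/-- The kind with a given code. -/
noncomputable def decKind : Digit U.K → Kind U.M.State := Function.invFun U.encKind

@[simp] theorem decCell_encCell (a : U.M.Tape → U.M.Symbol × Bool) :
    U.decCell (U.encCell a) = a := Function.leftInverse_invFun U.encCell_injective a

@[simp] theorem decKind_encKind (k : Kind U.M.State) : U.decKind (U.encKind k) = k :=
  Function.leftInverse_invFun U.encKind_injective k

/-- What has to be known about a vertex in order to compute its successors. -/
structure Info where
  kind : Digit U.K
  read : U.M.Tape → U.M.Symbol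
  last : Bool
  input : InputSymbol

instance : Finite U.Info :=
  Finite.of_injective (fun I : U.Info => (I.kind, I.read, I.last, I.input)) (by
    rintro ⟨a, b, c, d⟩ ⟨a', b', c', d'⟩ h
    simp only [Prod.mk.injEq] at h
    obtain ⟨rfl, rfl, rfl, rfl⟩ := h
    rfl)

/-- The modifications of the cell section. -/
inductive CellMode : Type
  | keep : CellMode
  | zero : CellMode
  | step : (U.M.Tape → U.M.Symbol) → (U.M.Tape → HeadMove) → CellMode

/-- The modifications of the position section. -/
inductive PosMode : Type
  | keep : PosMode
  | zero : PosMode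
  | inc : PosMode
  | dec : PosMode

/-- The modifications of all sections that lead to a successor of a vertex. -/
structure Plan where
  cell : U.CellMode
  kind : Option (Digit U.K)
  pos : PosMode
  time : Bool

open Classical in
/-- The action of the machine, where the action in a halting state changes nothing. -/
noncomputable def idleAction (q : U.M.State) (a : InputSymbol) (r : U.M.Tape → U.M.Symbol)
    (b : Bool) : MachineAction U.M.Tape U.M.State U.M.Symbol :=
  if q ∈ U.M.halting then ⟨q, .stay, r, fun _ => .stay, none⟩ else U.M.transition q a r b

/-- The modification of the position in a step. -/
def posMode : HeadMove → InputSymbol → PosMode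
  | .left, .leftEnd => .keep
  | .left, _ => .dec
  | .stay, _ => .keep
  | .right, .rightEnd => .keep
  | .right, _ => .inc

/-- The successor of a counter vertex. -/
def chainKind (last b : Bool) : Kind U.M.State :=
  if last then if b then .target else .dump else if b then .dump else .chain

open Classical in
/-- The plan for the successor along the edge `b`. -/
noncomputable def plan (I : U.Info) (b : Bool) : U.Plan :=
  match U.decKind I.kind with
  | .sim q =>
    if I.last then
      ⟨.zero, some (U.encKind (if (U.idleAction q I.input I.read b).next ∈ U.accept then .chain
        else .dump)), .zero, true⟩
    else
      ⟨.step (U.idleAction q I.input I.read b).write (U.idleAction q I.input I.read b).move,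
        some (U.encKind (.sim (U.idleAction q I.input I.read b).next)),
        posMode (U.idleAction q I.input I.read b).inputMove I.input, true⟩
  | .chain => ⟨.keep, some (U.encKind (U.chainKind I.last b)), .keep, true⟩
  | .target => ⟨.keep, none, .keep, false⟩
  | .dump => ⟨.keep, none, .keep, false⟩

/-- Whether the cell under consideration will be under the head after a movement, if `p`, `c` and
`n` tell whether the previous cell, the cell itself and the next cell are under the head now.  The
first cell does not have a previous one. -/
def marked (mv : HeadMove) (p : Option Bool) (c n : Bool) : Bool :=
  match mv with
  | .left => n || (c && p.isNone)
  | .stay => c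
  | .right => p.getD false

/-- The contents of a cell after a step. -/
def cellStep (w : U.M.Tape → U.M.Symbol) (mv : U.M.Tape → HeadMove)
    (p : Option (U.M.Tape → U.M.Symbol × Bool)) (c : U.M.Tape → U.M.Symbol × Bool)
    (n : Option (U.M.Tape → U.M.Symbol × Bool)) : U.M.Tape → U.M.Symbol × Bool :=
  fun i => (if (c i).2 then w i else (c i).1,
    marked (mv i) (p.map fun a => (a i).2) (c i).2 ((n.map fun a => (a i).2).getD false))

/-- The new digit of the cell section, given the old one and its neighbours. -/
noncomputable def cellDigit (mode : U.CellMode) (p : Option (Digit U.K)) (d : Digit U.K)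
    (n : Option (Digit U.K)) : Digit U.K :=
  match mode with
  | .keep => d
  | .zero => 0
  | .step w mv => U.encCell (U.cellStep w mv (p.map U.decCell) (U.decCell d) (n.map U.decCell))

/-- The new digit of the position section and the new carry. -/
def posDigit (mode : PosMode) (c : Bool) (d : Digit U.K) : Digit U.K × Bool :=
  match mode with
  | .keep => (d, c)
  | .zero => (0, c)
  | .inc => Digit.inc c d
  | .dec => Digit.dec c d

/-- The symbols on the tape: a digit and the section it belongs to, if known. -/
abbrev Sym : Type := Option Section × Digit U.K

/-- The digit of the next cell, if it belongs to the cell section. -/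
def nextCell : Option U.Sym → Option (Digit U.K)
  | some (some .cell, d) => some d
  | _ => none

/-- What happens after the input head has been brought back. -/
inductive Cont : Type
  | grow : Section → Fin (U.m + 1) → Cont
  | header : Cont
  | vertices : Bool → Cont

instance : Finite U.Cont := by
  refine Finite.of_surjective (α := (Section × Fin (U.m + 1)) ⊕ Unit ⊕ Bool)
    (fun s => match s with
      | .inl p => .grow p.1 p.2
      | .inr (.inl _) => .header
      | .inr (.inr b) => .vertices b) ?_
  rintro (⟨s, i⟩ | _ | b)
  exacts [⟨.inl (s, i), rfl⟩, ⟨.inr (.inl ()), rfl⟩, ⟨.inr (.inr b), rfl⟩]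

/-- The kinds of sweeps, with their memory. -/
inductive Ctl : Type
  /-- count the symbols of the input in a new segment -/
  | grow : Section → Fin (U.m + 1) → Bool → Ctl
  /-- erase the digits of the new segment and assign it to its section -/
  | close : Section → Fin (U.m + 1) → Ctl
  /-- bring the input head back to the left end -/
  | rewind : U.Cont → Ctl
  /-- continue with the input head at the left end -/
  | resume : U.Cont → Ctl
  /-- print the number of vertices -/
  | size : Ctl
  /-- print the source -/
  | source : Bool → Ctl
  /-- print the target -/
  | target : Ctl
  /-- print the digits of the number of balls -/
  | balls : Bool → Ctl
  /-- collect the information about a vertex -/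
  | scan : Bool → U.Info → Ctl
  /-- print a successor of a vertex -/
  | emit : Bool → Bool → U.Info → Option (Digit U.K) → Bool → Bool → Ctl
  /-- go to the next vertex -/
  | inc : Bool → Bool → Bool → Bool → Ctl
  | done : Ctl

instance : Finite U.Ctl := by
  refine Finite.of_surjective (α := (Section × Fin (U.m + 1) × Bool) ⊕ (Section × Fin (U.m + 1)) ⊕
      U.Cont ⊕ U.Cont ⊕ Unit ⊕ Bool ⊕ Unit ⊕ Bool ⊕ (Bool × U.Info) ⊕
      (Bool × Bool × U.Info × Option (Digit U.K) × Bool × Bool) ⊕ (Bool × Bool × Bool × Bool) ⊕ Unit)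
    (fun s => match s with
      | .inl p => .grow p.1 p.2.1 p.2.2
      | .inr (.inl p) => .close p.1 p.2
      | .inr (.inr (.inl k)) => .rewind k
      | .inr (.inr (.inr (.inl k))) => .resume k
      | .inr (.inr (.inr (.inr (.inl _)))) => .size
      | .inr (.inr (.inr (.inr (.inr (.inl b))))) => .source b
      | .inr (.inr (.inr (.inr (.inr (.inr (.inl _)))))) => .target
      | .inr (.inr (.inr (.inr (.inr (.inr (.inr (.inl b))))))) => .balls b
      | .inr (.inr (.inr (.inr (.inr (.inr (.inr (.inr (.inl p)))))))) => .scan p.1 p.2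
      | .inr (.inr (.inr (.inr (.inr (.inr (.inr (.inr (.inr (.inl p))))))))) =>
        .emit p.1 p.2.1 p.2.2.1 p.2.2.2.1 p.2.2.2.2.1 p.2.2.2.2.2
      | .inr (.inr (.inr (.inr (.inr (.inr (.inr (.inr (.inr (.inr (.inl p)))))))))) =>
        .inc p.1 p.2.1 p.2.2.1 p.2.2.2
      | .inr (.inr (.inr (.inr (.inr (.inr (.inr (.inr (.inr (.inr (.inr _)))))))))) => .done) ?_
  rintro (⟨a, b, c⟩ | ⟨a, b⟩ | k | k | _ | b | _ | b | ⟨a, b⟩ | ⟨a, b, c, d, e, f⟩ | ⟨a, b, c, d⟩ | _)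
  exacts [⟨.inl (a, b, c), rfl⟩, ⟨.inr (.inl (a, b)), rfl⟩, ⟨.inr (.inr (.inl k)), rfl⟩,
    ⟨.inr (.inr (.inr (.inl k))), rfl⟩, ⟨.inr (.inr (.inr (.inr (.inl ())))), rfl⟩,
    ⟨.inr (.inr (.inr (.inr (.inr (.inl b))))), rfl⟩,
    ⟨.inr (.inr (.inr (.inr (.inr (.inr (.inl ())))))), rfl⟩,
    ⟨.inr (.inr (.inr (.inr (.inr (.inr (.inr (.inl b))))))), rfl⟩,
    ⟨.inr (.inr (.inr (.inr (.inr (.inr (.inr (.inr (.inl (a, b))))))))), rfl⟩,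
    ⟨.inr (.inr (.inr (.inr (.inr (.inr (.inr (.inr (.inr (.inl (a, b, c, d, e, f)))))))))), rfl⟩,
    ⟨.inr (.inr (.inr (.inr (.inr (.inr (.inr (.inr (.inr (.inr (.inl (a, b, c, d))))))))))), rfl⟩,
    ⟨.inr (.inr (.inr (.inr (.inr (.inr (.inr (.inr (.inr (.inr (.inr ())))))))))), rfl⟩]

/-- The information at the beginning of a scan. -/
def emptyInfo (a : InputSymbol) : U.Info := ⟨0, fun _ => U.M.blank, true, a⟩

/-- What is done after the segment `i` of a section is finished. -/
def afterSegment : Section → Fin (U.m + 1) → U.Cont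
  | s, ⟨i + 1, h⟩ => .grow s ⟨i, (Nat.lt_succ_self i).trans h⟩
  | .cell, ⟨0, _⟩ => .grow .state (Fin.last _)
  | .state, ⟨0, _⟩ => .grow .pos (Fin.last _)
  | .pos, ⟨0, _⟩ => .grow .time (Fin.last _)
  | .time, ⟨0, _⟩ => .header

/-- The sweep with which a continuation starts. -/
def contStart : U.Cont → U.Ctl
  | .grow s i => .grow s i true
  | .header => .size
  | .vertices top => .scan top (U.emptyInfo .leftEnd)

/-- The sweep to be done if the input symbol is `a`. -/
noncomputable def enter : U.Ctl → InputSymbol → U.Ctl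
  | .grow s i _, .rightEnd => .close s i
  | .rewind k, .leftEnd => .resume k
  | .scan top _, a => .scan top (U.emptyInfo a)
  | c, _ => c

/-- The first sweep that prints the successor of a vertex along the edge `b`. -/
noncomputable def emitStart (top b : Bool) (I : U.Info) : U.Ctl :=
  .emit top b I none true (U.plan I b).time

/-- The information collected at a symbol. -/
noncomputable def collect (I : U.Info) : U.Sym → U.Info
  | (some .cell, d) =>
    ⟨I.kind, fun i => if (U.decCell d i).2 then (U.decCell d i).1 else I.read i, I.last, I.input⟩
  | (some .state, d) => ⟨d, I.read, I.last, I.input⟩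
  | (some .time, d) => ⟨I.kind, I.read, I.last && decide ((d : ℕ) + 1 = 2 ^ U.K), I.input⟩
  | _ => I

/-- The digits of the source. -/
def sourceDigit (first : Bool) : Section → Digit U.K
  | .cell => U.encCell fun _ => (U.M.blank, first)
  | .state => U.encKind (.sim U.M.start)
  | _ => 0

/-- The digits of the vertices of the counter and of the target. -/
def kindDigit (k : Kind U.M.State) : Section → Digit U.K
  | .state => U.encKind k
  | _ => 0

/-- The visit of a symbol. -/
noncomputable def visit : U.Ctl → U.Sym → Option U.Sym → U.Ctl × U.Sym × List Bool
  | .grow s i c, (none, d), _ => (.grow s i (Digit.inc c d).2, (none, (Digit.inc c d).1), [])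
  | .close s i, (none, _), _ => (.close s i, (some s, 0), [])
  | .size, (t, d), _ => (.size, (t, d), Digit.code d)
  | .source f, (some s, d), _ => (.source false, (some s, d), Digit.code (U.sourceDigit f s))
  | .target, (some s, d), _ => (.target, (some s, d), Digit.code (U.kindDigit .target s))
  | .balls c, (some .time, d), _ =>
    (.balls (Digit.inc c d).2, (some .time, (Digit.inc c d).1), [])
  | .scan top I, g, _ => (.scan top (U.collect I g), g, [])
  | .emit top b I p cp ct, (some .cell, d), n =>
    (.emit top b I (some d) cp ct, (some .cell, d),
      Digit.code (U.cellDigit (U.plan I b).cell p d (U.nextCell n)))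
  | .emit top b I p cp ct, (some .state, d), _ =>
    (.emit top b I p cp ct, (some .state, d), Digit.code ((U.plan I b).kind.getD d))
  | .emit top b I p cp ct, (some .pos, d), _ =>
    (.emit top b I p (U.posDigit (U.plan I b).pos cp d).2 ct, (some .pos, d),
      Digit.code (U.posDigit (U.plan I b).pos cp d).1)
  | .emit top b I p cp ct, (some .time, d), _ =>
    (.emit top b I p cp (Digit.inc ct d).2, (some .time, d), Digit.code (Digit.inc ct d).1)
  | .inc top c tp tt, (some .pos, d), _ =>
    (.inc top (Digit.inc c d).2 (tp || c) tt, (some .pos, (Digit.inc c d).1), [])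
  | .inc top c tp tt, (some .time, d), _ =>
    (.inc top (Digit.inc c d).2 tp (tt || c), (some .time, (Digit.inc c d).1), [])
  | .inc top c tp tt, (t, d), _ =>
    (.inc top (Digit.inc c d).2 tp tt, (t, (Digit.inc c d).1), [])
  | c, g, _ => (c, g, [])

/-- The end of a sweep. -/
noncomputable def finish : U.Ctl → (U.Ctl × HeadMove) × Option U.Sym × List Bool
  | .grow s i c =>
    ((.grow s i true, .right), if c then some (none, (Digit.inc true 0).1) else none, [])
  | .close s i => ((.rewind (U.afterSegment s i), .left), none, [])
  | .rewind k => ((.rewind k, .left), none, [])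
  | .resume k => ((U.contStart k, .stay), none, [])
  | .size => ((.source true, .stay), none, [true, false, true, true, false])
  | .source _ => ((.target, .stay), none, [true, true, false])
  | .target => ((.balls true, .stay), none, [true, true, false])
  | .balls true =>
    ((.scan false (U.emptyInfo .leftEnd), .stay), none, [true, false, true, true, false])
  | .balls false => ((.balls true, .stay), none, [true, false])
  | .scan top I => ((U.emitStart top false I, .stay), none, [])
  | .emit top false I _ _ _ => ((U.emitStart top true I, .stay), none, [true, true, false])
  | .emit top true _ _ _ _ => ((.inc top true false false, .stay), none, [true, true, false])
  | .inc false true _ _ => ((.rewind (.vertices true), .left), none, [])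
  | .inc true true _ _ => ((.done, .stay), none, [])
  | .inc top false _ true => ((.rewind (.vertices top), .left), none, [])
  | .inc top false tp false =>
    ((.scan top (U.emptyInfo .leftEnd), if tp then .right else .stay), none, [])
  | .done => ((.done, .stay), none, [])

/-- The sweeping machine that prints the instance. -/
noncomputable def sweeper : Sweeper (U.Ctl × HeadMove) U.Sym where
  start := (.grow .cell (Fin.last _) true, .stay)
  halting := {μ | μ.1 = .done}
  enter := fun μ a => (U.enter μ.1 a, μ.2)
  visit := fun μ g n => (((U.visit μ.1 g n).1, μ.2), (U.visit μ.1 g n).2)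
  finish := fun μ => U.finish μ.1
  inputMove := fun μ => μ.2

end Coding

/-! ### Composition of sweeps -/

namespace Sweeper

variable {Mem Γ : Type} {S : Sweeper Mem Γ}

/-- The result of a sweep, with symbols and output from an earlier part of the list. -/
def prepend (l : List Γ) (o : List Bool) (r : Mem × List Γ × List Bool) :
    Mem × List Γ × List Bool := (r.1, l ++ r.2.1, o ++ r.2.2)

@[simp] theorem prepend_nil (r : Mem × List Γ × List Bool) : prepend [] [] r = r := rfl

@[simp] theorem prepend_prepend (l l' : List Γ) (o o' : List Bool)
    (r : Mem × List Γ × List Bool) :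
    prepend l o (prepend l' o' r) = prepend (l ++ l') (o ++ o') r := by
  simp [prepend]

theorem sweep_cons (μ : Mem) (g : Γ) (l : List Γ) :
    S.sweep μ (g :: l) = prepend [(S.visit μ g l.head?).2.1] (S.visit μ g l.head?).2.2
      (S.sweep (S.visit μ g l.head?).1 l) := rfl

/-- The part of a sweep during which the memory and the list do not change. -/
theorem sweep_append_of_visit {μ : Mem} {l : List Γ} (e : Γ → List Bool)
    (h : ∀ g ∈ l, ∀ n, S.visit μ g n = (μ, g, e g)) (l' : List Γ) :
    S.sweep μ (l ++ l') = prepend l (l.flatMap e) (S.sweep μ l') := by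
  induction l with
  | nil => rfl
  | cons g l ih =>
    rw [List.cons_append, sweep_cons, h g (by simp), ih fun g hg => h g (by simp [hg]),
      prepend_prepend]
    rfl

theorem sweep_append_of_copy {μ : Mem} {l : List Γ}
    (h : ∀ g ∈ l, ∀ n, S.visit μ g n = (μ, g, [])) (l' : List Γ) :
    S.sweep μ (l ++ l') = prepend l [] (S.sweep μ l') := by
  rw [sweep_append_of_visit (fun _ => []) h, List.flatMap_eq_nil_iff.2 (by simp)]

theorem sweep_nil (μ : Mem) :
    S.sweep μ [] = ((S.finish μ).1, (S.finish μ).2.1.toList, (S.finish μ).2.2) := rfl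

end Sweeper

/-! ### Vertices as lists of digits, and the effect of each sweep on them -/

namespace Coding

open Sweeper Digit

variable (U : Coding)

/-- The digits of a vertex in the four sections. -/
@[ext] structure Vertex where
  cells : List (Digit U.K)
  state : List (Digit U.K)
  pos : List (Digit U.K)
  time : List (Digit U.K)

namespace Vertex

variable {U}

/-- All digits of a vertex. -/
def digits (V : U.Vertex) : List (Digit U.K) := V.cells ++ (V.state ++ (V.pos ++ V.time))

/-- The symbols of a section. -/
def label {K : ℕ} (s : Section) (l : List (Digit K)) : List (Option Section × Digit K) :=
  l.map fun d => (some s, d)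

/-- The tape that represents a vertex. -/
def tape (V : U.Vertex) : List U.Sym :=
  label .cell V.cells ++ (label .state V.state ++ (label .pos V.pos ++ label .time V.time))

/-- All sections have length `L`. -/
structure HasLength (V : U.Vertex) (L : ℕ) : Prop where
  cells : V.cells.length = L
  state : V.state.length = L
  pos : V.pos.length = L
  time : V.time.length = L

theorem HasLength.length_tape {V : U.Vertex} {L : ℕ} (h : V.HasLength L) :
    V.tape.length = 4 * L := by
  simp [tape, label, h.cells, h.state, h.pos, h.time]
  ring

theorem HasLength.length_digits {V : U.Vertex} {L : ℕ} (h : V.HasLength L) :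
    V.digits.length = 4 * L := by
  simp [digits, h.cells, h.state, h.pos, h.time]
  ring

end Vertex

open Vertex

/-- The successor of a vertex according to a plan. -/
noncomputable def applyPlan (p : U.Plan) (V : U.Vertex) : U.Vertex where
  cells := go none V.cells
  state := V.state.map fun d => p.kind.getD d
  pos := (carryMap (U.posDigit p.pos) true V.pos).1
  time := (carryMap inc p.time V.time).1
where
  go : Option (Digit U.K) → List (Digit U.K) → List (Digit U.K)
  | _, [] => []
  | q, d :: l => U.cellDigit p.cell q d l.head? :: go (some d) l

theorem length_applyPlan_go (p : U.Plan) (q : Option (Digit U.K)) (l : List (Digit U.K)) :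
    (applyPlan.go U p q l).length = l.length := by
  induction l generalizing q with
  | nil => rfl
  | cons d l ih => simp [applyPlan.go, ih]

theorem hasLength_applyPlan (p : U.Plan) {V : U.Vertex} {L : ℕ} (h : V.HasLength L) :
    (U.applyPlan p V).HasLength L :=
  ⟨by rw [← h.cells]; exact U.length_applyPlan_go p none _, by simp [applyPlan, h.state],
    by simp [applyPlan, h.pos], by simp [applyPlan, h.time]⟩

/-- The information about a vertex, where `a` is the symbol under the input head. -/
noncomputable def info (a : InputSymbol) (V : U.Vertex) : U.Info :=
  V.tape.foldl U.collect (U.emptyInfo a)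

/-- The successor of a vertex along the edge `b`. -/
noncomputable def succ (x : List Bool) (b : Bool) (V : U.Vertex) : U.Vertex :=
  U.applyPlan (U.plan (U.info (inputSymbolAt x (value V.pos)) V) b) V

/-- The result of the increment of a vertex. -/
def incVertex (V : U.Vertex) : U.Vertex where
  cells := (carryMap inc true V.cells).1
  state := (carryMap inc (carryMap inc true V.cells).2 V.state).1
  pos := (carryMap inc (carryMap inc true (V.cells ++ V.state)).2 V.pos).1
  time := (carryMap inc (carryMap inc true (V.cells ++ (V.state ++ V.pos))).2 V.time).1

theorem digits_incVertex (V : U.Vertex) :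
    (U.incVertex V).digits = (carryMap inc true V.digits).1 := by
  simp [incVertex, digits, carryMap_append]

/-! ### The sweeps -/

@[simp] theorem sweeper_visit (c : U.Ctl) (mv : HeadMove) (g : U.Sym) (n : Option U.Sym) :
    U.sweeper.visit (c, mv) g n = (((U.visit c g n).1, mv), (U.visit c g n).2) := rfl

@[simp] theorem sweeper_finish (c : U.Ctl) (mv : HeadMove) :
    U.sweeper.finish (c, mv) = U.finish c := rfl

theorem sweep_of_copy {c : U.Ctl} (mv : HeadMove) {l : List U.Sym}
    (h : ∀ g ∈ l, ∀ n, U.visit c g n = (c, g, [])) (l' : List U.Sym) :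
    U.sweeper.sweep (c, mv) (l ++ l') = prepend l [] (U.sweeper.sweep (c, mv) l') :=
  sweep_append_of_copy (fun g hg n => by rw [sweeper_visit, h g hg n]) l'

theorem sweep_of_copy_all {c : U.Ctl} (mv : HeadMove) {l : List U.Sym}
    (h : ∀ g ∈ l, ∀ n, U.visit c g n = (c, g, [])) :
    U.sweeper.sweep (c, mv) l = prepend l [] (U.sweeper.sweep (c, mv) []) := by
  have := U.sweep_of_copy mv h []
  rwa [List.append_nil] at this

theorem sweep_of_visit {c : U.Ctl} (mv : HeadMove) {l : List U.Sym} (e : U.Sym → List Bool)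
    (h : ∀ g ∈ l, ∀ n, U.visit c g n = (c, g, e g)) (l' : List U.Sym) :
    U.sweeper.sweep (c, mv) (l ++ l') = prepend l (l.flatMap e) (U.sweeper.sweep (c, mv) l') :=
  sweep_append_of_visit e (fun g hg n => by rw [sweeper_visit, h g hg n]) l'

theorem sweep_label {c : U.Ctl} (mv : HeadMove) (s : Section) (D : List (Digit U.K))
    (e : Digit U.K → Digit U.K)
    (h : ∀ d n, U.visit c (some s, d) n = (c, (some s, d), code (e d))) (l' : List U.Sym) :
    U.sweeper.sweep (c, mv) (label s D ++ l') =
      prepend (label s D) ((D.map e).flatMap code) (U.sweeper.sweep (c, mv) l') := by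
  rw [U.sweep_of_visit mv (fun g => code (e g.2))]
  · simp [label, List.flatMap_map]
  · intro g hg n
    obtain ⟨d, -, rfl⟩ := List.mem_map.1 hg
    exact h d n

/-- The symbols of an unfinished segment. -/
def fresh {K : ℕ} (l : List (Digit K)) : List (Option Section × Digit K) :=
  l.map fun d => (none, d)

/-- Finished sections pass the initial carry through unchanged, so the increment acts on the
unassigned digits only, and a carry left at the end becomes a new leading digit. -/
theorem sweep_grow (s : Section) (i : Fin (U.m + 1)) (mv : HeadMove) (l : List U.Sym)
    (hl : ∀ g ∈ l, g.1 ≠ none) (D : List (Digit U.K)) :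
    U.sweeper.sweep (.grow s i true, mv) (l ++ fresh D) =
      ((.grow s i true, .right), l ++ fresh (Digit.grow U.K D), []) := by
  have h : ∀ c, U.sweeper.sweep (.grow s i c, mv) (fresh D) =
      ((.grow s i true, .right),
        fresh ((carryMap inc c D).1 ++ if (carryMap inc c D).2 then [(inc true 0).1] else []), []) := by
    induction D with
    | nil => intro c; cases c <;> rfl
    | cons d D ih =>
      intro c
      rw [fresh, List.map_cons, sweep_cons]
      simp only [sweeper_visit, visit]
      rw [← fresh, ih]
      rfl
  rw [U.sweep_of_copy, h]
  · rfl
  · rintro ⟨_ | t, d⟩ hg n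
    · exact absurd rfl (hl _ hg)
    · rfl

theorem sweep_close (s : Section) (i : Fin (U.m + 1)) (mv : HeadMove) (l : List U.Sym)
    (hl : ∀ g ∈ l, g.1 ≠ none) (D : List (Digit U.K)) :
    U.sweeper.sweep (.close s i, mv) (l ++ fresh D) =
      ((.rewind (U.afterSegment s i), .left), l ++ List.replicate D.length (some s, 0), []) := by
  have h : U.sweeper.sweep (.close s i, mv) (fresh D) =
      ((.rewind (U.afterSegment s i), .left), List.replicate D.length (some s, 0), []) := by
    induction D with
    | nil => rfl
    | cons d D ih =>
      rw [fresh, List.map_cons, sweep_cons]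
      simp only [sweeper_visit, visit]
      rw [← fresh, ih]
      rfl
  rw [U.sweep_of_copy, h]
  · rfl
  · rintro ⟨_ | t, d⟩ hg n
    · exact absurd rfl (hl _ hg)
    · rfl

theorem sweep_rewind (k : U.Cont) (mv : HeadMove) (l : List U.Sym) :
    U.sweeper.sweep (.rewind k, mv) l = ((.rewind k, .left), l, []) := by
  rw [U.sweep_of_copy_all mv fun _ _ _ => rfl]
  simp [prepend, sweep_nil, finish]

theorem sweep_resume (k : U.Cont) (mv : HeadMove) (l : List U.Sym) :
    U.sweeper.sweep (.resume k, mv) l = ((U.contStart k, .stay), l, []) := by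
  rw [U.sweep_of_copy_all mv fun _ _ _ => rfl]
  simp [prepend, sweep_nil, finish]

theorem sweep_size (mv : HeadMove) (V : U.Vertex) :
    U.sweeper.sweep (.size, mv) V.tape = ((.source true, .stay), V.tape,
      V.digits.flatMap code ++ [true, false, true, true, false]) := by
  have h := U.sweep_label (c := .size) mv (e := id)
  rw [tape, h _ _ fun _ _ => rfl, h _ _ fun _ _ => rfl, h _ _ fun _ _ => rfl,
    ← List.append_nil (label .time _), h _ _ fun _ _ => rfl]
  simp [prepend, sweep_nil, finish, digits]

theorem sweep_target (mv : HeadMove) (V : U.Vertex) :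
    U.sweeper.sweep (.target, mv) V.tape = ((.balls true, .stay), V.tape,
      (Vertex.digits (U := U) ⟨V.cells.map fun _ => 0, V.state.map fun _ => U.encKind .target,
        V.pos.map fun _ => 0, V.time.map fun _ => 0⟩).flatMap code ++ [true, true, false]) := by
  rw [tape, U.sweep_label (c := .target) mv .cell _ (fun _ => 0) fun _ _ => rfl,
    U.sweep_label (c := .target) mv .state _ (fun _ => U.encKind .target) fun _ _ => rfl,
    U.sweep_label (c := .target) mv .pos _ (fun _ => 0) fun _ _ => rfl,
    ← List.append_nil (label .time _),
    U.sweep_label (c := .target) mv .time _ (fun _ => 0) fun _ _ => rfl]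
  simp [prepend, sweep_nil, finish, digits, -List.map_const, -List.map_const']

theorem sweep_source (mv : HeadMove) (V : U.Vertex) {d : Digit U.K} {C : List (Digit U.K)}
    (hC : V.cells = d :: C) :
    U.sweeper.sweep (.source true, mv) V.tape = ((.target, .stay), V.tape,
      (Vertex.digits (U := U) ⟨U.sourceDigit true .cell :: C.map fun _ => U.sourceDigit false .cell,
        V.state.map fun _ => U.encKind (.sim U.M.start),
        V.pos.map fun _ => 0, V.time.map fun _ => 0⟩).flatMap code ++ [true, true, false]) := by
  rw [tape, hC, show label .cell (d :: C) = (some .cell, d) :: label .cell C from rfl,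
    List.cons_append, sweep_cons]
  simp only [sweeper_visit, visit]
  rw [U.sweep_label (c := .source false) mv .cell _ (fun _ => U.sourceDigit false .cell)
      fun _ _ => rfl,
    U.sweep_label (c := .source false) mv .state _ (fun _ => U.encKind (.sim U.M.start))
      fun _ _ => rfl,
    U.sweep_label (c := .source false) mv .pos _ (fun _ => 0) fun _ _ => rfl,
    ← List.append_nil (label .time _),
    U.sweep_label (c := .source false) mv .time _ (fun _ => 0) fun _ _ => rfl]
  simp [prepend, sweep_nil, finish, digits, -List.map_const, -List.map_const']

/-- The time section serves as a counter: each sweep prints one zero bit of the number of balls, and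
the sweep with the overflow adds the leading one and the end mark. -/
theorem sweep_balls (mv : HeadMove) (V : U.Vertex) :
    U.sweeper.sweep (.balls true, mv) V.tape =
      ((if (carryMap inc true V.time).2 then .scan false (U.emptyInfo .leftEnd) else .balls true,
        .stay), Vertex.tape { V with time := (carryMap inc true V.time).1 },
        if (carryMap inc true V.time).2 then [true, false, true, true, false]
        else [true, false]) := by
  have h : ∀ c, U.sweeper.sweep (.balls c, mv) (label .time V.time) =
      ((if (carryMap inc c V.time).2 then .scan false (U.emptyInfo .leftEnd) else .balls true,
        .stay), label .time (carryMap inc c V.time).1,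
        if (carryMap inc c V.time).2 then [true, false, true, true, false]
        else [true, false]) := by
    induction V.time with
    | nil => intro c; cases c <;> rfl
    | cons d D ih =>
      intro c
      rw [label, List.map_cons, sweep_cons]
      simp only [sweeper_visit, visit]
      rw [← label, ih]
      rfl
  have hc : ∀ s D l, s ≠ .time → U.sweeper.sweep (.balls true, mv) (label s D ++ l) =
      prepend (label s D) [] (U.sweeper.sweep (.balls true, mv) l) := by
    intro s D l hs
    refine U.sweep_of_copy mv ?_ l
    intro g hg n
    obtain ⟨d, -, rfl⟩ := List.mem_map.1 hg
    cases s
    exacts [rfl, rfl, rfl, absurd rfl hs]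
  rw [tape, hc .cell _ _ nofun, hc .state _ _ nofun, hc .pos _ _ nofun, h]
  simp [prepend, tape]

theorem sweep_scan (top : Bool) (I : U.Info) (mv : HeadMove) (l : List U.Sym) :
    U.sweeper.sweep (.scan top I, mv) l =
      ((U.emitStart top false (l.foldl U.collect I), .stay), l, []) := by
  induction l generalizing I with
  | nil => rfl
  | cons g l ih =>
    rw [sweep_cons]
    simp only [sweeper_visit, visit]
    rw [ih]
    rfl

/-- The successor is never written on the tape. Each of its digits is determined by the collected
information, the old digit with its neighbours and a carry, so it is printed while the tape keeps
the vertex for the other edge. -/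
theorem sweep_emit (top b : Bool) (I : U.Info) (mv : HeadMove) {V : U.Vertex}
    (hS : V.state ≠ []) :
    U.sweeper.sweep (U.emitStart top b I, mv) V.tape =
      ((if b then .inc top true false false else U.emitStart top true I, .stay), V.tape,
        (U.applyPlan (U.plan I b) V).digits.flatMap code ++ [true, true, false]) := by
  have hcell : ∀ C q cp ct l, U.nextCell l.head? = none → ∃ q',
      U.sweeper.sweep (.emit top b I q cp ct, mv) (label .cell C ++ l) =
      prepend (label .cell C) ((applyPlan.go U (U.plan I b) q C).flatMap code)
        (U.sweeper.sweep (.emit top b I q' cp ct, mv) l) := by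
    intro C
    induction C with
    | nil => intro q cp ct l _; exact ⟨q, rfl⟩
    | cons d C ih =>
      intro q cp ct l hl
      obtain ⟨q', h⟩ := ih (some d) cp ct l hl
      refine ⟨q', ?_⟩
      have hn : U.nextCell (label .cell C ++ l).head? = C.head? := by
        cases C with
        | nil => exact hl
        | cons => rfl
      rw [show label .cell (d :: C) = (some .cell, d) :: label .cell C from rfl,
        List.cons_append, sweep_cons]
      simp only [sweeper_visit, visit, hn]
      rw [h, prepend_prepend]
      rfl
  have hpos : ∀ P q cp ct l, ∃ cp',
      U.sweeper.sweep (.emit top b I q cp ct, mv) (label .pos P ++ l) =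
      prepend (label .pos P) ((carryMap (U.posDigit (U.plan I b).pos) cp P).1.flatMap code)
        (U.sweeper.sweep (.emit top b I q cp' ct, mv) l) := by
    intro P
    induction P with
    | nil => intro q cp ct l; exact ⟨cp, rfl⟩
    | cons d P ih =>
      intro q cp ct l
      obtain ⟨cp', h⟩ := ih q _ ct l
      refine ⟨cp', ?_⟩
      rw [show label .pos (d :: P) = (some .pos, d) :: label .pos P from rfl,
        List.cons_append, sweep_cons]
      simp only [sweeper_visit, visit]
      rw [h, prepend_prepend]
      rfl
  have htime : ∀ Q q cp ct,
      U.sweeper.sweep (.emit top b I q cp ct, mv) (label .time Q) =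
      ((if b then .inc top true false false else U.emitStart top true I, .stay), label .time Q,
        (carryMap inc ct Q).1.flatMap code ++ [true, true, false]) := by
    intro Q
    induction Q with
    | nil => intro q cp ct; cases b <;> rfl
    | cons d Q ih =>
      intro q cp ct
      rw [show label .time (d :: Q) = (some .time, d) :: label .time Q from rfl, sweep_cons]
      simp only [sweeper_visit, visit]
      rw [ih]
      simp [prepend, carryMap]
  rw [tape, emitStart]
  obtain ⟨q', h1⟩ := hcell V.cells none true (U.plan I b).time
    (label .state V.state ++ (label .pos V.pos ++ label .time V.time)) (by
      obtain ⟨d, l, hd⟩ := List.exists_cons_of_ne_nil hS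
      rw [hd]
      rfl)
  obtain ⟨cp', h3⟩ := hpos V.pos q' true (U.plan I b).time (label .time V.time)
  rw [h1, U.sweep_label mv .state V.state (fun d => (U.plan I b).kind.getD d) fun _ _ => rfl, h3,
    htime]
  simp [prepend, digits, applyPlan]

/-- The last two arguments of `finish` tell whether the carry has reached the position section and
the time section, that is, whether the position changes and whether it wraps around to zero. The
input head is moved accordingly. The flags are set at the digits of these sections, which therefore
must not be empty. -/
theorem sweep_inc (top : Bool) (mv : HeadMove) {V : U.Vertex} (hP : V.pos ≠ [])
    (hQ : V.time ≠ []) :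
    U.sweeper.sweep (.inc top true false false, mv) V.tape =
      ((U.finish (.inc top (carryMap inc true V.digits).2
        (carryMap inc true (V.cells ++ V.state)).2
        (carryMap inc true (V.cells ++ (V.state ++ V.pos))).2)).1, (U.incVertex V).tape, []) := by
  have hplain : ∀ s, s = .cell ∨ s = .state → ∀ D c tp tt l,
      U.sweeper.sweep (.inc top c tp tt, mv) (label s D ++ l) =
      prepend (label s (carryMap inc c D).1) []
        (U.sweeper.sweep (.inc top (carryMap inc c D).2 tp tt, mv) l) := by
    intro s hs D
    induction D with
    | nil => intro c tp tt l; rfl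
    | cons d D ih =>
      intro c tp tt l
      rw [show label s (d :: D) = (some s, d) :: label s D from rfl, List.cons_append, sweep_cons]
      rcases hs with rfl | rfl
      all_goals
        simp only [sweeper_visit, visit]
        rw [ih, prepend_prepend]
        rfl
  -- A carry is passed on but never created, so the flag set at the first digit of a section does
  -- not change at the later ones.
  have hinc : ∀ c (d : Digit U.K), (inc c d).2 = true → c = true := by
    intro c d
    cases c <;> simp [inc]
  have hor : ∀ a b : Bool, (b = true → a = true) → (a || b) = a := by decide
  have hpos' : ∀ D c tp tt l, (c = true → tp = true) →
      U.sweeper.sweep (.inc top c tp tt, mv) (label .pos D ++ l) =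
      prepend (label .pos (carryMap inc c D).1) []
        (U.sweeper.sweep (.inc top (carryMap inc c D).2 tp tt, mv) l) := by
    intro D
    induction D with
    | nil => intro c tp tt l _; rfl
    | cons d D ih =>
      intro c tp tt l h
      rw [show label .pos (d :: D) = (some .pos, d) :: label .pos D from rfl, List.cons_append,
        sweep_cons]
      simp only [sweeper_visit, visit]
      rw [hor _ _ h,
        ih _ _ _ _ fun hc => h (hinc _ _ hc), prepend_prepend]
      rfl
  have htime' : ∀ D c tp tt l, (c = true → tt = true) →
      U.sweeper.sweep (.inc top c tp tt, mv) (label .time D ++ l) =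
      prepend (label .time (carryMap inc c D).1) []
        (U.sweeper.sweep (.inc top (carryMap inc c D).2 tp tt, mv) l) := by
    intro D
    induction D with
    | nil => intro c tp tt l _; rfl
    | cons d D ih =>
      intro c tp tt l h
      rw [show label .time (d :: D) = (some .time, d) :: label .time D from rfl, List.cons_append,
        sweep_cons]
      simp only [sweeper_visit, visit]
      rw [hor _ _ h,
        ih _ _ _ _ fun hc => h (hinc _ _ hc), prepend_prepend]
      rfl
  have hpos : ∀ D c l, D ≠ [] →
      U.sweeper.sweep (.inc top c false false, mv) (label .pos D ++ l) =
      prepend (label .pos (carryMap inc c D).1) []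
        (U.sweeper.sweep (.inc top (carryMap inc c D).2 c false, mv) l) := by
    intro D c l hD
    obtain ⟨d, D, rfl⟩ := List.exists_cons_of_ne_nil hD
    rw [show label .pos (d :: D) = (some .pos, d) :: label .pos D from rfl, List.cons_append,
      sweep_cons]
    simp only [sweeper_visit, visit]
    rw [Bool.false_or, hpos' _ _ _ _ _ (hinc _ _), prepend_prepend]
    rfl
  have htime : ∀ D c tp l, D ≠ [] →
      U.sweeper.sweep (.inc top c tp false, mv) (label .time D ++ l) =
      prepend (label .time (carryMap inc c D).1) []
        (U.sweeper.sweep (.inc top (carryMap inc c D).2 tp c, mv) l) := by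
    intro D c tp l hD
    obtain ⟨d, D, rfl⟩ := List.exists_cons_of_ne_nil hD
    rw [show label .time (d :: D) = (some .time, d) :: label .time D from rfl, List.cons_append,
      sweep_cons]
    simp only [sweeper_visit, visit]
    rw [Bool.false_or, htime' _ _ _ _ _ (hinc _ _), prepend_prepend]
    rfl
  have hfin : ∀ c tp tt, (U.finish (.inc top c tp tt)).2 = (none, []) := by
    intro c tp tt
    cases top <;> cases c <;> cases tt <;> rfl
  rw [tape, hplain _ (.inl rfl), hplain _ (.inr rfl), hpos _ _ _ hP,
    ← List.append_nil (label .time _), htime _ _ _ _ hQ, sweep_nil]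
  simp [prepend, tape, incVertex, carryMap_append, digits, hfin]

end Coding

/-! ### Uniqueness of digit expansions -/

namespace Digit

variable {K : ℕ}

theorem ofNat_value_add (l : List (Digit K)) (k : ℕ) :
    ofNat K l.length (value l + (2 ^ K) ^ l.length * k) = l :=
  value_inj (by simp) (by rw [value_ofNat, Nat.add_mul_mod_self_left, Nat.mod_eq_of_lt (value_lt l)])

theorem ofNat_zero (n : ℕ) : ofNat K n 0 = List.replicate n 0 :=
  value_inj (by simp) (by rw [value_ofNat, value_replicate_zero, Nat.zero_mod])

theorem length_count_mono {i j : ℕ} (h : i ≤ j) :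
    (count K i).length ≤ (count K j).length := by
  refine monotone_nat_of_le_succ (f := fun n => (count K n).length) (fun n => ?_) h
  simp [count_succ, grow]

end Digit

namespace Coding

open Sweeper Digit Vertex

variable (U : Coding)

/-- The position section of a malformed vertex may exceed the length of the input. The clamped head
then stands on the right end marker, which is what `inputSymbolAt` shows at all larger positions. -/
theorem inputSymbolAt_min (x : List Bool) (p : ℕ) :
    inputSymbolAt x (min p (x.length + 1)) = inputSymbolAt x p := by
  rcases le_total p (x.length + 1) with h | h
  · rw [min_eq_left h]
  · rw [min_eq_right h]
    rcases p with _ | p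
    · omega
    · simp [inputSymbolAt, show ¬ p < x.length by omega]

/-! ### Numbers of vertices -/

/-- The vertex with a given number, up to the leading bit of the number. -/
def ofNumber (L v : ℕ) : U.Vertex where
  cells := ofNat U.K L v
  state := ofNat U.K L (v / (2 ^ U.K) ^ L)
  pos := ofNat U.K L (v / (2 ^ U.K) ^ L / (2 ^ U.K) ^ L)
  time := ofNat U.K L (v / (2 ^ U.K) ^ L / (2 ^ U.K) ^ L / (2 ^ U.K) ^ L)

theorem hasLength_ofNumber (L v : ℕ) : (U.ofNumber L v).HasLength L :=
  ⟨by simp [ofNumber], by simp [ofNumber], by simp [ofNumber], by simp [ofNumber]⟩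

variable {U}

theorem Vertex.HasLength.value_digits {V : U.Vertex} {L : ℕ} (h : V.HasLength L) :
    value V.digits = value V.cells + (2 ^ U.K) ^ L * (value V.state + (2 ^ U.K) ^ L *
      (value V.pos + (2 ^ U.K) ^ L * value V.time)) := by
  rw [digits, value_append, value_append, value_append, h.cells, h.state, h.pos]

theorem Vertex.HasLength.value_digits_lt {V : U.Vertex} {L : ℕ} (h : V.HasLength L) :
    value V.digits < ((2 ^ U.K) ^ L) ^ 4 := by
  have := value_lt V.digits
  rwa [h.length_digits, mul_comm 4, pow_mul] at this

theorem Vertex.HasLength.ofNumber_value_add {V : U.Vertex} {L : ℕ} (h : V.HasLength L) (k : ℕ) :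
    U.ofNumber L (value V.digits + ((2 ^ U.K) ^ L) ^ 4 * k) = V := by
  obtain ⟨C, S, P, Q⟩ := V
  obtain ⟨rfl, h2, h3, h4⟩ := id h
  dsimp only at h2 h3 h4
  set B := (2 ^ U.K) ^ C.length with hB
  have hpos : 0 < B := by positivity
  have e : value (Vertex.digits (U := U) ⟨C, S, P, Q⟩) + B ^ 4 * k =
      value C + B * (value S + B * (value P + B * (value Q + B * k))) := by
    rw [h.value_digits]
    ring
  have hC : value C / B = 0 := Nat.div_eq_of_lt (value_lt C)
  have hS : value S / B = 0 := Nat.div_eq_of_lt (by rw [hB, ← h2]; exact value_lt S)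
  have hP : value P / B = 0 := Nat.div_eq_of_lt (by rw [hB, ← h3]; exact value_lt P)
  rw [e, ofNumber, ← hB]
  simp only [Nat.add_mul_div_left _ _ hpos, hC, hS, hP, zero_add]
  congr 1
  · exact ofNat_value_add C _
  · rw [hB, ← h2]
    exact ofNat_value_add S _
  · rw [hB, ← h3]
    exact ofNat_value_add P _
  · rw [hB, ← h4]
    exact ofNat_value_add Q _

theorem Vertex.HasLength.ofNumber_value {V : U.Vertex} {L : ℕ} (h : V.HasLength L) :
    U.ofNumber L (value V.digits) = V := h.ofNumber_value_add 0

theorem value_ofNumber {L v : ℕ} (hv : v < ((2 ^ U.K) ^ L) ^ 4) :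
    value (U.ofNumber L v).digits = v := by
  rw [(U.hasLength_ofNumber L v).value_digits]
  simp only [ofNumber, value_ofNat]
  set B := (2 ^ U.K) ^ L
  have : v / B / B / B < B := by
    rw [Nat.div_div_eq_div_mul, Nat.div_div_eq_div_mul]
    exact Nat.div_lt_of_lt_mul (by rw [mul_assoc]; convert hv using 1; ring)
  rw [Nat.mod_eq_of_lt this, Nat.mod_add_div, Nat.mod_add_div, Nat.mod_add_div]

/-- The leading bit lies above all four sections. A number and its copy with the leading bit thus
have the same edges, and two identical passes over the sections print the list of all edges. -/
theorem ofNumber_add (L v : ℕ) :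
    U.ofNumber L (v + ((2 ^ U.K) ^ L) ^ 4) = U.ofNumber L v := by
  have hd : ∀ w j : ℕ, (w + (2 ^ U.K) ^ L * j) / (2 ^ U.K) ^ L = w / (2 ^ U.K) ^ L + j :=
    fun w j => Nat.add_mul_div_left _ _ (by positivity)
  have hm : ∀ w j : ℕ, ofNat U.K L (w + (2 ^ U.K) ^ L * j) = ofNat U.K L w := fun w j =>
    value_inj (by simp) (by rw [value_ofNat, value_ofNat, Nat.add_mul_mod_self_left])
  rw [show v + ((2 ^ U.K) ^ L) ^ 4 = v + (2 ^ U.K) ^ L * ((2 ^ U.K) ^ L * ((2 ^ U.K) ^ L *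
    ((2 ^ U.K) ^ L * 1))) by ring]
  simp only [ofNumber, hd, hm]

variable (U)

/-- The number of a vertex in the instance. -/
def number (L : ℕ) (V : U.Vertex) : ℕ := value V.digits + ((2 ^ U.K) ^ L) ^ 4

variable {U}

theorem Vertex.HasLength.ofNumber_number {V : U.Vertex} {L : ℕ} (h : V.HasLength L) :
    U.ofNumber L (U.number L V) = V := by
  rw [number, ofNumber_add, h.ofNumber_value]

theorem Vertex.HasLength.encodeBinary_number {V : U.Vertex} {L : ℕ} (h : V.HasLength L) :
    encodeBinary (U.number L V) = V.digits.flatMap code ++ [true, true, false] := by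
  have := encodeBinary_value_add_pow V.digits
  rwa [h.length_digits, mul_comm 4, pow_mul] at this

variable (U)

theorem hasLength_incVertex {V : U.Vertex} {L : ℕ} (h : V.HasLength L) :
    (U.incVertex V).HasLength L :=
  ⟨by simp [incVertex, h.cells], by simp [incVertex, h.state], by simp [incVertex, h.pos],
    by simp [incVertex, h.time]⟩

theorem incVertex_ofNumber {L v : ℕ} (hv : v + 1 < ((2 ^ U.K) ^ L) ^ 4) :
    U.incVertex (U.ofNumber L v) = U.ofNumber L (v + 1) := by
  have h := U.hasLength_ofNumber L v
  rw [← (U.hasLength_incVertex h).ofNumber_value, digits_incVertex, value_carryMap_inc_of_lt,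
    value_ofNumber (by omega)]
  rwa [h.length_digits, mul_comm 4, pow_mul, value_ofNumber (by omega)]

theorem incVertex_ofNumber_last {L v : ℕ} (hv : v + 1 = ((2 ^ U.K) ^ L) ^ 4) :
    U.incVertex (U.ofNumber L v) = U.ofNumber L 0 := by
  have h := U.hasLength_ofNumber L v
  rw [← (U.hasLength_incVertex h).ofNumber_value, digits_incVertex, value_carryMap_inc_of_eq,
    value_replicate_zero]
  rwa [h.length_digits, mul_comm 4, pow_mul, value_ofNumber (by omega)]

/-- The vertex of a configuration at a given time. -/
def configVertex (L : ℕ) (γ : U.M.Config) (τ : ℕ) : U.Vertex where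
  cells := (List.range L).map fun j => U.encCell fun i => (γ.cell i j, decide (γ.head i = j))
  state := List.replicate L (U.encKind (.sim γ.state))
  pos := ofNat U.K L γ.inputHead
  time := ofNat U.K L τ

/-- The other vertices that matter: those of the counter and the target. -/
def kindVertex (L : ℕ) (k : Kind U.M.State) (τ : ℕ) : U.Vertex where
  cells := List.replicate L 0
  state := List.replicate L (U.encKind k)
  pos := List.replicate L 0
  time := ofNat U.K L τ

theorem hasLength_configVertex (L : ℕ) (γ : U.M.Config) (τ : ℕ) :
    (U.configVertex L γ τ).HasLength L :=
  ⟨by simp [configVertex], by simp [configVertex], by simp [configVertex], by simp [configVertex]⟩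

theorem hasLength_kindVertex (L : ℕ) (k : Kind U.M.State) (τ : ℕ) :
    (U.kindVertex L k τ).HasLength L :=
  ⟨by simp [kindVertex], by simp [kindVertex], by simp [kindVertex], by simp [kindVertex]⟩

/-! ### The computation of the sweeping machine -/

section Reaches

variable {U} {x : List Bool} {N : ℕ}

theorem reaches_of_sweep {c c₁ c' : U.Ctl} {mv mv' : HeadMove} {p p' : ℕ} {l l' : List U.Sym}
    {o o' u : List Bool} (hc : c ≠ .done) (he : U.enter c (inputSymbolAt x p) = c₁)
    (hs : U.sweeper.sweep (c₁, mv) l = ((c', mv'), l', u))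
    (hp : min (mv'.apply p) (x.length + 1) = p') (ho : o ++ u = o') (hl : l.length ≤ N)
    (hl' : l'.length ≤ N) :
    U.sweeper.Reaches x N ⟨(c, mv), p, l, o⟩ ⟨(c', mv'), p', l', o'⟩ := by
  refine Reaches.single hl hc ?_ hl'
  have h : U.sweeper.sweep (U.sweeper.enter (c, mv) (inputSymbolAt x p)) l =
      ((c', mv'), l', u) := by rw [← hs, ← he]; rfl
  simp only [next, h, ho]
  rw [← hp]
  rfl

theorem reaches_rewind (k : U.Cont) (mv : HeadMove) {p : ℕ} {l : List U.Sym} (o : List Bool)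
    (hp : p ≤ x.length + 1) (hl : l.length ≤ N) :
    U.sweeper.Reaches x N ⟨(.rewind k, mv), p, l, o⟩ ⟨(U.contStart k, .stay), 0, l, o⟩ := by
  induction p generalizing mv with
  | zero =>
    exact reaches_of_sweep nofun rfl (U.sweep_resume k mv l) (by simp [HeadMove.apply])
      (by simp) hl hl
  | succ p ih =>
    refine Reaches.trans ?_ (ih .left (by omega))
    refine reaches_of_sweep nofun (c₁ := .rewind k) ?_ (U.sweep_rewind k mv l)
      (by simp [HeadMove.apply]; omega) (by simp) hl hl
    rw [inputSymbolAt]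
    split_ifs <;> rfl

/-- The input acts as a clock: while the head walks from the left end marker to the right one, each
step increments the segment. Afterwards its digits are erased, since only its length matters. -/
theorem reaches_segment (s : Section) (i : Fin (U.m + 1)) (mv : HeadMove) {l : List U.Sym}
    (o : List Bool) (hl : ∀ g ∈ l, g.1 ≠ none)
    (hN : l.length + (count U.K (x.length + 1)).length ≤ N) :
    U.sweeper.Reaches x N ⟨(.grow s i true, mv), 0, l, o⟩
      ⟨(U.contStart (U.afterSegment s i), .stay), 0,
        l ++ List.replicate (count U.K (x.length + 1)).length (some s, 0), o⟩ := by
  have hlen : ∀ j ≤ x.length + 1, (l ++ fresh (count U.K j)).length ≤ N := by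
    intro j hj
    have := length_count_mono (K := U.K) hj
    simp [fresh]
    omega
  have hcount : ∀ j ≤ x.length + 1, ∃ mv', U.sweeper.Reaches x N ⟨(.grow s i true, mv), 0, l, o⟩
      ⟨(.grow s i true, mv'), j, l ++ fresh (count U.K j), o⟩ := by
    intro j
    induction j with
    | zero =>
      intro h
      have hr := hlen 0 h
      refine ⟨mv, ?_⟩
      simp only [count, Function.iterate_zero, id, fresh, List.map_nil, List.append_nil] at hr ⊢
      exact .refl hr
    | succ j ih =>
      intro hj
      obtain ⟨mv', h⟩ := ih (by omega)
      refine ⟨.right, h.trans ?_⟩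
      have hs := U.sweep_grow s i mv' l hl (count U.K j)
      rw [← count_succ] at hs
      refine reaches_of_sweep nofun (c₁ := .grow s i true) ?_ hs (by simp [HeadMove.apply]; omega)
        (by simp) (hlen j (by omega)) (hlen (j + 1) hj)
      rcases j with _ | j
      · rfl
      · rw [inputSymbolAt, dif_pos (by omega)]
        rfl
  obtain ⟨mv', h⟩ := hcount _ le_rfl
  refine h.trans (Reaches.trans (c' := ⟨(.rewind (U.afterSegment s i), .left), x.length,
    l ++ List.replicate (count U.K (x.length + 1)).length (some s, 0), o⟩) ?_
    (reaches_rewind _ _ _ (Nat.le_succ _) (by simpa using hN)))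
  refine reaches_of_sweep nofun (c₁ := .close s i) ?_ (U.sweep_close s i mv' l hl _)
    (by simp [HeadMove.apply]) (by simp) (hlen _ le_rfl) (by simpa using hN)
  rw [inputSymbolAt, dif_neg (by omega)]
  rfl

theorem reaches_section (s : Section) (mv : HeadMove) {l : List U.Sym} (o : List Bool) {d i : ℕ}
    (hd : (count U.K (x.length + 1)).length = d) (hi : i < U.m + 1) (hl : ∀ g ∈ l, g.1 ≠ none)
    (hN : l.length + (i + 1) * d ≤ N) :
    U.sweeper.Reaches x N ⟨(.grow s ⟨i, hi⟩ true, mv), 0, l, o⟩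
      ⟨(U.contStart (U.afterSegment s 0), .stay), 0,
        l ++ List.replicate ((i + 1) * d) (some s, 0), o⟩ := by
  induction i generalizing l mv with
  | zero =>
    have := reaches_segment (x := x) (N := N) s ⟨0, hi⟩ mv o hl (by rw [hd]; omega)
    rw [hd] at this
    simpa using this
  | succ i ih =>
    rw [add_mul, one_mul] at hN
    have h1 := reaches_segment (x := x) (N := N) s ⟨i + 1, hi⟩ mv o hl (by
      rw [hd]
      exact le_trans (by gcongr; exact Nat.le_add_left _ _) hN)
    rw [hd] at h1
    have h2 := ih (l := l ++ List.replicate d (some s, 0)) .stay (by omega) (by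
      intro g hg
      rcases List.mem_append.1 hg with h | h
      · exact hl g h
      · rw [List.eq_of_mem_replicate h]
        nofun) (by simp; omega)
    rw [List.append_assoc, ← List.replicate_add, add_comm d] at h2
    rw [add_mul (i + 1), one_mul]
    have h3 : U.contStart (U.afterSegment s ⟨i + 1, hi⟩) = .grow s ⟨i, by omega⟩ true := by
      cases s <;> rfl
    rw [h3] at h1
    exact h1.trans h2

theorem tape_ofNumber_zero (L : ℕ) : (U.ofNumber L 0).tape =
    List.replicate L (some .cell, 0) ++ (List.replicate L (some .state, 0) ++
      (List.replicate L (some .pos, 0) ++ List.replicate L (some .time, 0))) := by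
  simp [tape, ofNumber, ofNat_zero, label]

theorem reaches_size {L : ℕ} (hL : L = (U.m + 1) * (count U.K (x.length + 1)).length) :
    U.sweeper.Reaches x (4 * L) ⟨U.sweeper.start, 0, [], []⟩
      ⟨(.size, .stay), 0, (U.ofNumber L 0).tape, []⟩ := by
  have hne : ∀ (s : Section) (l : List U.Sym), (∀ g ∈ l, g.1 ≠ none) →
      ∀ g ∈ l ++ List.replicate L (some s, 0), g.1 ≠ none := by
    intro s l h g hg
    rcases List.mem_append.1 hg with h' | h'
    · exact h g h'
    · rw [List.eq_of_mem_replicate h']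
      nofun
  have h : ∀ (s : Section) (l : List U.Sym) (mv : HeadMove), (∀ g ∈ l, g.1 ≠ none) →
      l.length + L ≤ 4 * L →
      U.sweeper.Reaches x (4 * L) ⟨(.grow s (Fin.last _) true, mv), 0, l, []⟩
      ⟨(U.contStart (U.afterSegment s 0), .stay), 0, l ++ List.replicate L (some s, 0), []⟩ := by
    intro s l mv hl hN
    have := reaches_section (x := x) (N := 4 * L) s mv [] rfl (Nat.lt_succ_self U.m) hl
      (by rwa [← hL])
    rwa [← hL] at this
  have h1 := hne .cell [] (by simp)
  have h2 := hne .state _ h1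
  have h3 := hne .pos _ h2
  rw [tape_ofNumber_zero]
  have := (h .cell [] .stay (by simp) (by simp; omega)).trans
    ((h .state _ .stay h1 (by simp; omega)).trans
    ((h .pos _ .stay h2 (by simp; omega)).trans (h .time _ .stay h3 (by simp; omega))))
  simp only [List.nil_append, List.append_assoc] at this
  exact this

/-- All digits of `Q` are maximal when `r = 0`, so `r + 1` sweeps remain, the last of which
overflows and restores the zero vertex. -/
theorem reaches_balls {L : ℕ} (mv : HeadMove) (o : List Bool) (r : ℕ) {Q : List (Digit U.K)}
    (hQ : Q.length = L) (hr : value Q + r + 1 = (2 ^ U.K) ^ L) :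
    U.sweeper.Reaches x (4 * L) ⟨(.balls true, mv), 0, Vertex.tape { U.ofNumber L 0 with time := Q }, o⟩
      ⟨(.scan false (U.emptyInfo .leftEnd), .stay), 0, (U.ofNumber L 0).tape,
        o ++ ((List.replicate (r + 1) [true, false]).flatten ++ [true, true, false])⟩ := by
  have hlen : ∀ Q' : List (Digit U.K), Q'.length = L →
      (Vertex.tape { U.ofNumber L 0 with time := Q' }).length ≤ 4 * L := fun Q' hQ' =>
    (Vertex.HasLength.length_tape ⟨by simp [ofNumber], by simp [ofNumber], by simp [ofNumber],
      hQ'⟩).le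
  induction r generalizing Q o mv with
  | zero =>
    have hv : value Q + 1 = (2 ^ U.K) ^ Q.length := by rw [hQ, ← hr]
    have hs := U.sweep_balls mv { U.ofNumber L 0 with time := Q }
    dsimp only at hs
    rw [carryMap_inc_snd, decide_eq_true hv, value_carryMap_inc_of_eq hv, hQ] at hs
    have hz : ({ U.ofNumber L 0 with time := List.replicate L 0 } : U.Vertex) =
        U.ofNumber L 0 := by
      simp [ofNumber, ofNat_zero]
    rw [hz] at hs
    exact reaches_of_sweep nofun rfl hs (by simp [HeadMove.apply]) (by simp) (hlen Q hQ)
      (U.hasLength_ofNumber L 0).length_tape.le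
  | succ r ih =>
    have hv : value Q + 1 < (2 ^ U.K) ^ Q.length := by rw [hQ, ← hr]; omega
    have hs := U.sweep_balls mv { U.ofNumber L 0 with time := Q }
    dsimp only at hs
    rw [carryMap_inc_snd, decide_eq_false hv.ne] at hs
    have h2 := ih (Q := (carryMap inc true Q).1) .stay (o ++ [true, false]) (by simpa using hQ)
      (by rw [value_carryMap_inc_of_lt hv]; omega)
    rw [List.replicate_succ, List.flatten_cons, List.append_assoc, ← List.append_assoc o]
    exact (reaches_of_sweep (c := .balls true) (p := 0) (p' := 0) nofun rfl hs
      (by simp [HeadMove.apply]) rfl (hlen Q hQ) (hlen _ (by simpa using hQ))).trans h2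

/-- The part of the encoding of the instance that describes the edges at a vertex. -/
noncomputable def edges (U : Coding) (x : List Bool) (L v : ℕ) : List Bool :=
  encodeBinary (U.number L (U.succ x false (U.ofNumber L v))) ++
    encodeBinary (U.number L (U.succ x true (U.ofNumber L v)))

/-- One sweep collects the information and one sweep for each edge prints a successor. The input
head stands at the position named by the vertex, clamped to the input, so the scan sees the right
symbol. -/
theorem reaches_inc {L v : ℕ} (hL : 0 < L) (top : Bool) (I : U.Info) (mv : HeadMove)
    (o : List Bool) :
    U.sweeper.Reaches x (4 * L) ⟨(.scan top I, mv), min (value (U.ofNumber L v).pos) (x.length + 1),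
      (U.ofNumber L v).tape, o⟩
      ⟨(.inc top true false false, .stay), min (value (U.ofNumber L v).pos) (x.length + 1),
        (U.ofNumber L v).tape, o ++ U.edges x L v⟩ := by
  set V := U.ofNumber L v with hV
  have hlen := U.hasLength_ofNumber L v
  rw [← hV] at hlen
  have hle := hlen.length_tape.le
  have hne : V.state ≠ [] := by
    rw [← List.length_pos_iff, hlen.state]
    exact hL
  have h1 := U.sweep_scan top (U.emptyInfo (inputSymbolAt x (value V.pos))) mv V.tape
  have h2 := U.sweep_emit top false (U.info (inputSymbolAt x (value V.pos)) V) .stay hne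
  have h3 := U.sweep_emit top true (U.info (inputSymbolAt x (value V.pos)) V) .stay hne
  have hs : ∀ b, (U.succ x b V).HasLength L := fun b => U.hasLength_applyPlan _ hlen
  have hp : min (HeadMove.stay.apply (min (value V.pos) (x.length + 1))) (x.length + 1) =
      min (value V.pos) (x.length + 1) := by simp [HeadMove.apply]
  refine Reaches.trans (reaches_of_sweep nofun (o' := o) ?_ h1 hp (by simp) hle hle)
    (Reaches.trans (reaches_of_sweep nofun rfl h2 hp rfl hle hle)
    (reaches_of_sweep nofun rfl h3 hp ?_ hle hle))
  · rw [inputSymbolAt_min]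
    rfl
  · rw [edges, ← hV, (hs false).encodeBinary_number, (hs true).encodeBinary_number]
    simp [succ]

/-- The invariant is the agreement of the input head with the position section. Vertices are visited
in increasing order of their numbers and the position lies above the cells and the state, so it
stays, grows by one or wraps to zero from one vertex to the next. Here `r + 1` vertices of the pass
remain. -/
theorem reaches_vertices {L : ℕ} (hL : 0 < L) (top : Bool) (r v : ℕ) (I : U.Info) (mv : HeadMove)
    (o : List Bool) (hr : v + r + 1 = ((2 ^ U.K) ^ L) ^ 4) :
    ∃ mv', ∃ p ≤ x.length + 1, U.sweeper.Reaches x (4 * L)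
      ⟨(.scan top I, mv), min (value (U.ofNumber L v).pos) (x.length + 1),
        (U.ofNumber L v).tape, o⟩
      ⟨(if top then .done else .rewind (.vertices true), mv'), p,
        (U.ofNumber L 0).tape, o ++ (List.range' v (r + 1)).flatMap (U.edges x L)⟩ := by
  induction r generalizing v I mv o with
  | zero =>
    have h1 := reaches_inc (x := x) (v := v) hL top I mv o
    have hlen := U.hasLength_ofNumber L v
    have hs := U.sweep_inc top .stay (V := U.ofNumber L v)
      (by rw [← List.length_pos_iff, hlen.pos]; exact hL)
      (by rw [← List.length_pos_iff, hlen.time]; exact hL)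
    rw [carryMap_inc_snd, hlen.length_digits, mul_comm 4, pow_mul, value_ofNumber (by omega),
      decide_eq_true hr, U.incVertex_ofNumber_last hr] at hs
    have hle := fun v => (U.hasLength_ofNumber L v).length_tape.le
    have ho : (List.range' v (0 + 1)).flatMap (U.edges x L) = U.edges x L v := by simp
    rw [ho]
    cases top
    · exact ⟨.left, _, min_le_right _ _, h1.trans (reaches_of_sweep nofun rfl hs rfl (by simp) (hle _)
        (hle _))⟩
    · exact ⟨.stay, _, min_le_right _ _, h1.trans (reaches_of_sweep nofun rfl hs rfl (by simp) (hle _)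
        (hle _))⟩
  | succ r ih =>
    have h1 := reaches_inc (x := x) (v := v) hL top I mv o
    have hlen := U.hasLength_ofNumber L v
    have hv : v + 1 < ((2 ^ U.K) ^ L) ^ 4 := by omega
    have hi := U.incVertex_ofNumber hv
    have hs := U.sweep_inc top .stay (V := U.ofNumber L v)
      (by rw [← List.length_pos_iff, hlen.pos]; exact hL)
      (by rw [← List.length_pos_iff, hlen.time]; exact hL)
    rw [carryMap_inc_snd, hlen.length_digits, mul_comm 4, pow_mul, value_ofNumber (by omega),
      decide_eq_false hv.ne, hi] at hs
    have hle := fun v => (U.hasLength_ofNumber L v).length_tape.le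
    have hpos : (U.ofNumber L (v + 1)).pos =
        (carryMap inc (carryMap inc true ((U.ofNumber L v).cells ++ (U.ofNumber L v).state)).2
          (U.ofNumber L v).pos).1 := by
      rw [← hi]
      rfl
    have hc3 : (carryMap inc true ((U.ofNumber L v).cells ++ ((U.ofNumber L v).state ++
        (U.ofNumber L v).pos))).2 = (carryMap inc (carryMap inc true ((U.ofNumber L v).cells ++
          (U.ofNumber L v).state)).2 (U.ofNumber L v).pos).2 := by
      rw [← List.append_assoc, carryMap_append]
    rw [hc3] at hs
    -- The alternatives differ only in the head movement left in the memory: `.right` if the carry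
    -- ends in the position section, and `.stay` if it does not reach that section or if it passes
    -- through it and the head is rewound.
    have hfin : U.sweeper.Reaches x (4 * L)
        ⟨(.inc top true false false, .stay), min (value (U.ofNumber L v).pos) (x.length + 1),
          (U.ofNumber L v).tape, o ++ U.edges x L v⟩
        ⟨(.scan top (U.emptyInfo .leftEnd), .stay),
          min (value (U.ofNumber L (v + 1)).pos) (x.length + 1), (U.ofNumber L (v + 1)).tape,
          o ++ U.edges x L v⟩ ∨ U.sweeper.Reaches x (4 * L)
        ⟨(.inc top true false false, .stay), min (value (U.ofNumber L v).pos) (x.length + 1),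
          (U.ofNumber L v).tape, o ++ U.edges x L v⟩
        ⟨(.scan top (U.emptyInfo .leftEnd), .right),
          min (value (U.ofNumber L (v + 1)).pos) (x.length + 1), (U.ofNumber L (v + 1)).tape,
          o ++ U.edges x L v⟩ := by
      cases hc : (carryMap inc true ((U.ofNumber L v).cells ++ (U.ofNumber L v).state)).2
      · rw [hc, carryMap_inc_false] at hs hpos
        left
        refine reaches_of_sweep nofun rfl (hs.trans ?_) (by rw [hpos]; simp [HeadMove.apply])
          (List.append_nil _) (hle _) (hle _)
        cases top <;> rfl
      · rw [hc] at hs hpos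
        by_cases ht : value (U.ofNumber L v).pos + 1 = (2 ^ U.K) ^ (U.ofNumber L v).pos.length
        · rw [carryMap_inc_snd, decide_eq_true ht] at hs
          rw [value_carryMap_inc_of_eq ht] at hpos
          left
          refine Reaches.trans (reaches_of_sweep (c' := .rewind (.vertices top))
            (mv' := .left) nofun rfl (hs.trans ?_) rfl (List.append_nil _) (hle v) (hle (v + 1))) ?_
          · cases top <;> rfl
          · rw [hpos, value_replicate_zero, Nat.zero_min]
            exact reaches_rewind _ _ _ (min_le_right _ _) (hle _)
        · have ht' : value (U.ofNumber L v).pos + 1 < (2 ^ U.K) ^ (U.ofNumber L v).pos.length :=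
            lt_of_le_of_ne (value_lt _) ht
          rw [carryMap_inc_snd, decide_eq_false ht] at hs
          right
          refine reaches_of_sweep nofun rfl (hs.trans ?_) ?_ (List.append_nil _) (hle _) (hle _)
          · cases top <;> rfl
          · rw [hpos, value_carryMap_inc_of_lt ht']
            simp only [HeadMove.apply]
            omega
    rw [List.range'_succ, List.flatMap_cons, ← List.append_assoc]
    rcases hfin with h2 | h2
    · obtain ⟨mv', p, hp, h3⟩ := ih (v + 1) (U.emptyInfo .leftEnd) .stay (o ++ U.edges x L v)
        (by omega)
      exact ⟨mv', p, hp, h1.trans (h2.trans h3)⟩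
    · obtain ⟨mv', p, hp, h3⟩ := ih (v + 1) (U.emptyInfo .leftEnd) .right (o ++ U.edges x L v)
        (by omega)
      exact ⟨mv', p, hp, h1.trans (h2.trans h3)⟩

/-- The part of the encoding of the instance before the list of edges. -/
noncomputable def header (U : Coding) (L : ℕ) : List Bool :=
  encodeBinary (2 * ((2 ^ U.K) ^ L) ^ 4) ++
    encodeBinary (U.number L (U.configVertex L U.M.init 0)) ++
    encodeBinary (U.number L (U.kindVertex L .target 0)) ++
    encodeBinary (2 ^ (2 ^ U.K) ^ L)

theorem reaches_header {L : ℕ} (hpos : 0 < L) :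
    U.sweeper.Reaches x (4 * L) ⟨(.size, .stay), 0, (U.ofNumber L 0).tape, []⟩
      ⟨(.scan false (U.emptyInfo .leftEnd), .stay), 0, (U.ofNumber L 0).tape, U.header L⟩ := by
  have hle := (U.hasLength_ofNumber L 0).length_tape.le
  have hX : 0 < ((2 ^ U.K) ^ L) ^ 4 := by positivity
  have hT : 0 < (2 ^ U.K) ^ L := by positivity
  set X := ((2 ^ U.K) ^ L) ^ 4 with hXd
  -- The number of vertices is `2 * X`, that is, the zero digits of all sections followed by the
  -- bits `0, 1` of the number `2`.
  have e1 : (U.ofNumber L 0).digits.flatMap code ++ [true, false, true, true, false] =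
      encodeBinary (2 * X) := by
    have := encodeBinary_value_add (U.ofNumber L 0).digits two_pos
    rw [(U.hasLength_ofNumber L 0).length_digits, value_ofNumber hX, zero_add, mul_comm 4,
      pow_mul, ← hXd, mul_comm X] at this
    rw [this]
    simp [encodeBinary, Nat.bits, Nat.binaryRec]
  have h1 := reaches_of_sweep (x := x) (c := .size) (p := 0) (p' := 0) (o := []) nofun rfl
    (U.sweep_size .stay (U.ofNumber L 0)) (by simp [HeadMove.apply]) rfl hle hle
  rw [e1] at h1
  -- The first cell of the source is separated, since it alone carries the head marks.
  obtain ⟨L', rfl⟩ : ∃ L', L = L' + 1 := ⟨L - 1, by omega⟩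
  have e2 := (U.hasLength_configVertex (L' + 1) U.M.init 0).encodeBinary_number
  have e3 := (U.hasLength_kindVertex (L' + 1) .target 0).encodeBinary_number
  have hs := U.sweep_source .stay (U.ofNumber (L' + 1) 0) (d := 0) (C := List.replicate L' 0)
    (by simp only [ofNumber, ofNat_zero]; rfl)
  have hsv : (⟨U.sourceDigit true .cell :: (List.replicate L' 0).map
      fun (_ : Digit U.K) => U.sourceDigit false .cell,
      (U.ofNumber (L' + 1) 0).state.map fun _ => U.encKind (.sim U.M.start),
      (U.ofNumber (L' + 1) 0).pos.map fun _ => 0, (U.ofNumber (L' + 1) 0).time.map fun _ => 0⟩ :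
      U.Vertex) = U.configVertex (L' + 1) U.M.init 0 := by
    simp only [configVertex, ofNumber, ofNat_zero, Nat.zero_div, List.map_replicate, Machine.init]
    congr 1
    rw [List.range_succ_eq_map, List.map_cons, List.map_map]
    congr 1
    exact (List.eq_replicate_iff.2 ⟨by simp, by simp [sourceDigit]⟩).symm
  rw [hsv, ← e2] at hs
  have h2 := reaches_of_sweep (x := x) (c := .source true) (p := 0) (p' := 0)
    (o := [] ++ encodeBinary (2 * X)) nofun rfl
    hs (by simp [HeadMove.apply]) rfl hle hle
  have ht := U.sweep_target .stay (U.ofNumber (L' + 1) 0)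
  have htv : (⟨(U.ofNumber (L' + 1) 0).cells.map fun _ => 0,
      (U.ofNumber (L' + 1) 0).state.map fun _ => U.encKind .target,
      (U.ofNumber (L' + 1) 0).pos.map fun _ => 0, (U.ofNumber (L' + 1) 0).time.map fun _ => 0⟩ :
      U.Vertex) = U.kindVertex (L' + 1) .target 0 := by
    simp only [kindVertex, ofNumber, ofNat_zero, Nat.zero_div, List.map_replicate]
  rw [htv, ← e3] at ht
  have h3 := reaches_of_sweep (x := x) (c := .target) (p := 0) (p' := 0)
    (o := [] ++ encodeBinary (2 * X) ++
    encodeBinary (U.number (L' + 1) (U.configVertex (L' + 1) U.M.init 0))) nofun rfl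
    ht (by simp [HeadMove.apply]) rfl hle hle
  have h4 := reaches_balls (U := U) (x := x) (L := L' + 1) .stay ([] ++ encodeBinary (2 * X) ++
    encodeBinary (U.number (L' + 1) (U.configVertex (L' + 1) U.M.init 0)) ++
    encodeBinary (U.number (L' + 1) (U.kindVertex (L' + 1) .target 0)))
    ((2 ^ U.K) ^ (L' + 1) - 1) (Q := (U.ofNumber (L' + 1) 0).time)
    (U.hasLength_ofNumber _ _).time
    (by simp only [ofNumber, ofNat_zero, Nat.zero_div, value_replicate_zero]; omega)
  rw [Nat.sub_add_cancel hT, ← encodeBinary_two_pow] at h4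
  exact h1.trans (h2.trans (h3.trans h4))

/-- The output of the sweeping machine. -/
noncomputable def instanceCode (U : Coding) (x : List Bool) (L : ℕ) : List Bool :=
  U.header L ++ (List.range (2 * ((2 ^ U.K) ^ L) ^ 4)).flatMap (U.edges x L)

theorem length_pos {L : ℕ} (hL : L = (U.m + 1) * (count U.K (x.length + 1)).length) : 0 < L := by
  rw [hL]
  refine Nat.mul_pos (Nat.succ_pos _) (List.length_pos_iff.2 fun h => ?_)
  have := lt_pow_length_count U.K_pos (x.length + 1)
  rw [h] at this
  simp at this

theorem reaches_done {L : ℕ} (hL : L = (U.m + 1) * (count U.K (x.length + 1)).length) :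
    ∃ c : U.sweeper.Conf, c.mem ∈ U.sweeper.halting ∧ c.out = U.instanceCode x L ∧
      U.sweeper.Reaches x (4 * L) ⟨U.sweeper.start, 0, [], []⟩ c := by
  have hpos := length_pos hL
  have hle := (U.hasLength_ofNumber L 0).length_tape.le
  have hX : 0 < ((2 ^ U.K) ^ L) ^ 4 := by positivity
  set X := ((2 ^ U.K) ^ L) ^ 4 with hXd
  have hp0 : min (value (U.ofNumber L 0).pos) (x.length + 1) = 0 := by
    simp only [ofNumber, ofNat_zero, Nat.zero_div, value_replicate_zero]
    simp
  obtain ⟨mv5, p5, hp5, h5⟩ := reaches_vertices (x := x) hpos false (X - 1) 0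
    (U.emptyInfo .leftEnd) .stay (U.header L) (by omega)
  have h6 := reaches_rewind (x := x) (.vertices true) mv5
    (U.header L ++ (List.range' 0 (X - 1 + 1)).flatMap (U.edges x L)) hp5 hle
  obtain ⟨mv7, p7, hp7, h7⟩ := reaches_vertices (x := x) hpos true (X - 1) 0
    (U.emptyInfo .leftEnd) .stay
    (U.header L ++ (List.range' 0 (X - 1 + 1)).flatMap (U.edges x L)) (by omega)
  rw [hp0] at h5 h7
  have h := (reaches_size hL).trans ((reaches_header hpos).trans (h5.trans (h6.trans h7)))
  refine ⟨_, ?_, ?_, h⟩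
  · exact (if_pos rfl : (if true = true then (.done : U.Ctl) else .rewind (.vertices true)) = .done)
  · dsimp only
    rw [instanceCode, Nat.sub_add_cancel hX, ← List.range_eq_range', List.append_assoc, ← hXd]
    congr 1
    -- The second pass accounts for the numbers from `X` on, which differ from those of the first
    -- pass by the leading bit.
    rw [two_mul, List.range_add, List.flatMap_append, List.flatMap_map]
    congr 1
    refine congrArg List.flatten (List.map_congr_left fun v _ => ?_)
    rw [edges, edges, add_comm X, ofNumber_add]

end Reaches

end Coding

namespace Coding

open Digit Vertex

variable (U : Coding)

/-! ### The information about a vertex -/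

/-- The contents of the cells under the heads. -/
noncomputable def reads (C : List (Digit U.K)) : U.M.Tape → U.M.Symbol :=
  C.foldl (fun r d i => if (U.decCell d i).2 then (U.decCell d i).1 else r i) fun _ => U.M.blank

variable {U} in
/-- The kind of a vertex. -/
noncomputable def Vertex.kind (V : U.Vertex) : Kind U.M.State :=
  U.decKind (V.state.getLast?.getD 0)

theorem info_eq (a : InputSymbol) (V : U.Vertex) :
    U.info a V = ⟨V.state.getLast?.getD 0, U.reads V.cells,
      decide (value V.time + 1 = (2 ^ U.K) ^ V.time.length), a⟩ := by
  have hcell : ∀ (C : List (Digit U.K)) (I : U.Info), (label .cell C).foldl U.collect I =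
      ⟨I.kind, C.foldl (fun r d i => if (U.decCell d i).2 then (U.decCell d i).1 else r i) I.read,
        I.last, I.input⟩ := by
    intro C
    induction C with
    | nil => intro I; rfl
    | cons d C ih => intro I; exact ih _
  -- Each digit of the state section overwrites the kind, so the last one counts. A section has `L`
  -- digits only for uniformity; one digit suffices for the kind.
  have hstate : ∀ (S : List (Digit U.K)) (I : U.Info), (label .state S).foldl U.collect I =
      ⟨S.getLast?.getD I.kind, I.read, I.last, I.input⟩ := by
    intro S
    induction S with
    | nil => intro I; rfl
    | cons d S ih =>
      intro I
      refine (ih _).trans ?_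
      cases S with
      | nil => rfl
      | cons d' S => rw [List.getLast?_cons_cons, List.getLast?_cons]; rfl
  have hpos : ∀ (P : List (Digit U.K)) (I : U.Info), (label .pos P).foldl U.collect I = I := by
    intro P
    induction P with
    | nil => intro I; rfl
    | cons d P ih => intro I; exact ih _
  have htime : ∀ (Q : List (Digit U.K)) (I : U.Info), (label .time Q).foldl U.collect I =
      ⟨I.kind, I.read, I.last && decide (∀ d ∈ Q, (d : ℕ) + 1 = 2 ^ U.K), I.input⟩ := by
    intro Q
    induction Q with
    | nil => intro I; simp [label]
    | cons d Q ih =>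
      intro I
      refine (ih _).trans ?_
      simp [collect, Bool.and_assoc]
  rw [info, tape, List.foldl_append, List.foldl_append, List.foldl_append, hcell, hstate, hpos,
    htime]
  simp only [emptyInfo, Bool.true_and, forall_eq_max_iff]
  rfl

/-! ### Successors -/

theorem applyPlan_go_keep (p : U.Plan) (h : p.cell = .keep) (q : Option (Digit U.K))
    (C : List (Digit U.K)) : applyPlan.go U p q C = C := by
  induction C generalizing q with
  | nil => rfl
  | cons d C ih => rw [applyPlan.go, ih, h]; rfl

theorem applyPlan_go_zero (p : U.Plan) (h : p.cell = .zero) (q : Option (Digit U.K))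
    (C : List (Digit U.K)) : applyPlan.go U p q C = List.replicate C.length 0 := by
  induction C generalizing q with
  | nil => rfl
  | cons d C ih => rw [applyPlan.go, ih, h]; rfl

theorem carryMap_posDigit_keep (c : Bool) (P : List (Digit U.K)) :
    carryMap (U.posDigit .keep) c P = (P, c) := by
  induction P generalizing c with
  | nil => rfl
  | cons d P ih => rw [carryMap, posDigit, ih]

theorem carryMap_posDigit_zero (c : Bool) (P : List (Digit U.K)) :
    (carryMap (U.posDigit .zero) c P).1 = List.replicate P.length 0 := by
  induction P generalizing c with
  | nil => rfl
  | cons d P ih => rw [carryMap]; exact congrArg _ (ih _)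

variable {U} {x : List Bool} {b : Bool} {V : U.Vertex} {L : ℕ}

theorem Vertex.kind_of_state {k : Kind U.M.State} {n : ℕ} (hn : 0 < n)
    (h : V.state = List.replicate n (U.encKind k)) : V.kind = k := by
  obtain ⟨n, rfl⟩ : ∃ m, n = m + 1 := ⟨n - 1, by omega⟩
  rw [kind, h, List.getLast?_replicate]
  simp

theorem kind_configVertex (hL : 0 < L) (γ : U.M.Config) (τ : ℕ) :
    (U.configVertex L γ τ).kind = .sim γ.state := kind_of_state hL rfl

theorem kind_kindVertex (hL : 0 < L) (k : Kind U.M.State) (τ : ℕ) :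
    (U.kindVertex L k τ).kind = k := kind_of_state hL rfl

theorem hasLength_succ (x : List Bool) (b : Bool) (h : V.HasLength L) :
    (U.succ x b V).HasLength L := U.hasLength_applyPlan _ h

theorem succ_of_sink (h : V.kind = .target ∨ V.kind = .dump) : U.succ x b V = V := by
  have hp : U.plan (U.info (inputSymbolAt x (value V.pos)) V) b = ⟨.keep, none, .keep, false⟩ := by
    rw [info_eq, plan]
    rw [kind] at h
    rcases h with h | h <;> simp only [h]
  rw [succ, hp, applyPlan, applyPlan_go_keep _ _ rfl, carryMap_posDigit_keep, carryMap_inc_false]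
  simp

theorem map_const_eq_replicate {α β : Type} {l : List α} {n : ℕ} (h : l.length = n) (c : β) :
    (l.map fun _ => c) = List.replicate n c := by
  rw [List.map_const', h]

theorem succ_of_chain (hV : V.HasLength L) (h : V.kind = .chain) :
    U.succ x b V = ⟨V.cells, List.replicate L (U.encKind
      (U.chainKind (decide (value V.time + 1 = (2 ^ U.K) ^ L)) b)), V.pos,
      (carryMap inc true V.time).1⟩ := by
  have hp : U.plan (U.info (inputSymbolAt x (value V.pos)) V) b = ⟨.keep, some (U.encKind
      (U.chainKind (decide (value V.time + 1 = (2 ^ U.K) ^ L)) b)), .keep, true⟩ := by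
    rw [info_eq, plan]
    rw [kind] at h
    simp only [h, hV.time]
  rw [succ, hp, applyPlan, applyPlan_go_keep _ _ rfl, carryMap_posDigit_keep]
  simp only [Option.getD_some, map_const_eq_replicate hV.state]

-- Cells and position are erased in order that all accepting branches end in one and the same vertex
-- of the counter; the overflow resets the time.
open Classical in
theorem succ_of_sim_last (hV : V.HasLength L) {q : U.M.State} (h : V.kind = .sim q)
    (ht : value V.time + 1 = (2 ^ U.K) ^ L) :
    U.succ x b V = U.kindVertex L (if (U.idleAction q (inputSymbolAt x (value V.pos))
      (U.reads V.cells) b).next ∈ U.accept then .chain else .dump) 0 := by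
  have hp : U.plan (U.info (inputSymbolAt x (value V.pos)) V) b = ⟨.zero, some (U.encKind
      (if (U.idleAction q (inputSymbolAt x (value V.pos))
      (U.reads V.cells) b).next ∈ U.accept then .chain else .dump)), .zero, true⟩ := by
    rw [info_eq, plan]
    rw [kind] at h
    simp only [h, hV.time, ht, decide_true, if_true]
  rw [succ, hp, applyPlan, applyPlan_go_zero _ _ rfl, carryMap_posDigit_zero,
    value_carryMap_inc_of_eq (by rw [hV.time, ht]), hV.cells, hV.pos, hV.time, kindVertex, ofNat_zero]
  simp only [Option.getD_some, map_const_eq_replicate hV.state]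

theorem succ_of_sim (hV : V.HasLength L) {q : U.M.State} (h : V.kind = .sim q)
    (ht : value V.time + 1 < (2 ^ U.K) ^ L) {a : MachineAction U.M.Tape U.M.State U.M.Symbol}
    (ha : U.idleAction q (inputSymbolAt x (value V.pos)) (U.reads V.cells) b = a) :
    U.succ x b V = ⟨applyPlan.go U ⟨.step a.write a.move, none, .keep, false⟩ none V.cells,
      List.replicate L (U.encKind (.sim a.next)),
      (carryMap (U.posDigit (posMode a.inputMove (inputSymbolAt x (value V.pos)))) true V.pos).1,
      (carryMap inc true V.time).1⟩ := by
  have hp : U.plan (U.info (inputSymbolAt x (value V.pos)) V) b = ⟨.step a.write a.move,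
      some (U.encKind (.sim a.next)),
      posMode a.inputMove (inputSymbolAt x (value V.pos)), true⟩ := by
    rw [info_eq, plan]
    rw [kind] at h
    simp only [h, hV.time, ht.ne, decide_false, Bool.false_eq_true, if_false, ha]
  -- `applyPlan.go` depends only on the mode for the cells, so the other fields of the plan in the
  -- statement are mere fillers.
  have hgo : ∀ (p p' : U.Plan) (q : Option (Digit U.K)) (C : List (Digit U.K)), p.cell = p'.cell →
      applyPlan.go U p q C = applyPlan.go U p' q C := by
    intro p p' q C hpp
    induction C generalizing q with
    | nil => rfl
    | cons d C ih => rw [applyPlan.go, applyPlan.go, ih, hpp]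
  rw [succ, hp, applyPlan]
  simp only [Option.getD_some, map_const_eq_replicate hV.state]
  congr 1
  exact hgo _ _ _ _ rfl

/-! ### Successors of configurations -/

/-- The contents of the cell `j` on all tapes, with the head marks. -/
def configCell (γ : U.M.Config) (j : ℕ) : U.M.Tape → U.M.Symbol × Bool :=
  fun i => (γ.cell i j, decide (γ.head i = j))

/-- Each tape has exactly one marked cell among the first `L`. For the induction, a scan of `k`
cells has found the head precisely if it is below `k`. -/
theorem reads_configVertex {γ : U.M.Config} (hγ : ∀ i, γ.head i < L) (τ : ℕ) :
    U.reads (U.configVertex L γ τ).cells = fun i => γ.cell i (γ.head i) := by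
  have h : ∀ k, U.reads ((List.range k).map fun j => U.encCell (configCell γ j)) =
      fun i => if γ.head i < k then γ.cell i (γ.head i) else U.M.blank := by
    intro k
    induction k with
    | zero => rfl
    | succ k ih =>
      rw [List.range_succ, List.map_append, reads, List.foldl_append]
      rw [reads] at ih
      rw [ih]
      funext i
      simp only [List.map_cons, List.map_nil, List.foldl_cons, List.foldl_nil, decCell_encCell,
        configCell, decide_eq_true_eq]
      rcases lt_trichotomy (γ.head i) k with h | h | h
      · rw [if_neg h.ne, if_pos h, if_pos (by omega)]
      · rw [if_pos h, if_pos (by omega), h]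
      · rw [if_neg h.ne', if_neg (by omega), if_neg (by omega)]
  refine (h L).trans ?_
  funext i
  rw [if_pos (hγ i)]

/-- `idleAction` covers halted configurations by an action without effect, so that all computations
can be prolonged to the common length; `hp` ensures that the clamping does not move an idle input
head. -/
theorem step_eq (x : List Bool) (γ : U.M.Config) (b : Bool)
    {a : MachineAction U.M.Tape U.M.State U.M.Symbol}
    (ha : U.idleAction γ.state (inputSymbolAt x γ.inputHead) (fun i => γ.cell i (γ.head i)) b = a)
    (hp : γ.inputHead ≤ x.length + 1) :
    (U.M.step x γ b).state = a.next ∧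
      (U.M.step x γ b).inputHead = min (a.inputMove.apply γ.inputHead) (x.length + 1) ∧
      (U.M.step x γ b).head = (fun i => (a.move i).apply (γ.head i)) ∧
      (U.M.step x γ b).cell = fun i => Function.update (γ.cell i) (γ.head i) (a.write i) := by
  rw [idleAction] at ha
  rw [Machine.step]
  split_ifs at ha ⊢ with h
  · subst ha
    refine ⟨rfl, (min_eq_left hp).symm, rfl, ?_⟩
    funext i
    exact (Function.update_eq_self _ _).symm
  · subst ha
    exact ⟨rfl, rfl, rfl, rfl⟩

/-- A head can reach cell `j` only from `j` or from a neighbour, so the marks on three cells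
suffice. In cell `0` a movement to the left has no effect, which the missing left neighbour signals;
the missing right neighbour of cell `L - 1` is harmless, as no head is at `L`. -/
theorem cellStep_configCell {γ γ' : U.M.Config} {w : U.M.Tape → U.M.Symbol}
    {mv : U.M.Tape → HeadMove} (hh : γ'.head = fun i => (mv i).apply (γ.head i))
    (hc : γ'.cell = fun i => Function.update (γ.cell i) (γ.head i) (w i))
    (hγ : ∀ i, γ.head i < L) {j : ℕ} (hj : j < L) :
    U.cellStep w mv (if j = 0 then none else some (configCell γ (j - 1))) (configCell γ j)
      (if j + 1 < L then some (configCell γ (j + 1)) else none) = configCell γ' j := by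
  funext i
  have h1 : (if γ.head i = j then w i else γ.cell i j) = γ'.cell i j := by
    rw [hc]
    dsimp only
    rcases eq_or_ne (γ.head i) j with h | h
    · rw [if_pos h, ← h, Function.update_self]
    · rw [if_neg h, Function.update_of_ne h.symm]
  have hi := hγ i
  have h2 : (((if j + 1 < L then some (configCell γ (j + 1)) else none).map
      fun a => (a i).2).getD false) = decide (γ.head i = j + 1) := by
    split_ifs with h
    · rfl
    · symm
      simp
      omega
  have h3 : (((if j = 0 then none else some (configCell γ (j - 1))).map
      fun a => (a i).2).getD false) = decide (γ.head i + 1 = j) := by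
    split_ifs with h
    · symm
      simp [h]
    · simp only [configCell, Option.map_some, Option.getD_some, decide_eq_decide]
      omega
  have h4 : ((if j = 0 then none else some (configCell γ (j - 1))).map
      fun a => (a i).2).isNone = decide (j = 0) := by
    split_ifs with h <;> simp [h]
  have h5 : marked (mv i) ((if j = 0 then none else some (configCell γ (j - 1))).map
      fun a => (a i).2) (decide (γ.head i = j)) (decide (γ.head i = j + 1)) =
      decide ((mv i).apply (γ.head i) = j) := by
    cases mv i
    · rw [marked, h4, Bool.eq_iff_iff]
      simp only [Bool.or_eq_true, Bool.and_eq_true, decide_eq_true_eq]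
      simp only [HeadMove.apply]
      omega
    · rfl
    · rw [marked, h3, Bool.eq_iff_iff]
      simp only [decide_eq_true_eq]
      rfl
  rw [cellStep, h2]
  refine Prod.ext ?_ ?_
  · simpa [configCell] using h1
  · refine h5.trans ?_
    rw [configCell, hh]

theorem go_configVertex {γ γ' : U.M.Config} {w : U.M.Tape → U.M.Symbol}
    {mv : U.M.Tape → HeadMove} (hh : γ'.head = fun i => (mv i).apply (γ.head i))
    (hc : γ'.cell = fun i => Function.update (γ.cell i) (γ.head i) (w i))
    (hγ : ∀ i, γ.head i < L) (τ τ' : ℕ) :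
    applyPlan.go U ⟨.step w mv, none, .keep, false⟩ none (U.configVertex L γ τ).cells =
      (U.configVertex L γ' τ').cells := by
  -- Generalized to the part of the section from cell `j` on, with the digit before it as the left
  -- neighbour.
  have h : ∀ k j, j + k = L → applyPlan.go U ⟨.step w mv, none, .keep, false⟩
      (if j = 0 then none else some (U.encCell (configCell γ (j - 1))))
      ((List.range' j k).map fun j => U.encCell (configCell γ j)) =
      (List.range' j k).map fun j => U.encCell (configCell γ' j) := by
    intro k
    induction k with
    | zero => intro j _; rfl
    | succ k ih =>
      intro j hj
      have h1 := ih (j + 1) (by omega)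
      rw [if_neg (Nat.succ_ne_zero j), Nat.add_sub_cancel] at h1
      rw [List.range'_succ, List.map_cons, List.map_cons, applyPlan.go, h1,
        ← cellStep_configCell hh hc hγ (by omega : j < L)]
      congr 1
      have h2 : ((List.range' (j + 1) k).map fun j => U.encCell (configCell γ j)).head?.map
          U.decCell = if j + 1 < L then some (configCell γ (j + 1)) else none := by
        rcases k with _ | k
        · rw [if_neg (by omega)]
          rfl
        · rw [if_pos (by omega), List.range'_succ]
          simp
      have h3 : (if j = 0 then none else some (U.encCell (configCell γ (j - 1)))).map U.decCell =
          if j = 0 then none else some (configCell γ (j - 1)) := by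
        split_ifs <;> simp
      rw [cellDigit, h2, h3, decCell_encCell]
  have := h L 0 (zero_add L)
  rwa [← List.range_eq_range'] at this

/-- The end markers reveal when a movement is blocked, and `posMode` then keeps the position. In the
other cases `hx` excludes an overflow. -/
theorem pos_configVertex {p : ℕ} (hp : p ≤ x.length + 1) (hx : x.length + 1 < (2 ^ U.K) ^ L)
    (mv : HeadMove) :
    (carryMap (U.posDigit (posMode mv (inputSymbolAt x p))) true (ofNat U.K L p)).1 =
      ofNat U.K L (min (mv.apply p) (x.length + 1)) := by
  have hv : value (ofNat U.K L p) = p := by rw [value_ofNat, Nat.mod_eq_of_lt (by omega)]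
  have hkeep : ∀ p', min p' (x.length + 1) = p →
      (carryMap (U.posDigit .keep) true (ofNat U.K L p)).1 =
        ofNat U.K L (min p' (x.length + 1)) := by
    intro p' h
    rw [carryMap_posDigit_keep, h]
  cases mv
  · rcases p with _ | p
    · exact hkeep _ (by simp [HeadMove.apply])
    · have hm : posMode .left (inputSymbolAt x (p + 1)) = .dec := by
        rw [inputSymbolAt]
        split_ifs <;> rfl
      rw [hm]
      refine value_inj (by simp) ?_
      refine (value_carryMap_dec_of_pos (by omega)).trans ?_
      rw [hv, value_ofNat, HeadMove.apply, Nat.mod_eq_of_lt (by omega)]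
      omega
  · exact hkeep _ (by simpa [HeadMove.apply] using hp)
  · rcases eq_or_lt_of_le hp with h | h
    · have hm : posMode .right (inputSymbolAt x p) = .keep := by
        rw [h, inputSymbolAt, dif_neg (by omega)]
        rfl
      rw [hm]
      exact hkeep _ (by simp [HeadMove.apply, h])
    · have hm : posMode .right (inputSymbolAt x p) = .inc := by
        rcases p with _ | p
        · rfl
        · rw [inputSymbolAt, dif_pos (by omega)]
          rfl
      rw [hm]
      refine value_inj (by simp) ?_
      refine (value_carryMap_inc_of_lt (by rw [hv, length_ofNat]; omega)).trans ?_
      rw [hv, value_ofNat, HeadMove.apply, Nat.mod_eq_of_lt (by omega)]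
      omega

theorem carryMap_inc_ofNat {K n τ : ℕ} (h : τ + 1 < (2 ^ K) ^ n) :
    (carryMap inc true (ofNat K n τ)).1 = ofNat K n (τ + 1) := by
  have hv : value (ofNat K n τ) = τ := by rw [value_ofNat, Nat.mod_eq_of_lt (by omega)]
  refine value_inj (by simp) ?_
  rw [value_carryMap_inc_of_lt (by rw [hv, length_ofNat]; exact h), hv, value_ofNat,
    Nat.mod_eq_of_lt h]

theorem value_time_configVertex {γ : U.M.Config} {τ : ℕ} (h : τ < (2 ^ U.K) ^ L) :
    value (U.configVertex L γ τ).time = τ := by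
  rw [configVertex, value_ofNat, Nat.mod_eq_of_lt h]

theorem value_time_kindVertex {k : Kind U.M.State} {τ : ℕ} (h : τ < (2 ^ U.K) ^ L) :
    value (U.kindVertex L k τ).time = τ := by
  rw [kindVertex, value_ofNat, Nat.mod_eq_of_lt h]

variable {γ : U.M.Config} {τ : ℕ}

theorem idleAction_configVertex (hγ : ∀ i, γ.head i < L) (hp : γ.inputHead ≤ x.length + 1)
    (hx : x.length + 1 < (2 ^ U.K) ^ L) :
    U.idleAction γ.state (inputSymbolAt x (value (U.configVertex L γ τ).pos))
      (U.reads (U.configVertex L γ τ).cells) b =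
    U.idleAction γ.state (inputSymbolAt x γ.inputHead) (fun i => γ.cell i (γ.head i)) b := by
  rw [reads_configVertex hγ, show (U.configVertex L γ τ).pos = ofNat U.K L γ.inputHead from rfl,
    value_ofNat, Nat.mod_eq_of_lt (by omega)]

theorem succ_configVertex (hL : 0 < L) (hγ : ∀ i, γ.head i < L)
    (hp : γ.inputHead ≤ x.length + 1) (hx : x.length + 1 < (2 ^ U.K) ^ L)
    (hτ : τ + 1 < (2 ^ U.K) ^ L) :
    U.succ x b (U.configVertex L γ τ) = U.configVertex L (U.M.step x γ b) (τ + 1) := by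
  obtain ⟨h1, h2, h3, h4⟩ := step_eq x γ b rfl hp
  rw [succ_of_sim (U.hasLength_configVertex L γ τ) (kind_configVertex hL γ τ)
    (by rwa [value_time_configVertex (by omega)]) (idleAction_configVertex hγ hp hx),
    go_configVertex h3 h4 hγ τ (τ + 1)]
  have hv : value (U.configVertex L γ τ).pos = γ.inputHead := by
    rw [configVertex, value_ofNat, Nat.mod_eq_of_lt (by omega)]
  ext1
  · rfl
  · simp only [configVertex, h1]
  · simp only [configVertex, h2]
    rw [configVertex] at hv
    rw [hv, pos_configVertex hp hx]
  · exact carryMap_inc_ofNat hτ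

open Classical in
theorem succ_configVertex_last (hL : 0 < L) (hγ : ∀ i, γ.head i < L)
    (hp : γ.inputHead ≤ x.length + 1) (hx : x.length + 1 < (2 ^ U.K) ^ L)
    (hτ : τ + 1 = (2 ^ U.K) ^ L) :
    U.succ x b (U.configVertex L γ τ) =
      U.kindVertex L (if (U.M.step x γ b).state ∈ U.accept then .chain else .dump) 0 := by
  rw [(step_eq x γ b rfl hp).1, succ_of_sim_last (U.hasLength_configVertex L γ τ)
    (kind_configVertex hL γ τ) (by rwa [value_time_configVertex (by omega)]),
    idleAction_configVertex hγ hp hx]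

theorem succ_chainVertex (hL : 0 < L) (hτ : τ + 1 < (2 ^ U.K) ^ L) :
    U.succ x b (U.kindVertex L .chain τ) =
      U.kindVertex L (if b then .dump else .chain) (τ + 1) := by
  rw [succ_of_chain (U.hasLength_kindVertex L _ _) (kind_kindVertex hL _ _),
    value_time_kindVertex (by omega), decide_eq_false hτ.ne]
  ext1
  · rfl
  · simp [kindVertex, chainKind]
  · rfl
  · exact carryMap_inc_ofNat hτ

theorem succ_chainVertex_last (hL : 0 < L) (hτ : τ + 1 = (2 ^ U.K) ^ L) :
    U.succ x b (U.kindVertex L .chain τ) =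
      U.kindVertex L (if b then .target else .dump) 0 := by
  rw [succ_of_chain (U.hasLength_kindVertex L _ _) (kind_kindVertex hL _ _),
    value_time_kindVertex (by omega), decide_eq_true hτ]
  ext1
  · rfl
  · simp [kindVertex, chainKind]
  · rfl
  · dsimp only
    rw [value_carryMap_inc_of_eq]
    · simp [kindVertex, ofNat_zero]
    · rw [value_time_kindVertex (by omega), hτ]
      simp [kindVertex]

end Coding

/-! ### Walks, and the even distribution of balls over them -/

namespace SwitchGraph

open Finset

section Edges

variable {V : Type} (G : SwitchGraph V) (s : V)

/-- The successor of a vertex along one of its two edges. -/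
def edge (b : Bool) (v : V) : V := if b then G.s₁ v else G.s₀ v

/-- The vertex reached along the given edges. -/
def walk (cs : List Bool) : V := cs.foldl (fun v b => G.edge b v) s

theorem edge_of_isLeaf {v : V} (h : G.IsLeaf v) (b : Bool) : G.edge b v = v := by
  cases b
  exacts [h.1, h.2]

end Edges

variable {V : Type} [DecidableEq V] (G : SwitchGraph V) (s : V)

/-- The number of walks of length `n` from `s` to `w`. -/
def paths (n : ℕ) (w : V) : ℕ :=
  ∑ ω : Fin n → Bool, if G.walk s (List.ofFn ω) = w then 1 else 0

theorem paths_zero (w : V) : G.paths s 0 w = if s = w then 1 else 0 := by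
  simp [paths, walk]

variable [Fintype V]

theorem exists_of_inflow_pos {c : V → ℕ} {w : V} (h : 0 < G.inflow c w) :
    ∃ u b, ¬ G.IsLeaf u ∧ G.edge b u = w ∧ 0 < c u := by
  obtain ⟨u, hu, hne⟩ := exists_ne_zero_of_sum_ne_zero h.ne'
  have hu' : ¬ G.IsLeaf u := by simpa using hu
  by_cases h0 : G.s₀ u = w
  · refine ⟨u, false, hu', h0, Nat.pos_of_ne_zero fun hc => hne ?_⟩
    simp [hc]
  · by_cases h1 : G.s₁ u = w
    · refine ⟨u, true, hu', h1, Nat.pos_of_ne_zero fun hc => hne ?_⟩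
      simp [hc]
    · exact absurd (by simp [h0, h1]) hne

/-- The number of balls that arrive along the only edge that is used. -/
theorem inflow_eq_of_unique {c : V → ℕ} {w u₀ : V} {b₀ : Bool}
    (h : ∀ u b, ¬ G.IsLeaf u → G.edge b u = w → 0 < c u → u = u₀ ∧ b = b₀)
    (hu : ¬ G.IsLeaf u₀) (hw : G.edge b₀ u₀ = w) :
    G.inflow c w = if b₀ then c u₀ / 2 else (c u₀ + 1) / 2 := by
  have h0 : ∀ u ∈ ({u | ¬ G.IsLeaf u} : Finset V), u ≠ u₀ →
      ((if G.s₀ u = w then (c u + 1) / 2 else 0) + if G.s₁ u = w then c u / 2 else 0) = 0 := by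
    intro u hu hne
    have hu' : ¬ G.IsLeaf u := by simpa using hu
    rcases Nat.eq_zero_or_pos (c u) with hc | hc
    · simp [hc]
    · rw [if_neg (show ¬ G.s₀ u = w from fun h' => hne (h u false hu' h' hc).1),
        if_neg (show ¬ G.s₁ u = w from fun h' => hne (h u true hu' h' hc).1)]
  rw [inflow, sum_eq_single_of_mem u₀ (by simpa using hu) h0]
  rcases Nat.eq_zero_or_pos (c u₀) with hc | hc
  · cases b₀ <;> simp [hc]
  · cases b₀
    · rw [if_pos (show G.s₀ u₀ = w from hw),
        if_neg (show ¬ G.s₁ u₀ = w from fun h' => absurd (h u₀ true hu h' hc).2 (by decide))]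
      simp
    · rw [if_neg (show ¬ G.s₀ u₀ = w from fun h' => absurd (h u₀ false hu h' hc).2 (by decide)),
        if_pos (show G.s₁ u₀ = w from hw)]
      simp

/-- A walk of length `n + 1` is a walk of length `n` followed by one of the two edges; parallel
edges count twice. -/
theorem paths_succ (n : ℕ) (w : V) : G.paths s (n + 1) w =
    ∑ u, ((if G.s₀ u = w then G.paths s n u else 0) +
      if G.s₁ u = w then G.paths s n u else 0) := by
  have h1 : G.paths s (n + 1) w = ∑ ω : Fin n → Bool,
      ((if G.s₀ (G.walk s (List.ofFn ω)) = w then 1 else 0) +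
        if G.s₁ (G.walk s (List.ofFn ω)) = w then 1 else 0) := by
    rw [paths, ← (Fin.snocEquiv fun _ : Fin (n + 1) => Bool).sum_comp, Fintype.sum_prod_type_right]
    refine sum_congr rfl fun ω _ => ?_
    have hw : ∀ b, G.walk s (List.ofFn (Fin.snocEquiv (fun _ : Fin (n + 1) => Bool) (b, ω))) =
        G.edge b (G.walk s (List.ofFn ω)) := by
      intro b
      rw [List.ofFn_succ']
      simp [walk, Fin.snocEquiv]
    simp only [Fintype.sum_bool, hw]
    simp [edge, add_comm]
  rw [h1]
  have h2 : ∀ f : V → V, (∑ ω : Fin n → Bool,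
      if f (G.walk s (List.ofFn ω)) = w then 1 else 0) =
      ∑ u, if f u = w then G.paths s n u else 0 := by
    intro f
    have : ∀ u, (if f u = w then G.paths s n u else 0) =
        ∑ ω : Fin n → Bool, if G.walk s (List.ofFn ω) = u then if f u = w then 1 else 0 else 0 := by
      intro u
      split_ifs <;> simp [paths]
    rw [sum_congr rfl fun u _ => this u, sum_comm]
    simp
  rw [sum_add_distrib, sum_add_distrib, h2, h2]

/-- In a layered part of the graph, the balls are distributed evenly over all walks. -/
theorem flow_eq_paths {c : V → ℕ} {T : ℕ} {r : V → ℕ}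
    (hc : ∀ w, c w = (if s = w then 2 ^ T else 0) + G.inflow c w)
    (hr : ∀ u b, ¬ G.IsLeaf u → r (G.edge b u) ≤ T → r (G.edge b u) = r u + 1)
    (hl : ∀ u, G.IsLeaf u → T < r u) (hs : r s = 0) (n : ℕ) {w : V} (hn : n ≤ T) (hw : r w = n) :
    c w = 2 ^ (T - n) * G.paths s n w := by
  induction n generalizing w with
  | zero =>
    have h0 : G.inflow c w = 0 := by
      by_contra h
      obtain ⟨u, b, hu, hb, -⟩ := G.exists_of_inflow_pos (Nat.pos_of_ne_zero h)
      have := hr u b hu (by rw [hb]; omega)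
      rw [hb] at this
      omega
    rw [hc, h0, paths_zero]
    split_ifs <;> simp
  | succ n ih =>
    -- A predecessor of `w` lies in layer `n < T`, so it is visited an even number of times and both
    -- roundings give exactly half. It is no leaf, since it would be `w` itself, whose layer is at
    -- most `T`.
    have h1 : ∀ u b, G.edge b u = w → ¬ G.IsLeaf u ∧ c u = 2 * (2 ^ (T - (n + 1)) * G.paths s n u) := by
      intro u b hb
      have hu : ¬ G.IsLeaf u := by
        intro hu
        have := hl u hu
        rw [G.edge_of_isLeaf hu] at hb
        subst hb
        omega
      have := hr u b hu (by rw [hb]; omega)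
      rw [hb] at this
      refine ⟨hu, ?_⟩
      rw [ih (by omega) (by omega : r u = n), ← mul_assoc, ← pow_succ']
      congr 2
      omega
    have h2 : G.inflow c w = ∑ u,
        ((if G.s₀ u = w then 2 ^ (T - (n + 1)) * G.paths s n u else 0) +
          if G.s₁ u = w then 2 ^ (T - (n + 1)) * G.paths s n u else 0) := by
      rw [inflow, sum_filter]
      refine sum_congr rfl fun u _ => ?_
      have e0 : G.s₀ u = w →
          ¬ G.IsLeaf u ∧ c u = 2 * (2 ^ (T - (n + 1)) * G.paths s n u) := h1 u false
      have e1 : G.s₁ u = w →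
          ¬ G.IsLeaf u ∧ c u = 2 * (2 ^ (T - (n + 1)) * G.paths s n u) := h1 u true
      by_cases hu : G.IsLeaf u
      · rw [if_neg (not_not.2 hu), if_neg fun h => (e0 h).1 hu, if_neg fun h => (e1 h).1 hu, add_zero]
      · rw [if_pos hu]
        congr 1
        · split_ifs with h
          · have := (e0 h).2
            omega
          · rfl
        · split_ifs with h
          · have := (e1 h).2
            omega
          · rfl
    have hsw : s ≠ w := by
      rintro rfl
      omega
    rw [hc, if_neg hsw, zero_add, h2, paths_succ, mul_sum]
    refine sum_congr rfl fun u _ => ?_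
    split_ifs <;> simp [mul_add]

end SwitchGraph

/-! ### The switch graph of the instance and its layers -/

namespace Coding

open Digit Vertex SwitchGraph

variable {U : Coding} {x : List Bool} {L : ℕ}

theorem Vertex.HasLength.number_lt {V : U.Vertex} (h : V.HasLength L) :
    U.number L V < 2 * ((2 ^ U.K) ^ L) ^ 4 := by
  have := h.value_digits_lt
  rw [number]
  omega

/-- The element of the vertex set of the instance that represents a vertex. -/
def Vertex.HasLength.toFin {V : U.Vertex} (h : V.HasLength L) :
    Fin (2 * ((2 ^ U.K) ^ L) ^ 4) := ⟨U.number L V, h.number_lt⟩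

@[simp] theorem ofNumber_toFin {V : U.Vertex} (h : V.HasLength L) :
    U.ofNumber L h.toFin = V := h.ofNumber_number

theorem toFin_inj {V W : U.Vertex} {h : V.HasLength L} {h' : W.HasLength L} :
    h.toFin = h'.toFin ↔ V = W := by
  constructor
  · intro e
    rw [← ofNumber_toFin h, e, ofNumber_toFin]
  · rintro rfl
    rfl

theorem toFin_ofNumber {v : Fin (2 * ((2 ^ U.K) ^ L) ^ 4)} (hv : ((2 ^ U.K) ^ L) ^ 4 ≤ (v : ℕ)) :
    (U.hasLength_ofNumber L v).toFin = v := by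
  obtain ⟨k, hk⟩ := Nat.exists_eq_add_of_le' hv
  have hlt := v.isLt
  refine Fin.ext ?_
  change value (U.ofNumber L v).digits + _ = _
  rw [hk, ofNumber_add, value_ofNumber (by omega)]

theorem le_toFin {V : U.Vertex} (h : V.HasLength L) : ((2 ^ U.K) ^ L) ^ 4 ≤ (h.toFin : ℕ) :=
  Nat.le_add_left _ _

variable (U x L) in
/-- The switch graph of the instance. -/
noncomputable def graph : SwitchGraph (Fin (2 * ((2 ^ U.K) ^ L) ^ 4)) where
  s₀ v := (hasLength_succ x false (U.hasLength_ofNumber L v)).toFin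
  s₁ v := (hasLength_succ x true (U.hasLength_ofNumber L v)).toFin

theorem edge_graph (b : Bool) (v : Fin (2 * ((2 ^ U.K) ^ L) ^ 4)) :
    (U.graph x L).edge b v = (hasLength_succ x b (U.hasLength_ofNumber L v)).toFin := by
  cases b <;> rfl

theorem edge_toFin (b : Bool) {V : U.Vertex} (h : V.HasLength L) :
    (U.graph x L).edge b h.toFin = (hasLength_succ x b h).toFin := by
  rw [edge_graph, toFin_inj, ofNumber_toFin]

/-- The layer of a vertex. -/
noncomputable def rank (L : ℕ) (V : U.Vertex) : ℕ :=
  match V.kind with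
  | .sim _ => value V.time
  | .chain => (2 ^ U.K) ^ L + value V.time
  | .target => 2 * (2 ^ U.K) ^ L
  | .dump => 2 * (2 ^ U.K) ^ L

theorem rank_of_sim {V : U.Vertex} {q : U.M.State} (h : V.kind = .sim q) :
    rank L V = value V.time := by rw [rank, h]

theorem rank_of_chain {V : U.Vertex} (h : V.kind = .chain) :
    rank L V = (2 ^ U.K) ^ L + value V.time := by rw [rank, h]

theorem rank_of_sink {V : U.Vertex} (h : V.kind = .target ∨ V.kind = .dump) :
    rank L V = 2 * (2 ^ U.K) ^ L := by
  rcases h with h | h <;> rw [rank, h]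

theorem kind_cases (V : U.Vertex) :
    (∃ q, V.kind = .sim q) ∨ V.kind = .chain ∨ V.kind = .target ∨ V.kind = .dump := by
  cases h : V.kind with
  | sim q => exact .inl ⟨q, rfl⟩
  | chain => exact .inr (.inl rfl)
  | target => exact .inr (.inr (.inl rfl))
  | dump => exact .inr (.inr (.inr rfl))

theorem Vertex.HasLength.value_time_lt {V : U.Vertex} (h : V.HasLength L) :
    value V.time < (2 ^ U.K) ^ L := by
  have := value_lt V.time
  rwa [h.time] at this

theorem isSink_of_le_rank {V : U.Vertex} (hV : V.HasLength L)
    (h : 2 * (2 ^ U.K) ^ L ≤ rank L V) : V.kind = .target ∨ V.kind = .dump := by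
  have := hV.value_time_lt
  rcases kind_cases V with ⟨q, hq⟩ | hq | hq
  · rw [rank_of_sim hq] at h
    omega
  · rw [rank_of_chain hq] at h
    omega
  · exact hq

/-- The layer is read off from the kind and the time section alone, and both evolve in the same way
whatever the other sections contain. Hence this holds for malformed vertices too. -/
theorem rank_succ {V : U.Vertex} (hL : 0 < L) (hV : V.HasLength L)
    (h : rank L V < 2 * (2 ^ U.K) ^ L) (b : Bool) :
    rank L (U.succ x b V) = rank L V + 1 ∨ rank L (U.succ x b V) = 2 * (2 ^ U.K) ^ L := by
  have ht := hV.value_time_lt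
  have hT : 0 < (2 ^ U.K) ^ L := by positivity
  rcases kind_cases V with ⟨q, hq⟩ | hq | hq
  · rw [rank_of_sim hq]
    rcases Nat.lt_or_ge (value V.time + 1) ((2 ^ U.K) ^ L) with ht' | ht'
    · left
      rw [succ_of_sim hV hq ht' rfl, rank_of_sim (kind_of_state hL rfl)]
      exact value_carryMap_inc_of_lt (by rwa [hV.time])
    · rw [succ_of_sim_last hV hq (by omega)]
      split_ifs
      · left
        rw [rank_of_chain (kind_kindVertex hL _ _), value_time_kindVertex hT]
        omega
      · exact .inr (rank_of_sink (.inr (kind_kindVertex hL _ _)))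
  · rw [rank_of_chain hq, succ_of_chain hV hq]
    rcases Nat.lt_or_ge (value V.time + 1) ((2 ^ U.K) ^ L) with ht' | ht'
    · rw [decide_eq_false ht'.ne]
      cases b
      · left
        rw [rank_of_chain (kind_of_state hL rfl)]
        dsimp only
        rw [value_carryMap_inc_of_lt (by rwa [hV.time])]
        omega
      · exact .inr (rank_of_sink (.inr (kind_of_state hL rfl)))
    · rw [decide_eq_true (by omega)]
      right
      cases b
      · exact rank_of_sink (.inr (kind_of_state hL rfl))
      · exact rank_of_sink (.inl (kind_of_state hL rfl))
  · rw [rank_of_sink hq] at h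
    omega

/-- A function that increases along all edges except for the loops. -/
noncomputable def height (v : Fin (2 * ((2 ^ U.K) ^ L) ^ 4)) : ℕ :=
  2 * rank L (U.ofNumber L v) + if ((2 ^ U.K) ^ L) ^ 4 ≤ (v : ℕ) then 1 else 0

theorem height_toFin {V : U.Vertex} (h : V.HasLength L) : height h.toFin = 2 * rank L V + 1 := by
  rw [height, ofNumber_toFin, if_pos (le_toFin h)]

/-- All edges lead to numbers with the leading bit. A sink without it is therefore not a loop but
has its edges to its own copy in the same layer; the last summand of `height` makes these edges
increasing as well. -/
theorem height_lt_edge (hL : 0 < L) (b : Bool) (v : Fin (2 * ((2 ^ U.K) ^ L) ^ 4)) :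
    (height v < height ((U.graph x L).edge b v)) ∨
      (((2 ^ U.K) ^ L) ^ 4 ≤ (v : ℕ) ∧ 2 * (2 ^ U.K) ^ L ≤ rank L (U.ofNumber L v)) := by
  rw [edge_graph, height_toFin, height]
  rcases Nat.lt_or_ge (rank L (U.ofNumber L v)) (2 * (2 ^ U.K) ^ L) with h | h
  · left
    rcases rank_succ (x := x) hL (U.hasLength_ofNumber L v) h b with h' | h' <;> rw [h'] <;>
      split_ifs <;> omega
  · by_cases hv : ((2 ^ U.K) ^ L) ^ 4 ≤ (v : ℕ)
    · exact .inr ⟨hv, h⟩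
    · left
      rw [if_neg hv, succ_of_sink (isSink_of_le_rank (U.hasLength_ofNumber L v) h)]
      omega

theorem edge_eq_self {v : Fin (2 * ((2 ^ U.K) ^ L) ^ 4)} (hv : ((2 ^ U.K) ^ L) ^ 4 ≤ (v : ℕ))
    (h : 2 * (2 ^ U.K) ^ L ≤ rank L (U.ofNumber L v)) (b : Bool) :
    (U.graph x L).edge b v = v := by
  rw [edge_graph]
  conv_rhs => rw [← toFin_ofNumber hv]
  rw [toFin_inj, succ_of_sink (isSink_of_le_rank (U.hasLength_ofNumber L v) h)]

theorem height_lt (hL : 0 < L) {v : Fin (2 * ((2 ^ U.K) ^ L) ^ 4)}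
    (hv : ¬ (U.graph x L).IsLeaf v) (b : Bool) :
    height v < height ((U.graph x L).edge b v) := by
  rcases height_lt_edge hL b v with h | ⟨h1, h2⟩
  · exact h
  · exact absurd ⟨edge_eq_self h1 h2 false, edge_eq_self h1 h2 true⟩ hv

theorem acyclic_graph (hL : 0 < L) : (U.graph x L).Acyclic := by
  refine acyclic_of_rank _ (ρ := height) ?_
  rintro u v ⟨hne, h⟩
  obtain ⟨b, rfl⟩ : ∃ b, v = (U.graph x L).edge b u := by
    rcases h with h | h
    exacts [⟨false, h⟩, ⟨true, h⟩]
  exact height_lt hL (fun hu => hne ((U.graph x L).edge_of_isLeaf hu b).symm) b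

theorem rank_of_isLeaf (hL : 0 < L) {v : Fin (2 * ((2 ^ U.K) ^ L) ^ 4)}
    (hv : (U.graph x L).IsLeaf v) : 2 * (2 ^ U.K) ^ L ≤ rank L (U.ofNumber L v) := by
  rcases height_lt_edge (x := x) hL false v with h | h
  · rw [edge_of_isLeaf _ hv] at h
    exact absurd h (lt_irrefl _)
  · exact h.2

variable (U x) in
/-- The instance that the sweeping machine prints. -/
noncomputable def inst (hL : 0 < L) : DigicompInstance where
  size := 2 * ((2 ^ U.K) ^ L) ^ 4
  graph := U.graph x L
  acyclic := acyclic_graph hL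
  source := (U.hasLength_configVertex L U.M.init 0).toFin
  target := (U.hasLength_kindVertex L .target 0).toFin
  balls := 2 ^ (2 ^ U.K) ^ L

theorem encode_inst (hL : 0 < L) : (U.inst x hL).encode = U.instanceCode x L := by
  rw [DigicompInstance.encode, instanceCode, header]
  congr 1
  change (List.finRange (2 * ((2 ^ U.K) ^ L) ^ 4)).flatMap (fun v : Fin (2 * ((2 ^ U.K) ^ L) ^ 4) =>
    U.edges x L (v : ℕ)) = _
  rw [← List.map_coe_finRange_eq_range, List.flatMap_map]

/-! ### The number of balls that reach the target -/

section Flow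

variable {c : Fin (2 * ((2 ^ U.K) ^ L) ^ 4) → ℕ}

/-- The first chain vertex receives as many balls as there are walks to it. -/
theorem flow_chain_zero (hL : 0 < L)
    (hc : ∀ w, c w = (if (U.hasLength_configVertex L U.M.init 0).toFin = w
      then 2 ^ (2 ^ U.K) ^ L else 0) + (U.graph x L).inflow c w) :
    c (U.hasLength_kindVertex L .chain 0).toFin =
      (U.graph x L).paths (U.hasLength_configVertex L U.M.init 0).toFin ((2 ^ U.K) ^ L)
        (U.hasLength_kindVertex L .chain 0).toFin := by
  have hT : 0 < (2 ^ U.K) ^ L := by positivity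
  have h := (U.graph x L).flow_eq_paths (U.hasLength_configVertex L U.M.init 0).toFin hc
    (r := fun v => rank L (U.ofNumber L v)) ?_ ?_ ?_ ((2 ^ U.K) ^ L)
    (w := (U.hasLength_kindVertex L .chain 0).toFin) le_rfl ?_
  · rw [h, Nat.sub_self, pow_zero, one_mul]
  · intro u b hu hle
    rw [edge_graph, ofNumber_toFin] at hle ⊢
    -- Sinks are put in layer `2 * (2 ^ U.K) ^ L`, so edges from or to them do not end in the layers
    -- considered.
    have hlt : rank L (U.ofNumber L u) < 2 * (2 ^ U.K) ^ L := by
      by_contra h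
      rw [succ_of_sink (isSink_of_le_rank (U.hasLength_ofNumber L u) (not_lt.1 h))] at hle
      omega
    rcases rank_succ (x := x) hL (U.hasLength_ofNumber L u) hlt b with h | h <;> omega
  · intro u hu
    have := rank_of_isLeaf hL hu
    omega
  · rw [ofNumber_toFin, rank_of_sim (kind_configVertex hL _ _), value_time_configVertex hT]
  · rw [ofNumber_toFin, rank_of_chain (kind_kindVertex hL _ _), value_time_kindVertex hT, add_zero]

theorem exists_of_flow_pos
    (hc : ∀ w, c w = (if (U.hasLength_configVertex L U.M.init 0).toFin = w
      then 2 ^ (2 ^ U.K) ^ L else 0) + (U.graph x L).inflow c w)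
    {w : Fin (2 * ((2 ^ U.K) ^ L) ^ 4)} (hw : 0 < c w) :
    w = (U.hasLength_configVertex L U.M.init 0).toFin ∨
      ∃ u b, ¬ (U.graph x L).IsLeaf u ∧ (U.graph x L).edge b u = w ∧ 0 < c u := by
  by_cases hs : (U.hasLength_configVertex L U.M.init 0).toFin = w
  · exact .inl hs.symm
  · right
    rw [hc, if_neg hs, zero_add] at hw
    exact (U.graph x L).exists_of_inflow_pos hw

/-- The source and the heads of all edges have the leading bit, so the other copies are never
visited. -/
theorem le_of_flow_pos
    (hc : ∀ w, c w = (if (U.hasLength_configVertex L U.M.init 0).toFin = w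
      then 2 ^ (2 ^ U.K) ^ L else 0) + (U.graph x L).inflow c w)
    {w : Fin (2 * ((2 ^ U.K) ^ L) ^ 4)} (hw : 0 < c w) : ((2 ^ U.K) ^ L) ^ 4 ≤ (w : ℕ) := by
  rcases exists_of_flow_pos hc hw with rfl | ⟨u, b, -, rfl, -⟩
  · exact le_toFin _
  · rw [edge_graph]
    exact le_toFin _

/-- The only chain vertices that receive balls are those without garbage in other sections. -/
theorem chain_of_flow_pos (hL : 0 < L)
    (hc : ∀ w, c w = (if (U.hasLength_configVertex L U.M.init 0).toFin = w
      then 2 ^ (2 ^ U.K) ^ L else 0) + (U.graph x L).inflow c w)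
    {w : Fin (2 * ((2 ^ U.K) ^ L) ^ 4)} (hw : 0 < c w) (hk : (U.ofNumber L w).kind = .chain) :
    U.ofNumber L w = U.kindVertex L .chain (value (U.ofNumber L w).time) := by
  have hT : 0 < (2 ^ U.K) ^ L := by positivity
  -- Going back along visited chain vertices lowers the time, until a vertex is met that was entered
  -- from a configuration at its last time step. Such an entry has erased cells, a uniform state
  -- section and time `0`.
  induction ht : value (U.ofNumber L w).time using Nat.strong_induction_on generalizing w with
  | _ t ih =>
    rcases exists_of_flow_pos hc hw with rfl | ⟨u, b, hu, rfl, hcu⟩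
    · rw [ofNumber_toFin, kind_configVertex hL] at hk
      cases hk
    · rw [edge_graph, ofNumber_toFin] at hk ht ⊢
      have hlen := U.hasLength_ofNumber L (u : ℕ)
      have hlt := hlen.value_time_lt
      rcases kind_cases (U.ofNumber L u) with ⟨q, hq⟩ | hq | hq
      · rcases Nat.lt_or_ge (value (U.ofNumber L u).time + 1) ((2 ^ U.K) ^ L) with ht' | ht'
        · rw [succ_of_sim hlen hq ht' rfl, kind_of_state hL rfl] at hk
          cases hk
        · rw [succ_of_sim_last hlen hq (by omega)] at hk ht ⊢
          rw [kind_kindVertex hL] at hk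
          rw [hk, value_time_kindVertex hT] at ht
          rw [hk, ht]
      · rcases Nat.lt_or_ge (value (U.ofNumber L u).time + 1) ((2 ^ U.K) ^ L) with ht' | ht'
        · have h1 : value (U.succ x b (U.ofNumber L u)).time =
              value (U.ofNumber L u).time + 1 := by
            rw [succ_of_chain hlen hq]
            exact value_carryMap_inc_of_lt (by rwa [hlen.time])
          have h2 := ih (value (U.ofNumber L u).time) (by omega) hcu hq rfl
          rw [h2, succ_chainVertex hL ht'] at hk ⊢
          rw [kind_kindVertex hL] at hk
          rw [hk, ← ht, h1]
        · rw [succ_of_chain hlen hq, decide_eq_true (by omega), kind_of_state hL rfl] at hk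
          cases b <;> cases hk
      · rw [succ_of_sink hq] at hk
        rcases hq with hq | hq <;> rw [hq] at hk <;> cases hk

theorem not_isLeaf_chain (hL : 0 < L) {τ : ℕ} (hτ : τ < (2 ^ U.K) ^ L) :
    ¬ (U.graph x L).IsLeaf (U.hasLength_kindVertex L .chain τ).toFin := by
  intro h
  have := rank_of_isLeaf hL h
  rw [ofNumber_toFin, rank_of_chain (kind_kindVertex hL _ _), value_time_kindVertex hτ] at this
  omega

/-- Vertices that differ in the state digits above which the last one is read can have the same
successor, so the predecessor is unique only among visited vertices. Edge 0 is used first, which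
yields the rounding up. -/
theorem flow_chain_succ (hL : 0 < L)
    (hc : ∀ w, c w = (if (U.hasLength_configVertex L U.M.init 0).toFin = w
      then 2 ^ (2 ^ U.K) ^ L else 0) + (U.graph x L).inflow c w)
    {τ : ℕ} (hτ : τ + 1 < (2 ^ U.K) ^ L) :
    c (U.hasLength_kindVertex L .chain (τ + 1)).toFin =
      (c (U.hasLength_kindVertex L .chain τ).toFin + 1) / 2 := by
  have hT : 0 < (2 ^ U.K) ^ L := by positivity
  have hne : (U.hasLength_configVertex L U.M.init 0).toFin ≠
      (U.hasLength_kindVertex L .chain (τ + 1)).toFin := by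
    rw [Ne, toFin_inj]
    intro h
    have := kind_configVertex hL U.M.init 0
    rw [h, kind_kindVertex hL] at this
    cases this
  rw [hc, if_neg hne, zero_add, (U.graph x L).inflow_eq_of_unique (b₀ := false)
    (u₀ := (U.hasLength_kindVertex L .chain τ).toFin) ?_ (not_isLeaf_chain hL (by omega)) ?_]
  · simp
  · intro u b hu hb hcu
    rw [edge_graph, toFin_inj] at hb
    have hlen := U.hasLength_ofNumber L (u : ℕ)
    have hlt := hlen.value_time_lt
    have hk : (U.succ x b (U.ofNumber L u)).kind = .chain := by
      rw [hb, kind_kindVertex hL]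
    have ht : value (U.succ x b (U.ofNumber L u)).time = τ + 1 := by
      rw [hb, value_time_kindVertex hτ]
    rcases kind_cases (U.ofNumber L u) with ⟨q, hq⟩ | hq | hq
    · rcases Nat.lt_or_ge (value (U.ofNumber L u).time + 1) ((2 ^ U.K) ^ L) with ht' | ht'
      · rw [succ_of_sim hlen hq ht' rfl, kind_of_state hL rfl] at hk
        cases hk
      · rw [succ_of_sim_last hlen hq (by omega), value_time_kindVertex hT] at ht
        omega
    · have h2 := chain_of_flow_pos hL hc hcu hq
      rcases Nat.lt_or_ge (value (U.ofNumber L u).time + 1) ((2 ^ U.K) ^ L) with ht' | ht'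
      · rw [h2, succ_chainVertex hL ht'] at hk ht
        rw [value_time_kindVertex ht'] at ht
        rw [kind_kindVertex hL] at hk
        refine ⟨?_, ?_⟩
        · rw [← toFin_ofNumber (le_of_flow_pos hc hcu), toFin_inj, h2]
          congr 1
          omega
        · cases b
          · rfl
          · cases hk
      · rw [succ_of_chain hlen hq, decide_eq_true (by omega), kind_of_state hL rfl] at hk
        cases b <;> cases hk
    · rw [succ_of_sink hq] at hk
      rcases hq with hq | hq <;> rw [hq] at hk <;> cases hk
  · rw [edge_toFin, toFin_inj, succ_chainVertex hL hτ]
    rfl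

/-- Edge 1 of the last chain vertex takes every second ball, beginning with the second one, which
yields the rounding down. -/
theorem flow_target (hL : 0 < L)
    (hc : ∀ w, c w = (if (U.hasLength_configVertex L U.M.init 0).toFin = w
      then 2 ^ (2 ^ U.K) ^ L else 0) + (U.graph x L).inflow c w)
    {τ : ℕ} (hτ : τ + 1 = (2 ^ U.K) ^ L) :
    c (U.hasLength_kindVertex L .target 0).toFin =
      c (U.hasLength_kindVertex L .chain τ).toFin / 2 := by
  have hne : (U.hasLength_configVertex L U.M.init 0).toFin ≠
      (U.hasLength_kindVertex L .target 0).toFin := by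
    rw [Ne, toFin_inj]
    intro h
    have := kind_configVertex hL U.M.init 0
    rw [h, kind_kindVertex hL] at this
    cases this
  rw [hc, if_neg hne, zero_add, (U.graph x L).inflow_eq_of_unique (b₀ := true)
    (u₀ := (U.hasLength_kindVertex L .chain τ).toFin) ?_ (not_isLeaf_chain hL (by omega)) ?_]
  · simp
  · intro u b hu hb hcu
    rw [edge_graph, toFin_inj] at hb
    have hlen := U.hasLength_ofNumber L (u : ℕ)
    have hlt := hlen.value_time_lt
    have hk : (U.succ x b (U.ofNumber L u)).kind = .target := by
      rw [hb, kind_kindVertex hL]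
    rcases kind_cases (U.ofNumber L u) with ⟨q, hq⟩ | hq | hq
    · rcases Nat.lt_or_ge (value (U.ofNumber L u).time + 1) ((2 ^ U.K) ^ L) with ht' | ht'
      · rw [succ_of_sim hlen hq ht' rfl, kind_of_state hL rfl] at hk
        cases hk
      · rw [succ_of_sim_last hlen hq (by omega), kind_kindVertex hL] at hk
        split_ifs at hk
    · have h2 := chain_of_flow_pos hL hc hcu hq
      rcases Nat.lt_or_ge (value (U.ofNumber L u).time + 1) ((2 ^ U.K) ^ L) with ht' | ht'
      · rw [h2, succ_chainVertex hL ht', kind_kindVertex hL] at hk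
        cases b <;> cases hk
      · rw [succ_of_chain hlen hq, decide_eq_true (by omega), kind_of_state hL rfl] at hk
        refine ⟨?_, ?_⟩
        · rw [← toFin_ofNumber (le_of_flow_pos hc hcu), toFin_inj, h2]
          congr 1
          omega
        · cases b
          · cases hk
          · rfl
    -- A visited sink has the leading bit, hence is a leaf, and leaves do not contribute to
    -- `inflow`.
    · exact absurd ⟨edge_eq_self (le_of_flow_pos hc hcu) (rank_of_sink hq).ge false,
        edge_eq_self (le_of_flow_pos hc hcu) (rank_of_sink hq).ge true⟩ hu
  · rw [edge_toFin, toFin_inj, succ_chainVertex_last hL hτ]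
    rfl

/-- For natural numbers, `k < ⌈a / 2⌉` if and only if `2 * k < a`, so the roundings along the chain
do not affect a strict comparison. The last vertex must get more than one ball for the target to get
any, so the comparison starts with `k = 1`. -/
theorem flow_target_pos_iff (hL : 0 < L)
    (hc : ∀ w, c w = (if (U.hasLength_configVertex L U.M.init 0).toFin = w
      then 2 ^ (2 ^ U.K) ^ L else 0) + (U.graph x L).inflow c w) :
    0 < c (U.hasLength_kindVertex L .target 0).toFin ↔
      2 ^ (2 ^ U.K) ^ L < 2 * c (U.hasLength_kindVertex L .chain 0).toFin := by
  have h : ∀ τ < (2 ^ U.K) ^ L, ∀ k, k < c (U.hasLength_kindVertex L .chain τ).toFin ↔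
      2 ^ τ * k < c (U.hasLength_kindVertex L .chain 0).toFin := by
    intro τ
    induction τ with
    | zero => intro _ k; simp
    | succ τ ih =>
      intro hτ k
      rw [flow_chain_succ hL hc hτ, pow_succ, mul_assoc, ← ih (by omega) (2 * k)]
      omega
  have hT : 0 < (2 ^ U.K) ^ L := by positivity
  obtain ⟨τ, hτ⟩ : ∃ τ, τ + 1 = (2 ^ U.K) ^ L := ⟨(2 ^ U.K) ^ L - 1, by omega⟩
  rw [flow_target hL hc hτ]
  have := h τ (by omega) 1
  rw [← hτ, pow_succ]
  omega

end Flow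

end Coding

/-! ## Acceptance probabilities -/

namespace Machine

section Run

variable {C : Type} {M : Machine C} {x : List Bool}

theorem run_append (cs ds : List C) :
    M.run x (cs ++ ds) = ds.foldl (M.step x) (M.run x cs) := List.foldl_append

theorem run_concat (cs : List C) (b : C) : M.run x (cs ++ [b]) = M.step x (M.run x cs) b :=
  run_append cs [b]

theorem inputHead_run_le (cs : List C) : (M.run x cs).inputHead ≤ x.length + 1 := by
  induction cs using List.reverseRecOn with
  | nil => exact Nat.zero_le _
  | append_singleton cs b ih =>
    rw [run_concat, step]
    split_ifs
    · exact ih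
    · exact min_le_right _ _

theorem run_append_of_haltsAfter {cs : List C} (h : M.HaltsAfter x cs) (ds : List C) :
    M.run x (cs ++ ds) = M.run x cs := by
  induction ds using List.reverseRecOn with
  | nil => rw [List.append_nil]
  | append_singleton ds b ih => rw [← List.append_assoc, run_concat, ih, step,
      if_pos (show _ ∈ _ from h)]

end Run

variable {M : Machine Bool} {accept : Set M.State} {x : List Bool}

open Classical in
theorem acceptProb_eq_sum (T : ℕ) : M.acceptProb accept x T =
    ((∑ ω : Fin T → Bool, if (M.run x (List.ofFn ω)).state ∈ accept then 1 else 0 : ℕ) : ℚ) /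
      2 ^ T := by
  rw [acceptProb, Nat.card_eq_fintype_card, Fintype.card_subtype, Finset.card_filter]

/-- A coin tossed after halting changes nothing, so the number of accepting sequences doubles
together with the number of all sequences. -/
theorem acceptProb_succ {T : ℕ} (h : ∀ cs : List Bool, cs.length = T → M.HaltsAfter x cs) :
    M.acceptProb accept x (T + 1) = M.acceptProb accept x T := by
  classical
  have hr : ∀ (b : Bool) (ω : Fin T → Bool),
      M.run x (List.ofFn (Fin.snocEquiv (fun _ : Fin (T + 1) => Bool) (b, ω))) =
        M.run x (List.ofFn ω) := by
    intro b ω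
    rw [List.ofFn_succ', ← run_append_of_haltsAfter (h (List.ofFn ω) (by simp)) [b]]
    simp [Fin.snocEquiv]
  rw [acceptProb_eq_sum, acceptProb_eq_sum,
    ← (Fin.snocEquiv fun _ : Fin (T + 1) => Bool).sum_comp, Fintype.sum_prod_type_right]
  simp only [hr, Fintype.sum_bool, ← two_mul, ← Finset.mul_sum]
  rw [pow_succ', Nat.cast_mul, Nat.cast_two]
  exact mul_div_mul_left _ _ two_ne_zero

/-- This allows the polynomial time bound to be replaced by `(2 ^ U.K) ^ L`, the period of the time
section. -/
theorem acceptProb_of_le {T T' : ℕ} (h : ∀ cs : List Bool, cs.length = T → M.HaltsAfter x cs)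
    (hT : T ≤ T') : M.acceptProb accept x T' = M.acceptProb accept x T := by
  induction T', hT using Nat.le_induction with
  | base => rfl
  | succ n hn ih =>
    rw [acceptProb_succ, ih]
    intro cs hcs
    have := h (cs.take T) (by simp; omega)
    rw [HaltsAfter, ← List.take_append_drop T cs, run_append_of_haltsAfter this]
    exact this

open Classical in
theorem half_lt_acceptProb_iff (T : ℕ) : 1 / 2 < M.acceptProb accept x T ↔
    2 ^ T < 2 * ∑ ω : Fin T → Bool, if (M.run x (List.ofFn ω)).state ∈ accept then 1 else 0 := by
  rw [acceptProb_eq_sum, div_lt_div_iff₀ two_pos (by positivity), one_mul, mul_comm]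
  exact_mod_cast Iff.rfl

end Machine

/-! ## Correctness of the reduction -/

namespace Coding

open Digit Vertex SwitchGraph

variable {U : Coding} {x : List Bool} {L : ℕ}

theorem walk_eq (hL : 0 < L) (hγ : ∀ cs i, (U.M.run x cs).head i < L)
    (hx : x.length + 1 < (2 ^ U.K) ^ L) (cs : List Bool) (hcs : cs.length < (2 ^ U.K) ^ L) :
    (U.graph x L).walk (U.hasLength_configVertex L U.M.init 0).toFin cs =
      (U.hasLength_configVertex L (U.M.run x cs) cs.length).toFin := by
  induction cs using List.reverseRecOn with
  | nil => rfl
  | append_singleton cs b ih =>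
    rw [List.length_append, List.length_singleton] at hcs
    rw [walk] at ih ⊢
    rw [List.foldl_append, ih (by omega), List.foldl_cons, List.foldl_nil, edge_toFin, toFin_inj,
      succ_configVertex hL (hγ cs) (Machine.inputHead_run_le cs) hx hcs, Machine.run_concat,
      List.length_append, List.length_singleton]

theorem walk_eq_chain_iff (hL : 0 < L) (hγ : ∀ cs i, (U.M.run x cs).head i < L)
    (hx : x.length + 1 < (2 ^ U.K) ^ L) (cs : List Bool) (hcs : cs.length = (2 ^ U.K) ^ L) :
    (U.graph x L).walk (U.hasLength_configVertex L U.M.init 0).toFin cs =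
      (U.hasLength_kindVertex L .chain 0).toFin ↔ (U.M.run x cs).state ∈ U.accept := by
  have hT : 0 < (2 ^ U.K) ^ L := by positivity
  induction cs using List.reverseRecOn with
  | nil => exact absurd hcs hT.ne
  | append_singleton cs b _ =>
    rw [List.length_append, List.length_singleton] at hcs
    have h := walk_eq hL hγ hx cs (by omega)
    rw [walk] at h ⊢
    rw [List.foldl_append, h, List.foldl_cons, List.foldl_nil, edge_toFin, toFin_inj,
      succ_configVertex_last hL (hγ cs) (Machine.inputHead_run_le cs) hx hcs, Machine.run_concat]
    split_ifs with ha
    · simp [ha]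
    · refine iff_of_false (fun he => ?_) ha
      have := congrArg Vertex.kind he
      rw [kind_kindVertex hL, kind_kindVertex hL] at this
      cases this

theorem isYes_inst_iff (hL : 0 < L) (hγ : ∀ cs i, (U.M.run x cs).head i < L)
    (hx : x.length + 1 < (2 ^ U.K) ^ L) :
    (U.inst x hL).IsYes ↔ 1 / 2 < U.M.acceptProb U.accept x ((2 ^ U.K) ^ L) := by
  obtain ⟨c, hc, h⟩ := (U.graph x L).exists_flow (U.hasLength_configVertex L U.M.init 0).toFin
    (ρ := height) (fun u hu => ⟨height_lt hL hu false, height_lt hL hu true⟩)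
    (2 ^ (2 ^ U.K) ^ L)
  refine (h _).trans ((flow_target_pos_iff hL hc).trans ?_)
  rw [flow_chain_zero hL hc, Machine.half_lt_acceptProb_iff, paths]
  have e : ∀ ω : Fin ((2 ^ U.K) ^ L) → Bool,
      (U.graph x L).walk (U.hasLength_configVertex L U.M.init 0).toFin (List.ofFn ω) =
        (U.hasLength_kindVertex L .chain 0).toFin ↔ (U.M.run x (List.ofFn ω)).state ∈ U.accept :=
    fun ω => walk_eq_chain_iff hL hγ hx _ List.length_ofFn
  classical
  rw [Finset.sum_congr rfl fun ω _ => if_congr (e ω) rfl rfl]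

end Coding

/-! ## The choice of the parameters -/

/-- The base `n + 2` is at least `2` for every `n`, so that coefficients and sums can be absorbed by
the exponent. -/
theorem Polynomial.exists_eval_le_pow (p : Polynomial ℕ) :
    ∃ e : ℕ, ∀ n : ℕ, p.eval n ≤ (n + 2) ^ e := by
  induction p using Polynomial.induction_on' with
  | add p q hp hq =>
    obtain ⟨a, ha⟩ := hp
    obtain ⟨b, hb⟩ := hq
    refine ⟨max a b + 1, fun n => ?_⟩
    rw [eval_add, pow_succ]
    have h1 := (ha n).trans (Nat.pow_le_pow_right (by omega) (le_max_left a b))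
    have h2 := (hb n).trans (Nat.pow_le_pow_right (by omega) (le_max_right a b))
    nlinarith [Nat.zero_le ((n + 2) ^ max a b * n)]
  | monomial k a =>
    refine ⟨a + k, fun n => ?_⟩
    rw [eval_monomial, pow_add]
    exact Nat.mul_le_mul (Nat.lt_two_pow_self.le.trans (Nat.pow_le_pow_left (by omega) a))
      (Nat.pow_le_pow_left (by omega) k)

theorem exists_injective_digit (α : Type) [Finite α] :
    ∃ K₀ : ℕ, ∀ K ≥ K₀, ∃ f : α → Digit K, Function.Injective f := by
  refine ⟨Nat.card α, fun K hK => ⟨fun a => Fin.castLE ?_ (Finite.equivFin α a), ?_⟩⟩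
  · exact hK.le.trans Nat.lt_two_pow_self.le
  · exact (Fin.castLE_injective _).comp (Finite.equivFin α).injective

namespace Coding

open Digit

/-- `K` depends on the machine alone and is fixed before `m`, because the number of segments is
later chosen in terms of `K`. -/
theorem exists_coding (M : Machine Bool) (accept : Set M.State) :
    ∃ K : ℕ, 0 < K ∧ ∀ m, ∃ U : Coding, U.K = K ∧ U.m = m ∧
      ∃ h : U.M = M, h ▸ U.accept = accept := by
  have := M.finite_tape
  have := M.finite_state
  have := M.finite_symbol
  obtain ⟨a, ha⟩ := exists_injective_digit (M.Tape → M.Symbol × Bool)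
  obtain ⟨b, hb⟩ := exists_injective_digit (Kind M.State)
  obtain ⟨f, hf⟩ := ha (a + b + 1) (by omega)
  obtain ⟨g, hg⟩ := hb (a + b + 1) (by omega)
  exact ⟨a + b + 1, by omega, fun m => ⟨⟨M, accept, a + b + 1, by omega, f, hf, g, hg, m⟩,
    rfl, rfl, rfl, rfl⟩⟩

variable (U : Coding)

/-- The length of the sections of the vertices for an input. -/
def sectionLength (x : List Bool) : ℕ := (U.m + 1) * (count U.K (x.length + 1)).length

theorem sectionLength_pos (x : List Bool) : 0 < U.sectionLength x := length_pos rfl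

theorem lt_pow_sectionLength (x : List Bool) : x.length + 1 < (2 ^ U.K) ^ U.sectionLength x :=
  (lt_pow_length_count U.K_pos _).trans_le
    (Nat.pow_le_pow_right (by positivity) (Nat.le_mul_of_pos_left _ (Nat.succ_pos _)))

theorem pow_le_pow_sectionLength {e : ℕ} (he : e ≤ U.m) (x : List Bool) :
    (x.length + 2) ^ e ≤ (2 ^ U.K) ^ U.sectionLength x := by
  rw [sectionLength, mul_comm, pow_mul]
  exact (Nat.pow_le_pow_left (lt_pow_length_count U.K_pos _) e).trans
    (Nat.pow_le_pow_right (by positivity) (by omega))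

/-- A segment of `d` digits satisfies `x.length + 1 < 2 ^ (K * d)`, so `K` segments are longer than
the logarithm, and `c * K` segments hold all cells that the machine visits. -/
theorem mul_log_le_sectionLength {c : ℕ} (hc : c * U.K ≤ U.m) (x : List Bool) :
    c * (Nat.log 2 x.length + 1) ≤ U.sectionLength x := by
  have h1 := lt_pow_length_count U.K_pos (x.length + 1)
  rw [← pow_mul] at h1
  have h2 : Nat.log 2 x.length < U.K * (count U.K (x.length + 1)).length := by
    rcases Nat.eq_zero_or_pos x.length with h | h
    · refine (congrArg (Nat.log 2) h).trans (Nat.log_zero_right 2) |>.trans_lt ?_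
      refine Nat.pos_of_ne_zero fun h0 => ?_
      rw [h0] at h1
      omega
    · exact Nat.log_lt_of_lt_pow h.ne' (by omega)
  refine (Nat.mul_le_mul_left c h2).trans ?_
  rw [← mul_assoc, sectionLength]
  exact Nat.mul_le_mul_right _ (by omega)

theorem sectionLength_le (x : List Bool) :
    4 * U.sectionLength x ≤ 8 * (U.m + 1) * (Nat.log 2 x.length + 1) := by
  have h1 := length_count_le U.K_pos (x.length + 1)
  have h2 : Nat.log 2 (x.length + 1) ≤ Nat.log 2 x.length + 1 := by
    refine (Nat.log_mono_right (Nat.lt_pow_succ_log_self one_lt_two x.length)).trans ?_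
    rw [Nat.log_pow one_lt_two]
  rw [sectionLength]
  have h3 : (U.m + 1) * (count U.K (x.length + 1)).length ≤
      (U.m + 1) * (2 * (Nat.log 2 x.length + 1)) := Nat.mul_le_mul_left _ (by omega)
  linarith

theorem logSpaceComputable_instanceCode :
    LogSpaceComputable fun x => U.instanceCode x (U.sectionLength x) := by
  refine Sweeper.logSpaceComputable U.sweeper (8 * (U.m + 1)) fun x => ?_
  obtain ⟨c, h1, h2, h3⟩ := U.reaches_done (x := x) rfl
  exact ⟨c, h1, h2, h3.mono (U.sectionLength_le x)⟩

end Coding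

theorem proposition2 : PLHard DigicompEXP := by
  rintro L ⟨M, accept, p, ⟨c, hc⟩, hp, hL⟩
  obtain ⟨e, he⟩ := p.exists_eval_le_pow
  obtain ⟨K, hK, hU⟩ := Coding.exists_coding M accept
  -- The summand `c * K` provides room for the work tapes, and `e` makes the time bound exceed the
  -- polynomial.
  obtain ⟨U, rfl, hm, rfl, rfl⟩ := hU (c * K + e)
  refine ⟨_, U.logSpaceComputable_instanceCode, fun x => ?_⟩
  have hiff : (U.inst x (U.sectionLength_pos x)).IsYes ↔ x ∈ L := by
    rw [hL, Coding.isYes_inst_iff _ (fun cs i => (hc x cs i).trans_le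
      (U.mul_log_le_sectionLength (by omega) x)) (U.lt_pow_sectionLength x),
      Machine.acceptProb_of_le (hp x)
        ((he x.length).trans (U.pow_le_pow_sectionLength (by omega) x))]
  exact ⟨fun h => ⟨_, Coding.encode_inst _, hiff.2 h⟩,
    fun h => ⟨_, Coding.encode_inst _, fun hy => h (hiff.1 hy)⟩⟩
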